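/- Identify the unit circle $\mathcal C$ of $\mathbb R^2$ with the complex numbers of modulus one, let $d$ be the geodesic distance on $\mathcal C$, $d_\infty(\mathbf x,\mathbf y)=\max_i d(x_i,y_i)$, let $\mathcal O$ be the orthogonal group of $\mathbb R^2$, $\mathcal C_N=\{e^{2\iota\pi k/N}:0\le k<N\}$, and let $\boldsymbol\Pi_n=\{(e^{2\iota\pi\sigma(j)/n})_{1\le j\le n}:\sigma \text{ a permutation of } [n]\}$ be the set of regular positions. **Model.** Let $n$ be a multiple of $4$, $n_0=n/4$, $\mathbf x^*\in\mathcal C^n$ and $f(x,y)=1-d(x,y)/(2\pi)$. One observes a random symmetric matrix $A\in\mathbb R^{n\times n}$ with $A_{ii}=0$ and $A_{ij}=f(x_i^*,x_j^*)+E_{ij}$ for $i<j$, where the $E_{ij}$, $i<j$, are independent, centered and subGaussian(1): $\mathbb P\big[\sum_{i<j}B_{ij}E_{ij}>t\,(\sum_{i<j}B_{ij}^2)^{1/2}\big]\le e^{-t^2/2}$ for every real matrix $B$ and every $t\ge0$. **Spectral localization.** Input: a subset $S=\{i_1<\dots<i_{n_0}\}$ of $[n]$ and $A_{SS}$. (i)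 Compute two orthonormal eigenvectors $\hat u,\hat v\in\mathbb R^{n_0}$ of $A_{SS}$ associated with its second and third largest eigenvalues (counted with multiplicity), and set $w_\ell=\sqrt{n_0/2}\,(\hat u_\ell,\hat v_\ell)\in\mathbb R^2$, $z_\ell=w_\ell/\|w_\ell\|_2$ (any point of $\mathcal C$ if $w_\ell=0$). (ii) Pick a permutation $\sigma$ such that $z_{\sigma(1)},\dots,z_{\sigma(n_0)}$ is in trigonometric order. (iii) Choose $\hat k\in\operatorname{argmin}_{k\in[n_0]}\sum_{\ell}\|e^{2\iota\pi(k+\ell)/n_0}-z_{\sigma(\ell)}\|_1$ and set $\tilde x^{(1)}_{i_{\sigma(\ell)}}=e^{2\iota\pi(\hat k+\ell)/n_0}$ for $\ell=1,\dots,n_0$. Where these choices are not unique, they are made by a fixed measurable rule from $S$ and $A_{SS}$. **Spectral Localize-and-Refine.** Independently of $A$, pick $S\subset[n]$ uniformly among the subsets of cardinality $n_0$, then $S'\subset\overline S$ uniformly among the subsets of $\overline S$ of cardinality $n_0$. Let $\tilde{\mathbf x}^{(1)}_S$ and $\tilde{\mathbf x}^{(1')}_{S'}$ be the spectral localizations computed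 from $A_{SS}$ and $A_{S'S'}$. Choose $$\hat x^{(2)}_i\in\operatorname*{argmin}_{z\in\mathcal C_{n_0}}\sum_{j\in S}A_{ij}\,d(z,\tilde x^{(1)}_j)\ \ (i\in\overline S),\qquad \hat x^{(2')}_i\in\operatorname*{argmin}_{z\in\mathcal C_{n_0}}\sum_{j\in S'}A_{ij}\,d(z,\tilde x^{(1')}_j)\ \ (i\in\overline{S'}),$$ $$\hat Q\in\operatorname*{argmin}_{Q\in\mathcal O}\ \max_{i\in\overline S\cap\overline{S'}}d\big(\hat x^{(2)}_i,Q\hat x^{(2')}_i\big),$$ and output $\hat{\mathbf x}\in\mathcal C^n$ with $\hat x_j=\hat x_j^{(2)}$ for $j\in\overline S$ and $\hat x_j=\hat Q\hat x_j^{(2')}$ for $j\in S$. **Claim.** For every $c_a\ge0$ there are constants $C_a>0$ and $C_a'$, depending only on $c_a$, such that for every multiple $n\ge C_a'$ of $4$, every $\mathbf x^*\in\mathcal C^n$ with $$\min_{\mathbf y\in\boldsymbol\Pi_n}d_\infty(\mathbf x^*,\mathbf y)\le c_a\sqrt{\frac{\log n}{n}}$$ and every noise as above, with probability at least $1-9/n^2$,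 every output $\hat{\mathbf x}$ of the spectral Localize-and-Refine procedure (whatever the minimizers $\hat x^{(2)}_i$, $\hat x^{(2')}_i$, $\hat Q$) satisfies $$\min_{Q\in\mathcal O}d_\infty(\hat{\mathbf x},Q\mathbf x^*)\le C_a\sqrt{\frac{\log n}{n}}.$$ -/

import Mathlib

open MeasureTheory ProbabilityTheory

namespace Seriation

/-! ### The circle, its geodesic distance and its isometries

Points of the unit circle of `ℝ² = ℂ` are elements of Mathlib's `Circle`. -/

/-- The argument of `x` in `[0, 2π)`. -/
noncomputable def argument (x : Circle) : ℝ :=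
  toIcoMod Real.two_pi_pos 0 (Complex.arg (x : ℂ))

/-- The geodesic distance on the circle. -/
noncomputable def geoDist (x y : Circle) : ℝ :=
  min |argument x - argument y| (2 * Real.pi - |argument x - argument y|)

/-- The distance `d_∞` between two tuples indexed by a finite set, the maximum of the
coordinatewise distances. -/
noncomputable def dInf {ι : Type*} [Fintype ι] (x y : ι → Circle) : ℝ :=
  ⨆ i, geoDist (x i) (y i)

/-- The action on the circle of an orthogonal transformation of `ℝ² = ℂ`. The orthogonal group is
the group `ℂ ≃ₗᵢ[ℝ] ℂ` of real linear isometries of the plane. -/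
noncomputable def act (Q : ℂ ≃ₗᵢ[ℝ] ℂ) (x : Circle) : Circle :=
  ⟨Q (x : ℂ), by simp [Submonoid.unitSphere, Circle.norm_coe]⟩

/-- The point of argument `2πk/N`, for an integer `k`. -/
noncomputable def root (N k : ℕ) : Circle :=
  Circle.exp (2 * Real.pi * k / N)

/-- The regular grid with `N` points on the circle. -/
def grid (N : ℕ) : Set Circle :=
  Set.range fun k : Fin N => root N k

/-- The set of regular positions: the enumerations of the regular grid. -/
def regularPositions (n : ℕ) : Set (Fin n → Circle) :=
  {x | ∃ σ : Equiv.Perm (Fin n), ∀ j, x j = root n (σ j)}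

/-- The `d_∞`-distance of a tuple to the (finite) set of regular positions. -/
noncomputable def distToRegular {n : ℕ} (x : Fin n → Circle) : ℝ :=
  ⨅ y : regularPositions n, dInf x y.1

/-! ### The latent space model -/

/-- The affine affinity function. -/
noncomputable def affinity (x y : Circle) : ℝ :=
  1 - geoDist x y / (2 * Real.pi)

/-- The pairs `(i, j)` with `i < j`. -/
abbrev UpperPair (n : ℕ) : Type :=
  {p : Fin n × Fin n // p.1 < p.2}

/-- The random matrix `A` follows the latent space model with positions `x` and affinity `f`: it is
symmetric with null diagonal, `A i j` has mean `f (x i) (x j)` for `i < j`, and the noise entries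
`A i j - f (x i) (x j)`, `i < j`, are independent and subGaussian(1), that is to say, their linear
combinations have the tails of a Gaussian variable. -/
structure IsLatentModel {Ω : Type*} [MeasurableSpace Ω] (P : Measure Ω) {n : ℕ}
    (f : Circle → Circle → ℝ) (x : Fin n → Circle) (A : Ω → Fin n → Fin n → ℝ) : Prop where
  measurable : Measurable A
  symm : ∀ ω i j, A ω i j = A ω j i
  diag : ∀ ω i, A ω i i = 0
  integrable : ∀ p : UpperPair n, Integrable (fun ω => A ω p.1.1 p.1.2) P
  mean : ∀ p : UpperPair n, ∫ ω, A ω p.1.1 p.1.2 ∂P = f (x p.1.1) (x p.1.2)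
  indep : iIndepFun (fun (p : UpperPair n) ω => A ω p.1.1 p.1.2 - f (x p.1.1) (x p.1.2)) P
  subgaussian : ∀ (B : UpperPair n → ℝ) (t : ℝ), 0 ≤ t →
    P.real {ω | t * Real.sqrt (∑ p, B p ^ 2) <
      ∑ p, B p * (A ω p.1.1 p.1.2 - f (x p.1.1) (x p.1.2))} ≤ Real.exp (-t ^ 2 / 2)

/-! ### Sample splitting -/

/-- The pairs `(S, S')` of disjoint subsets of cardinality `n / 4` of the index set. -/
abbrev Split (n : ℕ) : Type :=
  {p : Finset (Fin n) × Finset (Fin n) // p.1.card = n / 4 ∧ p.2.card = n / 4 ∧ Disjoint p.1 p.2}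

/-- The random pair `T = (S, S')` is independent of the data and uniformly distributed.
Equivalently (as the number of choices of `S'` does not depend on `S`), the subset `S` is picked
uniformly among those of cardinality `n / 4`, then `S'` uniformly among the subsets of cardinality
`n / 4` of the complement of `S`. -/
structure IsUniformSplit {Ω : Type*} [MeasurableSpace Ω] (P : Measure Ω) {n : ℕ}
    (A : Ω → Fin n → Fin n → ℝ) (T : Ω → Split n) : Prop where
  measurable : Measurable T
  uniform : ∀ t : Split n, P.real {ω | T ω = t} = 1 / (Nat.card (Split n) : ℝ)
  indep : IndepFun A T P

/-- For `S = {i_1 < ... < i_N}`, the matrix `A_SS`, indexed by `Fin N`. -/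
def block {n N : ℕ} (S : Finset (Fin n)) (hS : S.card = N) (A : Fin n → Fin n → ℝ) :
    Fin N → Fin N → ℝ :=
  fun k l => A (S.orderEmbOfFin hS k) (S.orderEmbOfFin hS l)

/-! ### Spectral localization -/

/-- `w` is an output of the vanilla spectral algorithm on the symmetric matrix `M`: it is given by
two orthonormal eigenvectors `u, v` for the second and third eigenvalues of `M`, these being sorted
in nonincreasing order and counted with multiplicity. -/
def IsVSA {N : ℕ} (M : Fin N → Fin N → ℝ) (w : Fin N → ℂ) : Prop :=
  ∃ (hM : (Matrix.of M).IsHermitian) (hN : 2 < Fintype.card (Fin N)) (u v : Fin N → ℝ),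
    (Matrix.of M).mulVec u = hM.eigenvalues₀ ⟨1, by omega⟩ • u ∧
    (Matrix.of M).mulVec v = hM.eigenvalues₀ ⟨2, hN⟩ • v ∧
    u ⬝ᵥ u = 1 ∧ v ⬝ᵥ v = 1 ∧ u ⬝ᵥ v = 0 ∧
    ∀ l, w l = ⟨Real.sqrt (N / 2) * u l, Real.sqrt (N / 2) * v l⟩

/-- The `ℓ¹` norm of `ℝ² = ℂ`. -/
noncomputable def l1Norm (z : ℂ) : ℝ := |z.re| + |z.im|

/-- The criterion minimized by the shift `k` in the uniform approximation step. -/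
noncomputable def shiftCost {N : ℕ} (z : Fin N → Circle) (σ : Equiv.Perm (Fin N)) (k : Fin N) : ℝ :=
  ∑ l : Fin N, l1Norm ((root N (k + l) : ℂ) - (z (σ l) : ℂ))

/-- `y` is an output of the uniform approximation step on the input `w`: `z l` is `w l / ‖w l‖`
(any point of the circle if `w l = 0`), `σ` sorts the points `z l` in trigonometric order, and the
point of rank `l` is sent to the `l`-th point of the regular grid, after the best shift `k`.
Ranks and shifts run through `{0, ..., N - 1}` instead of `{1, ..., N}`, which gives the same
outputs because `root N` has period `N`. -/
def IsUniformApprox {N : ℕ} (w : Fin N → ℂ) (y : Fin N → Circle) : Prop :=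
  ∃ (z : Fin N → Circle) (σ : Equiv.Perm (Fin N)) (k : Fin N),
    (∀ l, ((‖w l‖ : ℝ) : ℂ) * (z l : ℂ) = w l) ∧
    Monotone (fun l => argument (z (σ l))) ∧
    (∀ k', shiftCost z σ k ≤ shiftCost z σ k') ∧
    ∀ l, y (σ l) = root N (k + l)

/-- `y` is an output of spectral localization on the data matrix `M`. -/
def IsSpectralLocalization {N : ℕ} (M : Fin N → Fin N → ℝ) (y : Fin N → Circle) : Prop :=
  ∃ w, IsVSA M w ∧ IsUniformApprox w y

/-- An implementation of spectral localization: a measurable way of computing, from a subset `S` and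
the data matrix `A_SS`, one of the outputs of the procedure (eigenvectors, and permutations in the
presence of ties, are not unique). The points of `S` are listed in increasing order. -/
structure IsSpectralLocalizer {n : ℕ}
    (loc : Finset (Fin n) → (Fin (n / 4) → Fin (n / 4) → ℝ) → Fin (n / 4) → Circle) : Prop where
  measurable : ∀ S l, Measurable fun M => (loc S M l : ℂ)
  output : ∀ S M, (∀ i j, M i j = M j i) → IsSpectralLocalization M (loc S M)

/-! ### Refinement, merging, and the whole procedure -/

/-- `z` minimizes over the grid with `|S|` points the scalar product of `A_{i,S}` with the vector of
the distances between `z` and the initial positions `y` of the points of `S`. -/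
def IsRefined {n N : ℕ} (A : Fin n → Fin n → ℝ) (S : Finset (Fin n)) (hS : S.card = N)
    (y : Fin N → Circle) (i : Fin n) (z : Circle) : Prop :=
  z ∈ grid N ∧
    IsMinOn (fun z' => ∑ l : Fin N, A i (S.orderEmbOfFin hS l) * geoDist z' (y l)) (grid N) z

/-- `Q` minimizes, among the orthogonal transformations, the `d_∞`-distance between `x` and `Q x'`
on the indices that lie neither in `S` nor in `S'`. -/
def IsSynchronization {n : ℕ} (S S' : Finset (Fin n)) (x x' : Fin n → Circle)
    (Q : ℂ ≃ₗᵢ[ℝ] ℂ) : Prop :=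
  ∀ Q' : ℂ ≃ₗᵢ[ℝ] ℂ,
    dInf (fun i : {i // i ∉ S ∧ i ∉ S'} => x i) (fun i => act Q (x' i)) ≤
      dInf (fun i : {i // i ∉ S ∧ i ∉ S'} => x i) (fun i => act Q' (x' i))

/-- `xhat` is an output of the spectral Localize-and-Refine procedure on the data `A`, with the
subsets `T = (S, S')` and the implementation `loc` of spectral localization. -/
def IsOutput {n : ℕ}
    (loc : Finset (Fin n) → (Fin (n / 4) → Fin (n / 4) → ℝ) → Fin (n / 4) → Circle)
    (A : Fin n → Fin n → ℝ) (T : Split n) (xhat : Fin n → Circle) : Prop :=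
  ∃ (x2 x2' : Fin n → Circle) (Q : ℂ ≃ₗᵢ[ℝ] ℂ),
    (∀ i, i ∉ T.1.1 →
      IsRefined A T.1.1 T.2.1 (loc T.1.1 (block T.1.1 T.2.1 A)) i (x2 i)) ∧
    (∀ i, i ∉ T.1.2 →
      IsRefined A T.1.2 T.2.2.1 (loc T.1.2 (block T.1.2 T.2.2.1 A)) i (x2' i)) ∧
    IsSynchronization T.1.1 T.1.2 x2 x2' Q ∧
    ∀ j, xhat j = if j ∈ T.1.1 then act Q (x2' j) else x2 j

end Seriation

namespace Seriation

/-! ### Geometry of the circle -/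

/-! On the regular grid with `N` points the affinity matrix is a convolution. The constants and the
first harmonics are eigenvectors, with eigenvalues at least `N / 2` and close to `0.11 N`. Since the
affinity stays within `0.034` of `3/4 + 0.22 cos d` (`abs_affinity_sub_harmonic_le`), the quadratic
form is at most `0.034 N` on the orthogonal complement of these three vectors. The second and third
eigenvalues are thus isolated by gaps of order `N`, and their eigenvectors draw the grid up to an
isometry.

Let `h` be of order `√(n log n)` and `N = n / 4`. A uniform subset `S` contains about a quarter of
each initial segment of the grid (`measure_not_isRepresentative_le`), so its latent points are
within `O(h / N)` of an `N`-grid. The noise has operator norm `O(h)`, by a union bound over an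
integer net (`IsLatentModel.measure_operator_noise_le`). Hence `A_SS` is the grid matrix up to a
quadratic form of size `O(h)`, and the gaps put the spectral output within `O(h² / N)`, in squared
`ℓ²` norm, of an isometric image of the grid (`IsVSA.exists_isometry_close`), that is, within `O(h)`
in `ℓ¹` norm. Sorting and shifting keep an `ℓ¹` error of order `h`
(`IsUniformApprox.sum_geoDist_le`): after lifting to `ℤ`, a permutation with few inversions is close
to a translation (`exists_translation_of_inverted_le`).

Refinement turns this mean accuracy into a uniform one. The localized points fill the grid exactly,
so at distance `d` from its minimizer the noiseless criterion has grown by at least `0.007 N d²`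
(`le_sum_affinity_mul_geoDist_sub`), while the noise and the localization errors contribute only
`O(h d)`; hence `d = O(h / N)` (`IsRefined.geoDist_le`). The noise is controlled because the
localization depends on `A_SS` only, which is independent of the row `A_iS`. The possible
localizations are disjoint events, so that no union bound over the `N!` enumerations is paid
(`IsLatentModel.measure_iUnion_refinementBad_le`).

For the merging, both refined families are accurate on at least half of the indices. An isometry
that almost fixes half of an almost regular configuration cannot be a reflection; it is a rotation,
which moves all points equally (`geoDist_act_self_le`). The synchronized accuracy therefore extends
to the points of `S` (`IsSynchronization.geoDist_le`). -/

lemma exp_argument (x : Circle) : Circle.exp (argument x) = x := by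
  unfold argument
  rw [toIcoMod, Circle.periodic_exp.sub_zsmul_eq, Circle.exp_arg]

lemma argument_nonneg (x : Circle) : 0 ≤ argument x :=
  left_le_toIcoMod _ _ _

lemma argument_lt (x : Circle) : argument x < 2 * Real.pi := by
  have := toIcoMod_lt_right Real.two_pi_pos 0 (Complex.arg (x : ℂ))
  rwa [zero_add] at this

lemma abs_argument_sub_lt (x y : Circle) : |argument x - argument y| < 2 * Real.pi := by
  rw [abs_lt]
  constructor <;> linarith [argument_nonneg x, argument_nonneg y, argument_lt x, argument_lt y]

lemma geoDist_nonneg (x y : Circle) : 0 ≤ geoDist x y :=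
  le_min (abs_nonneg _) (by linarith [abs_argument_sub_lt x y])

lemma geoDist_le_pi (x y : Circle) : geoDist x y ≤ Real.pi := by
  unfold geoDist
  rcases le_total (|argument x - argument y|) Real.pi with h | h
  · exact (min_le_left _ _).trans h
  · exact (min_le_right _ _).trans (by linarith)

lemma re_exp_mul_conj_exp (a b : ℝ) :
    ((Circle.exp a : ℂ) * (starRingEnd ℂ) (Circle.exp b : ℂ)).re = Real.cos (a - b) := by
  have h : (Circle.exp a : ℂ) * (starRingEnd ℂ) (Circle.exp b : ℂ) = (Circle.exp (a - b) : ℂ) := by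
    rw [← Circle.coe_inv_eq_conj, Circle.exp_sub, div_eq_mul_inv, Circle.coe_mul]
  rw [h, Circle.coe_exp, Complex.exp_ofReal_mul_I_re]

lemma cos_geoDist (x y : Circle) :
    Real.cos (geoDist x y) = ((x : ℂ) * (starRingEnd ℂ) (y : ℂ)).re := by
  conv_rhs => rw [← exp_argument x, ← exp_argument y]
  rw [re_exp_mul_conj_exp]
  unfold geoDist
  rcases min_choice (|argument x - argument y|) (2 * Real.pi - |argument x - argument y|) with h | h
  · rw [h, Real.cos_abs]
  · rw [h, Real.cos_two_pi_sub, Real.cos_abs]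

lemma geoDist_eq_arccos (x y : Circle) :
    geoDist x y = Real.arccos ((x : ℂ) * (starRingEnd ℂ) (y : ℂ)).re := by
  rw [← cos_geoDist, Real.arccos_cos (geoDist_nonneg x y) (geoDist_le_pi x y)]

lemma geoDist_eq_angle (x y : Circle) :
    geoDist x y = InnerProductGeometry.angle (x : ℂ) (y : ℂ) := by
  rw [geoDist_eq_arccos, InnerProductGeometry.angle, Circle.norm_coe, Circle.norm_coe,
    Complex.inner]
  congr 1
  simp [Complex.mul_re]
  ring

lemma geoDist_comm (x y : Circle) : geoDist x y = geoDist y x := by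
  rw [geoDist_eq_angle, geoDist_eq_angle, InnerProductGeometry.angle_comm]

lemma geoDist_triangle (x y z : Circle) : geoDist x z ≤ geoDist x y + geoDist y z := by
  simp only [geoDist_eq_angle]
  exact InnerProductGeometry.angle_le_angle_add_angle _ _ _

lemma abs_geoDist_sub_le (x y z : Circle) : |geoDist x z - geoDist y z| ≤ geoDist x y := by
  rw [abs_le]
  have h₁ := geoDist_triangle x y z
  have h₂ := geoDist_triangle y x z
  rw [geoDist_comm y x] at h₂
  constructor <;> linarith

lemma coe_act (Q : ℂ ≃ₗᵢ[ℝ] ℂ) (x : Circle) : (act Q x : ℂ) = Q x := rfl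

lemma geoDist_act (Q : ℂ ≃ₗᵢ[ℝ] ℂ) (x y : Circle) :
    geoDist (act Q x) (act Q y) = geoDist x y := by
  rw [geoDist_eq_angle, geoDist_eq_angle, coe_act, coe_act]
  exact Q.toLinearIsometry.angle_map _ _

lemma geoDist_self (x : Circle) : geoDist x x = 0 := by
  simp [geoDist, Real.pi_pos.le]

lemma geoDist_mul_left (a x y : Circle) : geoDist (a * x) (a * y) = geoDist x y := by
  have h : ∀ z : Circle, act (rotation a) z = a * z := fun z => by
    ext; simp [coe_act]
  rw [← h, ← h, geoDist_act]

lemma geoDist_inv (x y : Circle) : geoDist x⁻¹ y⁻¹ = geoDist x y := by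
  rw [geoDist_eq_arccos, geoDist_eq_arccos, Circle.coe_inv_eq_conj, Circle.coe_inv_eq_conj,
    ← map_mul, Complex.conj_re]

lemma norm_sub_sq_eq (x y : Circle) :
    ‖(x : ℂ) - y‖ ^ 2 = 2 - 2 * Real.cos (geoDist x y) := by
  have := norm_sub_sq_real (x : ℂ) y
  rw [this, cos_geoDist, Complex.inner, Circle.norm_coe, Circle.norm_coe]
  simp [Complex.mul_re]
  ring

lemma norm_sub_le_geoDist (x y : Circle) : ‖(x : ℂ) - y‖ ≤ geoDist x y := by
  refine abs_le_of_sq_le_sq' ?_ (geoDist_nonneg x y) |>.2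
  rw [norm_sub_sq_eq]
  linarith [Real.one_sub_sq_div_two_le_cos (x := geoDist x y)]

lemma geoDist_le_norm_sub (x y : Circle) : geoDist x y ≤ Real.pi / 2 * ‖(x : ℂ) - y‖ := by
  refine abs_le_of_sq_le_sq' ?_ (by positivity) |>.2
  rw [mul_pow, norm_sub_sq_eq]
  have h := Real.cos_le_one_sub_mul_cos_sq (x := geoDist x y)
    (by rw [abs_of_nonneg (geoDist_nonneg x y)]; exact geoDist_le_pi x y)
  have hpi := Real.pi_pos
  have : (Real.pi / 2) ^ 2 * (2 - 2 * Real.cos (geoDist x y)) ≥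
      (Real.pi / 2) ^ 2 * (2 * (2 / Real.pi ^ 2 * geoDist x y ^ 2)) := by
    gcongr
    linarith
  refine le_trans (le_of_eq ?_) this
  field_simp

lemma geoDist_exp (a b : ℝ) :
    geoDist (Circle.exp a) (Circle.exp b) = Real.arccos (Real.cos (a - b)) := by
  rw [geoDist_eq_arccos, re_exp_mul_conj_exp]

lemma geoDist_exp_le (a b : ℝ) : geoDist (Circle.exp a) (Circle.exp b) ≤ |a - b| := by
  rcases le_total (|a - b|) Real.pi with h | h
  · rw [geoDist_exp, ← Real.cos_abs, Real.arccos_cos (abs_nonneg _) h]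
  · exact (geoDist_le_pi _ _).trans h

/-- The winding number that brings `a - b` into `(-π, π]`. It is what lifts a matching on the circle
to a matching on the line. -/
lemma exists_int_abs_sub_eq_geoDist (a b : ℝ) :
    ∃ q : ℤ, |a - b - 2 * Real.pi * q| = geoDist (Circle.exp a) (Circle.exp b) := by
  have hp := Real.two_pi_pos
  refine ⟨toIocDiv hp (-Real.pi) (a - b), ?_⟩
  have h₁ : a - b - 2 * Real.pi * toIocDiv hp (-Real.pi) (a - b) =
      toIocMod hp (-Real.pi) (a - b) := by
    rw [toIocMod, zsmul_eq_mul]; ring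
  have h₂ := toIocMod_mem_Ioc hp (-Real.pi) (a - b)
  have h₃ : |toIocMod hp (-Real.pi) (a - b)| ≤ Real.pi := by
    rw [abs_le]; constructor
    · exact h₂.1.le
    · linarith [h₂.2]
  rw [h₁, geoDist_exp, ← Real.arccos_cos (abs_nonneg _) h₃, Real.cos_abs]
  congr 1
  rw [← h₁, mul_comm, Real.cos_sub_int_mul_two_pi]

/-! ### The affinity function and its first harmonic -/

lemma half_le_affinity (x y : Circle) : 1 / 2 ≤ affinity x y := by
  have h := geoDist_le_pi x y
  have hpi := Real.pi_pos
  have : geoDist x y / (2 * Real.pi) ≤ 1 / 2 := by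
    rw [div_le_iff₀ (by positivity)]; linarith
  unfold affinity
  linarith

lemma abs_affinity_sub_le (x y x' y' : Circle) :
    |affinity x y - affinity x' y'| ≤ (geoDist x x' + geoDist y y') / (2 * Real.pi) := by
  have h₁ := abs_geoDist_sub_le x x' y
  have h₂ := abs_geoDist_sub_le y y' x'
  rw [geoDist_comm y x', geoDist_comm y' x'] at h₂
  have hpi := Real.pi_pos
  have : affinity x y - affinity x' y' =
      -((geoDist x y - geoDist x' y) + (geoDist x' y - geoDist x' y')) / (2 * Real.pi) := by
    unfold affinity; ring
  rw [this, abs_div, abs_neg, abs_of_pos (by positivity : (0 : ℝ) < 2 * Real.pi)]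
  gcongr
  exact (abs_add_le _ _).trans (add_le_add h₁ h₂)

/-- Concavity of the sine: the chord over `[0, π/2]` bounds the difference above by `0.03`, the
tangent at `π/4` bounds it below by `-0.034`. The slope `0.22` is not the Fourier coefficient `2/π²`
of the affinity; it roughly balances these two errors. -/
lemma abs_sin_sub_le {φ : ℝ} (h0 : 0 ≤ φ) (h1 : φ ≤ Real.pi / 2) :
    |φ / (2 * Real.pi) - 0.22 * Real.sin φ| ≤ 0.034 := by
  have hpi := Real.pi_pos
  have hpi3 := Real.pi_gt_d2
  have hpi4 := Real.pi_lt_d2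
  have hlin : φ / (2 * Real.pi) = φ / Real.pi / 2 := by rw [div_div, mul_comm]
  have hr1 : φ / Real.pi ≤ 1 / 2 := by rw [div_le_iff₀ hpi]; linarith
  have hr0 : 0 ≤ φ / Real.pi := by positivity
  rw [abs_le]
  constructor
  · -- the tangent at `π / 4`
    -- With `s = π/4 - φ`, this is the tangent inequality on the left of `π/4`. The left side is
    -- cubic and the right side quadratic in `s`, and `s ≤ 0.79` is small enough to compare them.
    have hcube : ∀ s : ℝ, 0 ≤ s → s ≤ Real.pi / 4 → s - Real.sin s ≤ 1 - Real.cos s := by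
      intro s hs hs'
      have hc := Real.cos_le_one_sub_mul_cos_sq (x := s) (by rw [abs_of_nonneg hs]; linarith)
      rcases hs.eq_or_lt with rfl | hs0
      · simp
      have hsin := Real.sin_gt_sub_cube hs0
      have h2 : 2 / Real.pi ^ 2 ≥ 0.2 := by
        rw [ge_iff_le, le_div_iff₀ (by positivity)]; nlinarith
      have hs1 : s ≤ 0.79 := by linarith
      nlinarith [mul_nonneg hs hs, mul_nonneg (mul_nonneg hs hs) (sub_nonneg.2 hs1),
        mul_le_mul_of_nonneg_right h2 (mul_nonneg hs hs)]
    have htan : Real.sin φ ≤ √2 / 2 * (1 + (φ - Real.pi / 4)) := by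
      have hs : Real.sin φ = √2 / 2 * (Real.cos (φ - Real.pi / 4) + Real.sin (φ - Real.pi / 4)) := by
        have : φ = Real.pi / 4 + (φ - Real.pi / 4) := by ring
        conv_lhs => rw [this, Real.sin_add, Real.sin_pi_div_four, Real.cos_pi_div_four]
        ring
      rw [hs]
      refine mul_le_mul_of_nonneg_left ?_ (by positivity)
      rcases le_total (Real.pi / 4) φ with h | h
      · linarith [Real.sin_le (x := φ - Real.pi / 4) (by linarith),
          Real.cos_le_one (φ - Real.pi / 4)]
      · have := hcube (Real.pi / 4 - φ) (by linarith) (by linarith)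
        have e1 : Real.sin (φ - Real.pi / 4) = -Real.sin (Real.pi / 4 - φ) := by
          rw [← Real.sin_neg]; ring_nf
        have e2 : Real.cos (φ - Real.pi / 4) = Real.cos (Real.pi / 4 - φ) := by
          rw [← Real.cos_neg]; ring_nf
        linarith
    have hsq : √2 ≤ 1.4143 := by
      rw [Real.sqrt_le_left (by norm_num)]; norm_num
    have hsq0 : 0 ≤ √2 := Real.sqrt_nonneg 2
    have hb : √2 / 2 * (1 + (φ - Real.pi / 4)) ≤ 0.70715 * (1 + (φ - Real.pi / 4)) := by
      apply mul_le_mul_of_nonneg_right <;> linarith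
    have hd : φ / Real.pi ≥ φ * 0.317 := by
      rw [ge_iff_le, le_div_iff₀ hpi]; nlinarith
    rw [hlin]
    nlinarith
  · have := Real.mul_le_sin h0 h1
    have h2 : 2 / Real.pi * φ = 2 * (φ / Real.pi) := by ring
    rw [h2] at this
    rw [hlin]
    linarith

/-- About the distance `π/2`, both `affinity - 3/4` and the cosine are odd, so one quarter period
suffices. This uniform bound replaces any computation of the higher Fourier coefficients. -/
lemma abs_affinity_sub_harmonic_le (x y : Circle) :
    |affinity x y - 3 / 4 - 0.22 * ((x : ℂ) * (starRingEnd ℂ) (y : ℂ)).re| ≤ 0.034 := by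
  rw [← cos_geoDist]
  have h0 := geoDist_nonneg x y
  have h1 := geoDist_le_pi x y
  have hpi := Real.pi_pos
  unfold affinity
  set θ := geoDist x y
  rcases le_total θ (Real.pi / 2) with h | h
  · have := abs_sin_sub_le (φ := Real.pi / 2 - θ) (by linarith) (by linarith)
    rw [Real.sin_pi_div_two_sub] at this
    convert this using 2
    field_simp
    ring
  · have := abs_sin_sub_le (φ := θ - Real.pi / 2) (by linarith) (by linarith)
    rw [← abs_neg, Real.sin_sub_pi_div_two] at this
    convert this using 2
    field_simp
    ring

/-! ### The regular grid -/

lemma natCast_zmod_ne_zero {N m : ℕ} (h0 : 0 < m) (hm : m < N) : (m : ZMod N) ≠ 0 := by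
  rw [Ne, ZMod.natCast_eq_zero_iff]
  exact Nat.not_dvd_of_pos_of_lt h0 hm

section Grid

variable {N : ℕ} [NeZero N]

lemma root_eq_toCircle (k : ℕ) : root N k = ZMod.toCircle (k : ZMod N) := by
  ext
  rw [ZMod.toCircle_natCast, root, Circle.coe_exp]
  push_cast
  congr 1
  ring

lemma toCircle_intCast_eq_exp (k : ℤ) :
    ZMod.toCircle (k : ZMod N) = Circle.exp (2 * Real.pi * k / N) := by
  ext
  rw [ZMod.toCircle_intCast, Circle.coe_exp]
  push_cast
  congr 1
  ring

lemma toCircle_mem_grid (j : ZMod N) : ZMod.toCircle j ∈ grid N :=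
  ⟨⟨j.val, ZMod.val_lt j⟩, by simp [root_eq_toCircle]⟩

lemma exists_toCircle_of_mem_grid {z : Circle} (hz : z ∈ grid N) :
    ∃ j : ZMod N, z = ZMod.toCircle j := by
  obtain ⟨k, rfl⟩ := hz
  exact ⟨_, root_eq_toCircle _⟩

lemma exists_geoDist_toCircle_le (w : Circle) :
    ∃ j : ZMod N, geoDist w (ZMod.toCircle j) ≤ 2 * Real.pi / N := by
  have hN : (0 : ℝ) < N := Nat.cast_pos.2 (NeZero.pos N)
  have hpi := Real.pi_pos
  set k : ℤ := ⌊argument w * N / (2 * Real.pi)⌋ with hk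
  refine ⟨(k : ZMod N), ?_⟩
  rw [toCircle_intCast_eq_exp]
  conv_lhs => rw [← exp_argument w]
  refine (geoDist_exp_le _ _).trans ?_
  have h₁ := Int.floor_le (argument w * N / (2 * Real.pi))
  have h₂ := Int.lt_floor_add_one (argument w * N / (2 * Real.pi))
  rw [← hk] at h₁ h₂
  have e : argument w - 2 * Real.pi * k / N =
      (argument w * N / (2 * Real.pi) - k) * (2 * Real.pi / N) := by
    field_simp
  rw [e, abs_mul, abs_of_pos (by positivity : 0 < 2 * Real.pi / N), abs_of_nonneg (by linarith)]
  have : 0 < 2 * Real.pi / N := by positivity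
  nlinarith

lemma toCircle_neg (j : ZMod N) : ZMod.toCircle (-j) = (ZMod.toCircle j)⁻¹ :=
  AddChar.map_neg_eq_inv _ _

lemma toCircle_add (j k : ZMod N) :
    ZMod.toCircle (j + k) = ZMod.toCircle j * ZMod.toCircle k :=
  AddChar.map_add_eq_mul _ _ _

/-- Up to a rounding, an orthogonal transformation permutes the regular grid. -/
lemma exists_perm_geoDist_act_le (Q : ℂ ≃ₗᵢ[ℝ] ℂ) :
    ∃ ρ : Equiv.Perm (ZMod N), ∀ j,
      geoDist (act Q (ZMod.toCircle j)) (ZMod.toCircle (ρ j)) ≤ 2 * Real.pi / N := by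
  obtain ⟨q, hq | hq⟩ := linear_isometry_complex Q
  · obtain ⟨m, hm⟩ := exists_geoDist_toCircle_le (N := N) q
    refine ⟨Equiv.addLeft m, fun j => ?_⟩
    have : act Q (ZMod.toCircle j) = ZMod.toCircle j * q := by
      ext; simp [coe_act, hq, mul_comm]
    have h2 : Equiv.addLeft m j = j + m := add_comm _ _
    rw [this, h2, toCircle_add, geoDist_mul_left]
    exact hm
  · obtain ⟨m, hm⟩ := exists_geoDist_toCircle_le (N := N) q
    refine ⟨(Equiv.neg _).trans (Equiv.addLeft m), fun j => ?_⟩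
    have : act Q (ZMod.toCircle j) = ZMod.toCircle (-j) * q := by
      ext
      rw [toCircle_neg, Circle.coe_mul, Circle.coe_inv_eq_conj]
      simp [coe_act, hq, mul_comm]
    have h2 : (Equiv.neg (ZMod N)).trans (Equiv.addLeft m) j = -j + m := add_comm _ _
    rw [this, h2, toCircle_add, geoDist_mul_left]
    exact hm

lemma sum_toCircle_pow {m : ℕ} (hm : (m : ZMod N) ≠ 0) :
    ∑ j : ZMod N, (ZMod.toCircle j : ℂ) ^ m = 0 := by
  have h := AddChar.sum_mulShift (m : ZMod N) (ZMod.isPrimitive_stdAddChar N)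
  rw [if_neg hm, Nat.cast_zero] at h
  rw [← h]
  refine Finset.sum_congr rfl fun j _ => ?_
  rw [ZMod.stdAddChar_apply, mul_comm, ← nsmul_eq_mul, AddChar.map_nsmul_eq_pow, Circle.coe_pow]

lemma sum_toCircle (hN : 1 < N) : ∑ j : ZMod N, (ZMod.toCircle j : ℂ) = 0 := by
  simpa using sum_toCircle_pow (N := N) (m := 1) (natCast_zmod_ne_zero one_pos hN)

lemma re_sq_of_circle (z : Circle) : (z : ℂ).re ^ 2 = (1 + ((z : ℂ) ^ 2).re) / 2 := by
  have h : (z : ℂ).re * (z : ℂ).re + (z : ℂ).im * (z : ℂ).im = 1 := by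
    have := Circle.normSq_coe z
    rwa [Complex.normSq_apply] at this
  rw [sq (z : ℂ), Complex.mul_re]
  linarith

lemma sum_mul_toCircle_re_sq (hN : 2 < N) (q : Circle) :
    ∑ j : ZMod N, (((q * ZMod.toCircle j : Circle) : ℂ).re) ^ 2 = N / 2 := by
  have h : ∀ j : ZMod N, ((q * ZMod.toCircle j : Circle) : ℂ).re ^ 2 =
      (1 + ((q : ℂ) ^ 2 * (ZMod.toCircle j : ℂ) ^ 2).re) / 2 := fun j => by
    rw [re_sq_of_circle, Circle.coe_mul, mul_pow]
  simp only [h]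
  rw [← Finset.sum_div, Finset.sum_add_distrib, ← Complex.re_sum, ← Finset.mul_sum,
    sum_toCircle_pow (natCast_zmod_ne_zero two_pos hN)]
  simp [ZMod.card]

/-! ### Convolution operators on the grid -/

lemma geoDist_toCircle_add (a b : ZMod N) :
    geoDist (ZMod.toCircle a) (ZMod.toCircle (a + b)) = geoDist 1 (ZMod.toCircle b) := by
  rw [toCircle_add]
  nth_rewrite 1 [← mul_one (ZMod.toCircle a)]
  exact geoDist_mul_left _ _ _

lemma sum_comp_geoDist (φ : ℝ → ℝ) (a : ZMod N) :
    ∑ b : ZMod N, φ (geoDist (ZMod.toCircle a) (ZMod.toCircle b)) =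
      ∑ c : ZMod N, φ (geoDist 1 (ZMod.toCircle c)) := by
  rw [← Equiv.sum_comp (Equiv.addLeft a)]
  simp [geoDist_toCircle_add]

/-- A kernel that depends on the distance only is a convolution on `ZMod N`, so it has the character
`ZMod.toCircle` as an eigenvector. The symmetry `c ↦ -c` of the kernel makes the eigenvalue real. -/
lemma sum_comp_geoDist_mul_toCircle (φ : ℝ → ℝ) (a : ZMod N) :
    ∑ b : ZMod N, (φ (geoDist (ZMod.toCircle a) (ZMod.toCircle b)) : ℂ) * (ZMod.toCircle b : ℂ) =
      (∑ c : ZMod N, φ (geoDist 1 (ZMod.toCircle c)) * (ZMod.toCircle c : ℂ).re : ℝ) *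
        (ZMod.toCircle a : ℂ) := by
  rw [← Equiv.sum_comp (Equiv.addLeft a)]
  simp only [Equiv.coe_addLeft, geoDist_toCircle_add]
  have h : ∑ c : ZMod N, (φ (geoDist 1 (ZMod.toCircle c)) : ℂ) * (ZMod.toCircle c : ℂ) =
      (∑ c : ZMod N, φ (geoDist 1 (ZMod.toCircle c)) * (ZMod.toCircle c : ℂ).re : ℝ) := by
    apply Complex.ext
    · rw [Complex.re_sum, Complex.ofReal_re]
      simp
    · rw [Complex.ofReal_im, Complex.im_sum]
      have : ∑ c : ZMod N, φ (geoDist 1 (ZMod.toCircle c)) * (ZMod.toCircle c : ℂ).im =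
          -∑ c : ZMod N, φ (geoDist 1 (ZMod.toCircle c)) * (ZMod.toCircle c : ℂ).im := by
        conv_lhs => rw [← Equiv.sum_comp (Equiv.neg (ZMod N))]
        rw [← Finset.sum_neg_distrib]
        refine Finset.sum_congr rfl fun c _ => ?_
        rw [Equiv.neg_apply, toCircle_neg]
        have h1 := geoDist_inv 1 (ZMod.toCircle c)
        rw [inv_one] at h1
        rw [h1, Circle.coe_inv_eq_conj, Complex.conj_im]
        ring
      simp only [Complex.im_ofReal_mul]
      linarith
  rw [← h, Finset.sum_mul]
  refine Finset.sum_congr rfl fun c _ => ?_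
  rw [toCircle_add, Circle.coe_mul]
  ring

/-- The eigenvalue of the affinity matrix of the regular grid on the first harmonic. -/
noncomputable def firstEigenvalue (N : ℕ) [NeZero N] : ℝ :=
  ∑ c : ZMod N, affinity 1 (ZMod.toCircle c) * (ZMod.toCircle c : ℂ).re

/-- The row sums of the affinity matrix of the regular grid. -/
noncomputable def zerothEigenvalue (N : ℕ) [NeZero N] : ℝ :=
  ∑ c : ZMod N, affinity 1 (ZMod.toCircle c)

lemma sum_affinity (a : ZMod N) :
    ∑ b : ZMod N, affinity (ZMod.toCircle a) (ZMod.toCircle b) = zerothEigenvalue N :=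
  sum_comp_geoDist (fun t => 1 - t / (2 * Real.pi)) a

lemma sum_affinity_mul_toCircle (a : ZMod N) :
    ∑ b : ZMod N, (affinity (ZMod.toCircle a) (ZMod.toCircle b) : ℂ) * (ZMod.toCircle b : ℂ) =
      firstEigenvalue N * (ZMod.toCircle a : ℂ) :=
  sum_comp_geoDist_mul_toCircle (fun t => 1 - t / (2 * Real.pi)) a

lemma le_zerothEigenvalue : (N : ℝ) / 2 ≤ zerothEigenvalue N := by
  unfold zerothEigenvalue
  calc (N : ℝ) / 2 = ∑ _c : ZMod N, (1 / 2 : ℝ) := by simp [ZMod.card]; ring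
    _ ≤ _ := Finset.sum_le_sum fun c _ => half_le_affinity _ _

/-- In the approximation of the affinity, the constant has no first harmonic and `0.22 cos`
contributes `0.22 · N / 2`; the uniform error costs at most `0.034` per grid point. -/
lemma abs_firstEigenvalue_sub_le (hN : 2 < N) : |firstEigenvalue N - 0.11 * N| ≤ 0.034 * N := by
  have h1 : ∑ c : ZMod N, (ZMod.toCircle c : ℂ).re = 0 := by
    rw [← Complex.re_sum, sum_toCircle (by omega), Complex.zero_re]
  have h2 : ∑ c : ZMod N, (ZMod.toCircle c : ℂ).re ^ 2 = N / 2 := by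
    simpa using sum_mul_toCircle_re_sq hN 1
  have h3 : firstEigenvalue N - 0.11 * N = ∑ c : ZMod N,
      (affinity 1 (ZMod.toCircle c) - 3 / 4 -
        0.22 * (((1 : Circle) : ℂ) * (starRingEnd ℂ) (ZMod.toCircle c : ℂ)).re) *
          (ZMod.toCircle c : ℂ).re := by
    have : ∀ c : ZMod N, (affinity 1 (ZMod.toCircle c) - 3 / 4 -
        0.22 * (((1 : Circle) : ℂ) * (starRingEnd ℂ) (ZMod.toCircle c : ℂ)).re) *
          (ZMod.toCircle c : ℂ).re = affinity 1 (ZMod.toCircle c) * (ZMod.toCircle c : ℂ).re -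
          3 / 4 * (ZMod.toCircle c : ℂ).re - 0.22 * (ZMod.toCircle c : ℂ).re ^ 2 := by
      intro c
      simp only [Circle.coe_one, one_mul, Complex.conj_re]
      ring
    simp only [this, Finset.sum_sub_distrib, ← Finset.mul_sum, h1, h2, firstEigenvalue]
    ring
  rw [h3]
  refine (Finset.abs_sum_le_sum_abs _ _).trans ?_
  calc _ ≤ ∑ _c : ZMod N, (0.034 : ℝ) := by
        refine Finset.sum_le_sum fun c _ => ?_
        rw [abs_mul]
        have h4 := abs_affinity_sub_harmonic_le 1 (ZMod.toCircle c)
        have h5 : |(ZMod.toCircle c : ℂ).re| ≤ 1 :=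
          (Complex.abs_re_le_norm _).trans (Circle.norm_coe _).le
        calc _ ≤ 0.034 * 1 := mul_le_mul h4 h5 (abs_nonneg _) (by norm_num)
          _ = _ := by norm_num
    _ = _ := by simp [ZMod.card]; ring

/-- The criterion of the refinement step has a quadratic growth at its minimum. -/
lemma le_sum_affinity_mul_geoDist_sub (hN : 2 < N) (a b : ZMod N) :
    0.007 * N * geoDist (ZMod.toCircle a) (ZMod.toCircle b) ^ 2 ≤
      ∑ g : ZMod N, affinity (ZMod.toCircle b) (ZMod.toCircle g) *
        (geoDist (ZMod.toCircle a) (ZMod.toCircle g) -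
          geoDist (ZMod.toCircle b) (ZMod.toCircle g)) := by
  have hNpos : (0 : ℝ) < N := Nat.cast_pos.2 (by omega)
  have hpi := Real.pi_pos
  set D : ZMod N → ℝ := fun g => geoDist (ZMod.toCircle a) (ZMod.toCircle g) -
          geoDist (ZMod.toCircle b) (ZMod.toCircle g) with hD
  -- Sums of functions of the distance over the full grid do not depend on the centre. Hence the
  -- terms linear in `D` and the differences of squares both disappear.
  have hs1 : ∑ g : ZMod N, D g = 0 := by
    rw [hD, Finset.sum_sub_distrib, sub_eq_zero]
    exact (sum_comp_geoDist (fun t => t) a).trans (sum_comp_geoDist (fun t => t) b).symm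
  have hs2 : ∑ g : ZMod N, geoDist (ZMod.toCircle a) (ZMod.toCircle g) ^ 2 -
      ∑ g : ZMod N, geoDist (ZMod.toCircle b) (ZMod.toCircle g) ^ 2 = 0 := by
    rw [sub_eq_zero]
    exact (sum_comp_geoDist (fun t => t ^ 2) a).trans (sum_comp_geoDist (fun t => t ^ 2) b).symm
  -- The affinity is affine in the distance, so completing the square leaves only `∑ D²`.
  have hmain : ∑ g : ZMod N, affinity (ZMod.toCircle b) (ZMod.toCircle g) * D g =
      (∑ g : ZMod N, D g ^ 2) / (4 * Real.pi) := by
    have : ∀ g, affinity (ZMod.toCircle b) (ZMod.toCircle g) * D g = D g +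
        D g ^ 2 / (4 * Real.pi) - (geoDist (ZMod.toCircle a) (ZMod.toCircle g) ^ 2 -
          geoDist (ZMod.toCircle b) (ZMod.toCircle g) ^ 2) / (4 * Real.pi) := by
      intro g
      simp only [hD, affinity]
      field_simp
      ring
    simp only [this]
    rw [Finset.sum_sub_distrib, Finset.sum_add_distrib, hs1, ← Finset.sum_div, ← Finset.sum_div,
      Finset.sum_sub_distrib, hs2]
    ring
  have hvec : ∑ g : ZMod N, (D g : ℂ) * (ZMod.toCircle g : ℂ) =
      ((-(2 * Real.pi * firstEigenvalue N) : ℝ) : ℂ) *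
        ((ZMod.toCircle a : ℂ) - (ZMod.toCircle b : ℂ)) := by
    have : ∀ g, (D g : ℂ) * (ZMod.toCircle g : ℂ) = ((-(2 * Real.pi) : ℝ) : ℂ) *
        ((affinity (ZMod.toCircle a) (ZMod.toCircle g) : ℂ) * (ZMod.toCircle g : ℂ) -
        (affinity (ZMod.toCircle b) (ZMod.toCircle g) : ℂ) * (ZMod.toCircle g : ℂ)) := by
      intro g
      rw [← sub_mul, ← mul_assoc, ← Complex.ofReal_sub, ← Complex.ofReal_mul]
      congr 2
      simp only [hD, affinity]
      field_simp
      ring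
    simp only [this]
    rw [← Finset.mul_sum, Finset.sum_sub_distrib, sum_affinity_mul_toCircle,
      sum_affinity_mul_toCircle]
    push_cast
    ring
  -- `∑ D²` is bounded below through the first harmonic of `D` alone, which `hvec` evaluates. As
  -- `firstEigenvalue N ≥ 0.076 N`, the resulting constant is `0.304² / (4π) > 0.007`.
  have hcs : ‖∑ g : ZMod N, (D g : ℂ) * (ZMod.toCircle g : ℂ)‖ ^ 2 ≤ N * ∑ g : ZMod N, D g ^ 2 := by
    calc _ ≤ (∑ g : ZMod N, |D g|) ^ 2 := by
          gcongr
          refine (norm_sum_le _ _).trans (Finset.sum_le_sum fun g _ => ?_)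
          rw [norm_mul, Circle.norm_coe, mul_one, Complex.norm_real, Real.norm_eq_abs]
      _ ≤ (Finset.univ : Finset (ZMod N)).card * ∑ g : ZMod N, |D g| ^ 2 := sq_sum_le_card_mul_sum_sq
      _ = _ := by simp [ZMod.card]
  rw [hvec, norm_mul, Complex.norm_real, mul_pow, Real.norm_eq_abs, sq_abs] at hcs
  have hd := geoDist_le_norm_sub (ZMod.toCircle a) (ZMod.toCircle b)
  have hl := (abs_le.1 (abs_firstEigenvalue_sub_le hN)).1
  have hl' : 0.076 * N ≤ firstEigenvalue N := by linarith
  rw [hmain, le_div_iff₀ (by positivity)]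
  set d := geoDist (ZMod.toCircle a) (ZMod.toCircle b)
  set c := ‖(ZMod.toCircle a : ℂ) - (ZMod.toCircle b : ℂ)‖
  have hd0 : 0 ≤ d := geoDist_nonneg _ _
  have hd2 : d ^ 2 ≤ (Real.pi / 2 * c) ^ 2 := by gcongr
  have h6 : (2 * Real.pi * (0.076 * N)) ^ 2 * c ^ 2 ≤ N * ∑ g : ZMod N, D g ^ 2 := by
    refine le_trans ?_ hcs
    rw [neg_sq]
    gcongr
  have h7 : N * (0.0924 * N * d ^ 2) ≤ N * ∑ g : ZMod N, D g ^ 2 := by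
    refine le_trans ?_ h6
    have : (2 * Real.pi * (0.076 * N)) ^ 2 * c ^ 2 =
        (0.304 : ℝ) ^ 2 * N ^ 2 * (Real.pi / 2 * c) ^ 2 := by ring
    rw [this]
    have h8 : (N : ℝ) * (0.0924 * N * d ^ 2) ≤ (0.304 : ℝ) ^ 2 * N ^ 2 * d ^ 2 := by
      have : 0 ≤ (N : ℝ) ^ 2 * d ^ 2 := by positivity
      nlinarith
    refine h8.trans ?_
    gcongr
  have h9 := le_of_mul_le_mul_left h7 hNpos
  have hpi4 := Real.pi_lt_d2
  have : 0 ≤ N * d ^ 2 := by positivity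
  nlinarith

end Grid

/-- The quadratic form of an affinity matrix is close to that of its first two harmonics. -/
lemma abs_quadForm_affinity_sub_le {ι : Type*} [Fintype ι] (r : ι → Circle) (x : ι → ℝ) :
    |∑ k, ∑ l, x k * x l * affinity (r k) (r l) - 3 / 4 * (∑ k, x k) ^ 2 -
      0.22 * ‖∑ k, (x k : ℂ) * (r k : ℂ)‖ ^ 2| ≤ 0.034 * Fintype.card ι * ∑ k, x k ^ 2 := by
  have h1 : (∑ k, x k) ^ 2 = ∑ k, ∑ l, x k * x l := by rw [sq, Finset.sum_mul_sum]
  have h2 : ‖∑ k, (x k : ℂ) * (r k : ℂ)‖ ^ 2 =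
      ∑ k, ∑ l, x k * x l * ((r k : ℂ) * (starRingEnd ℂ) (r l : ℂ)).re := by
    have : ((‖∑ k, (x k : ℂ) * (r k : ℂ)‖ ^ 2 : ℝ) : ℂ) =
        (∑ k, (x k : ℂ) * (r k : ℂ)) * (starRingEnd ℂ) (∑ k, (x k : ℂ) * (r k : ℂ)) := by
      rw [Complex.mul_conj, Complex.normSq_eq_norm_sq]
    rw [← Complex.ofReal_re (_ ^ 2), this, map_sum, Finset.sum_mul_sum, Complex.re_sum]
    refine Finset.sum_congr rfl fun k _ => ?_
    rw [Complex.re_sum]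
    refine Finset.sum_congr rfl fun l _ => ?_
    rw [map_mul, Complex.conj_ofReal, ← Complex.re_ofReal_mul]
    push_cast
    congr 1
    ring
  rw [h1, h2, Finset.mul_sum, Finset.mul_sum, ← Finset.sum_sub_distrib, ← Finset.sum_sub_distrib]
  calc _ ≤ ∑ k, ∑ l, |x k| * |x l| * 0.034 := by
        refine (Finset.abs_sum_le_sum_abs _ _).trans (Finset.sum_le_sum fun k _ => ?_)
        rw [Finset.mul_sum, Finset.mul_sum, ← Finset.sum_sub_distrib, ← Finset.sum_sub_distrib]
        refine (Finset.abs_sum_le_sum_abs _ _).trans (Finset.sum_le_sum fun l _ => ?_)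
        have h3 : x k * x l * affinity (r k) (r l) - 3 / 4 * (x k * x l) -
            0.22 * (x k * x l * ((r k : ℂ) * (starRingEnd ℂ) (r l : ℂ)).re) = x k * x l *
            (affinity (r k) (r l) - 3 / 4 -
              0.22 * ((r k : ℂ) * (starRingEnd ℂ) (r l : ℂ)).re) := by ring
        rw [h3, abs_mul, abs_mul]
        gcongr
        exact abs_affinity_sub_harmonic_le _ _
    _ = 0.034 * (∑ k, |x k|) ^ 2 := by
        rw [sq, Finset.sum_mul_sum, Finset.mul_sum]
        refine Finset.sum_congr rfl fun k _ => ?_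
        rw [Finset.mul_sum]
        exact Finset.sum_congr rfl fun l _ => by ring
    _ ≤ 0.034 * (Fintype.card ι * ∑ k, |x k| ^ 2) := by
        gcongr
        exact sq_sum_le_card_mul_sum_sq
    _ = _ := by simp only [sq_abs]; ring

/-! ### Sorting points matched with the grid -/

/-- Two integers are inverted by a permutation of the integers. -/
def Inverted (ℓ : Equiv.Perm ℤ) (j j' : ℤ) : Prop :=
  (j < j' ∧ ℓ j' < ℓ j) ∨ (j' < j ∧ ℓ j < ℓ j')

/-- The displacements of two integers differ by at most the number of inversions. -/
lemma abs_displacement_sub_le (ℓ : Equiv.Perm ℤ) (I : ℤ → Finset ℤ)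
    (hI : ∀ j j', Inverted ℓ j j' → j' ∈ I j) (j₀ j : ℤ) :
    |(j - ℓ j) - (j₀ - ℓ j₀)| ≤ 2 * ((I j).card + (I j₀).card : ℤ) := by
  wlog hlt : j₀ < j generalizing j₀ j
  · rcases (not_lt.1 hlt).eq_or_lt with rfl | h
    · simp
    · rw [abs_sub_comm, add_comm]; exact this j j₀ h
  have hinj : ∀ a b, ℓ a = ℓ b → a = b := fun a b h => ℓ.injective h
  have hcard : ((I j ∪ I j₀).card : ℤ) ≤ (I j).card + (I j₀).card :=
    mod_cast Finset.card_union_le _ _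
  have hB : ∀ a b j', j' ∈ (Finset.Ico a b).map ℓ.symm.toEmbedding ↔ a ≤ ℓ j' ∧ ℓ j' < b := by
    intro a b j'
    simp only [Finset.mem_map_equiv, Equiv.symm_symm, Finset.mem_Ico]
  have hBc : ∀ a b : ℤ, ((Finset.Ico a b).map ℓ.symm.toEmbedding).card = (b - a).toNat := by
    intro a b; rw [Finset.card_map, Int.card_Ico]
  have hmem : ∀ j', Inverted ℓ j j' ∨ Inverted ℓ j₀ j' → j' ∈ I j ∪ I j₀ := by
    rintro j' (h | h)
    · exact Finset.mem_union_left _ (hI _ _ h)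
    · exact Finset.mem_union_right _ (hI _ _ h)
  -- If the order is kept, the interval `[j₀, j)` and the preimage of `[ℓ j₀, ℓ j)` differ only by
  -- integers inverted with `j` or `j₀`, so comparing cardinalities suffices. If it is reversed,
  -- both sets consist of such integers, and the two lengths add up: hence the factor `2`.
  rcases le_total (ℓ j₀) (ℓ j) with hle | hle
  · have h1 : (Finset.Ico j₀ j) ⊆
        (Finset.Ico (ℓ j₀) (ℓ j)).map ℓ.symm.toEmbedding ∪ (I j ∪ I j₀) := by
      intro j' hj'
      rw [Finset.mem_Ico] at hj'
      by_cases hb : j' ∈ (Finset.Ico (ℓ j₀) (ℓ j)).map ℓ.symm.toEmbedding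
      · exact Finset.mem_union_left _ hb
      · refine Finset.mem_union_right _ (hmem _ ?_)
        rw [hB] at hb
        have := hinj j' j
        have := hinj j' j₀
        unfold Inverted
        grind
    have h2 : (Finset.Ico (ℓ j₀) (ℓ j)).map ℓ.symm.toEmbedding ⊆
        (Finset.Ico j₀ j) ∪ (I j ∪ I j₀) := by
      intro j' hj'
      rw [hB] at hj'
      by_cases hb : j' ∈ Finset.Ico j₀ j
      · exact Finset.mem_union_left _ hb
      · refine Finset.mem_union_right _ (hmem _ ?_)
        rw [Finset.mem_Ico] at hb
        have := hinj j' j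
        have := hinj j' j₀
        unfold Inverted
        grind
    have h3 := (Finset.card_le_card h1).trans (Finset.card_union_le _ _)
    have h4 := (Finset.card_le_card h2).trans (Finset.card_union_le _ _)
    rw [hBc, Int.card_Ico] at h3 h4
    rw [abs_le]
    omega
  · have h1 : (Finset.Ico j₀ j) ⊆ I j ∪ I j₀ := by
      intro j' hj'
      rw [Finset.mem_Ico] at hj'
      refine hmem _ ?_
      have := hinj j' j
      have := hinj j' j₀
      have := hinj j j₀
      unfold Inverted
      grind
    have h2 : (Finset.Ico (ℓ j) (ℓ j₀)).map ℓ.symm.toEmbedding ⊆ I j ∪ I j₀ := by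
      intro j' hj'
      rw [hB] at hj'
      refine hmem _ ?_
      have := hinj j' j
      have := hinj j' j₀
      unfold Inverted
      grind
    have h3 := Finset.card_le_card h1
    have h4 := Finset.card_le_card h2
    rw [hBc] at h4
    rw [Int.card_Ico] at h3
    rw [abs_le]
    omega

lemma card_filter_abs_le (K : ℤ) {r : ℝ} (hr : 0 ≤ r) :
    (((Finset.Icc (-K) K).filter fun d : ℤ => |(d : ℝ)| ≤ r).card : ℝ) ≤ 2 * r + 1 := by
  have h : ((Finset.Icc (-K) K).filter fun d : ℤ => |(d : ℝ)| ≤ r) ⊆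
      Finset.Icc (-⌊r⌋) ⌊r⌋ := by
    intro d hd
    have hd := (Finset.mem_filter.1 hd).2
    rw [← Int.cast_abs, ← Int.le_floor, abs_le] at hd
    exact Finset.mem_Icc.2 hd
  have h2 := Finset.card_le_card h
  rw [Int.card_Icc] at h2
  have h0 : 0 ≤ ⌊r⌋ := Int.floor_nonneg.2 hr
  have h3 : (((Finset.Icc (-K) K).filter fun d : ℤ => |(d : ℝ)| ≤ r).card : ℤ) ≤ 2 * ⌊r⌋ + 1 := by
    omega
  have h4 : (((Finset.Icc (-K) K).filter fun d : ℤ => |(d : ℝ)| ≤ r).card : ℝ) ≤ 2 * ⌊r⌋ + 1 := by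
    exact_mod_cast h3
  linarith [Int.floor_le r]

/-- If the inversions of a permutation of the integers are controlled by a periodic function, then
this permutation is close to a translation. -/
lemma exists_translation_of_inverted_le {N : ℕ} [NeZero N] (ℓ : Equiv.Perm ℤ) (ε : ZMod N → ℝ)
    (hε : ∀ c, 0 ≤ ε c)
    (hinv : ∀ j j' : ℤ, j < j' → ℓ j' < ℓ j → ((j' - j : ℤ) : ℝ) ≤ ε j + ε j') :
    ∃ k : ℤ, ∑ c : ZMod N, |(((c.val : ℤ) - ℓ c.val - k : ℤ) : ℝ)| ≤
      ∑ c : ZMod N, (32 * ε c + 8) := by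
  classical
  set E : ℝ := ∑ c : ZMod N, ε c with hE
  have hεE : ∀ c, ε c ≤ E := fun c => Finset.single_le_sum (fun c _ => hε c) (Finset.mem_univ c)
  set K : ℤ := ⌈2 * E⌉ with hK
  set W : Finset ℤ := Finset.Icc (-K) K with hW
  -- An inversion at offset `d` has `|d| ≤ ε j + ε (j + d)`, hence is charged to the larger of the
  -- two errors. The window `W` only serves to make the sets finite.
  set D : ℤ → Finset ℤ := fun j => (W.filter fun d : ℤ => |(d : ℝ)| ≤ 2 * ε (j : ZMod N)) ∪
    (W.filter fun d : ℤ => |(d : ℝ)| ≤ 2 * ε ((j : ZMod N) + (d : ZMod N))) with hD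
  set I : ℤ → Finset ℤ := fun j => (D j).map (addLeftEmbedding j) with hIdef
  have hI : ∀ j j', Inverted ℓ j j' → j' ∈ I j := by
    intro j j' h
    have hle : |((j' - j : ℤ) : ℝ)| ≤ ε j + ε j' := by
      rcases h with h | h
      · rw [abs_of_nonneg (by exact_mod_cast (by omega : (0:ℤ) ≤ j' - j))]
        exact hinv _ _ h.1 h.2
      · rw [← abs_neg, ← Int.cast_neg, neg_sub,
          abs_of_nonneg (by exact_mod_cast (by omega : (0:ℤ) ≤ j - j')), add_comm]
        exact hinv _ _ h.1 h.2
    rw [hIdef, Finset.mem_map]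
    refine ⟨j' - j, ?_, by simp⟩
    have hWm : j' - j ∈ W := by
      have h5 : |((j' - j : ℤ) : ℝ)| ≤ 2 * E := by linarith [hεE j, hεE j']
      rw [hW, Finset.mem_Icc, ← abs_le, ← Int.cast_le (R := ℝ), Int.cast_abs]
      exact h5.trans (Int.le_ceil _)
    have hcast : ((j : ZMod N) + ((j' - j : ℤ) : ZMod N)) = (j' : ZMod N) := by
      push_cast; ring
    rw [hD, Finset.mem_union, Finset.mem_filter, Finset.mem_filter, hcast]
    rcases le_total (ε j) (ε j') with h | h
    · exact Or.inr ⟨hWm, by linarith⟩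
    · exact Or.inl ⟨hWm, by linarith⟩
  have hcount : ∑ c : ZMod N, ((I c.val).card : ℝ) ≤ ∑ c : ZMod N, (8 * ε c + 2) := by
    have h1 : ∀ c : ZMod N, ((I c.val).card : ℝ) ≤
        (4 * ε c + 1) + ∑ d ∈ W, if |(d : ℝ)| ≤ 2 * ε (c + d) then (1 : ℝ) else 0 := by
      intro c
      rw [hIdef, Finset.card_map]
      refine (Nat.cast_le.2 (Finset.card_union_le _ _)).trans ?_
      rw [Nat.cast_add]
      have hc : (((c.val : ℕ) : ℤ) : ZMod N) = c := by simp
      rw [hc]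
      refine add_le_add ?_ (le_of_eq ?_)
      · refine (card_filter_abs_le K (by linarith [hε c])).trans ?_
        linarith
      · rw [Finset.sum_boole]
    refine (Finset.sum_le_sum fun c _ => h1 c).trans ?_
    rw [Finset.sum_add_distrib, Finset.sum_comm]
    -- Periodicity: at a fixed offset, summing over a full period moves the charge from `c` to `c +
    -- d`.
    have h2 : ∀ d : ℤ, ∑ c : ZMod N, (if |(d : ℝ)| ≤ 2 * ε (c + d) then (1 : ℝ) else 0) =
        ∑ c : ZMod N, if |(d : ℝ)| ≤ 2 * ε c then (1 : ℝ) else 0 := fun d =>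
      Equiv.sum_comp (Equiv.addRight (d : ZMod N))
        (fun c => if |(d : ℝ)| ≤ 2 * ε c then (1 : ℝ) else 0)
    simp only [h2]
    rw [Finset.sum_comm, ← Finset.sum_add_distrib]
    refine Finset.sum_le_sum fun c _ => ?_
    rw [Finset.sum_boole]
    have := card_filter_abs_le K (r := 2 * ε c) (by linarith [hε c])
    linarith
  -- The translation is the displacement of the residue with the fewest candidate inversions, whose
  -- count is then absorbed by that of any other residue.
  obtain ⟨c₀, -, hc₀⟩ := Finset.exists_min_image (Finset.univ : Finset (ZMod N))
    (fun c => ((I c.val).card : ℝ)) ⟨0, Finset.mem_univ _⟩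
  refine ⟨(c₀.val : ℤ) - ℓ c₀.val, ?_⟩
  calc _ ≤ ∑ c : ZMod N, 4 * ((I c.val).card : ℝ) := by
        refine Finset.sum_le_sum fun c _ => ?_
        have h := abs_displacement_sub_le ℓ I hI c₀.val c.val
        have h' : |((((c.val : ℤ) - ℓ c.val) - ((c₀.val : ℤ) - ℓ c₀.val) : ℤ) : ℝ)| ≤
            2 * (((I c.val).card : ℝ) + (I c₀.val).card) := by
          rw [← Int.cast_abs]; exact_mod_cast h
        have h'' := hc₀ c (Finset.mem_univ c)
        linarith
    _ ≤ 4 * ∑ c : ZMod N, (8 * ε c + 2) := by rw [← Finset.mul_sum]; gcongr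
    _ = _ := by rw [Finset.mul_sum]; exact Finset.sum_congr rfl fun c _ => by ring

/-- The canonical bijection from `Fin N` onto the integers modulo `N`. -/
def finEquivZMod (N : ℕ) [NeZero N] : Fin N ≃ ZMod N where
  toFun r := ((r : ℕ) : ZMod N)
  invFun c := ⟨c.val, c.val_lt⟩
  left_inv r := Fin.ext (ZMod.val_cast_of_lt r.2)
  right_inv c := ZMod.natCast_zmod_val c

/-- If points sorted in trigonometric order are matched with the points of the grid, then they are
almost as well matched with the points of the grid in increasing order, after some shift. -/
lemma exists_shift_of_matching {N : ℕ} [NeZero N] (θ : Fin N → ℝ) (hθ : Monotone θ)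
    (hθ0 : ∀ l, 0 ≤ θ l) (hθ1 : ∀ l, θ l < 2 * Real.pi) (β : Fin N ≃ ZMod N) :
    ∃ k : Fin N, ∑ l : Fin N, geoDist (Circle.exp (θ l)) (root N (k + l)) ≤
      33 * ∑ l, geoDist (Circle.exp (θ l)) (ZMod.toCircle (β l)) + 16 * Real.pi := by
  have hN : (0 : ℝ) < N := Nat.cast_pos.2 (NeZero.pos N)
  have hpi := Real.pi_pos
  set γ : Fin N ≃ Fin N := (finEquivZMod N).trans β.symm with hγ
  have hq : ∀ r : Fin N, ∃ q : ℤ, |θ (γ r) - 2 * Real.pi * (r : ℕ) / N - 2 * Real.pi * q| =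
      geoDist (Circle.exp (θ (γ r))) (ZMod.toCircle ((r : ℕ) : ZMod N)) := by
    intro r
    obtain ⟨q, hq⟩ := exists_int_abs_sub_eq_geoDist (θ (γ r)) (2 * Real.pi * (r : ℕ) / N)
    refine ⟨q, hq.trans ?_⟩
    rw [← root_eq_toCircle, root]
  choose q hq using hq
  set D := Int.divModEquiv N with hD
  -- In the coordinates (turn, position), a lifted grid index is sent to the lifted rank of the
  -- point matched with it, the turn being corrected by the winding number `q`. `T` is the lifted
  -- argument of a rank in units of the grid step: it is monotone in the rank and differs by `ε`
  -- from the grid index.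
  set shear : Equiv.Perm (ℤ × Fin N) :=
    { toFun := fun p => (p.1 - q p.2, γ p.2)
      invFun := fun p => (p.1 + q (γ.symm p.2), γ.symm p.2)
      left_inv := fun p => by simp
      right_inv := fun p => by simp } with hshear
  set ℓ : Equiv.Perm ℤ := D.trans (shear.trans D.symm) with hℓ
  set T : ℤ × Fin N → ℝ := fun p => N * p.1 + N * θ p.2 / (2 * Real.pi) with hT
  have hDs : ∀ p : ℤ × Fin N, D.symm p = p.1 * N + ((p.2 : ℕ) : ℤ) := fun p => rfl
  have hTmono : ∀ p p', D.symm p < D.symm p' → T p ≤ T p' := by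
    rintro ⟨a, r⟩ ⟨a', r'⟩ h
    rw [hDs, hDs] at h
    have hr : ((r : ℕ) : ℤ) < N := by exact_mod_cast r.2
    have hr' : ((r' : ℕ) : ℤ) < N := by exact_mod_cast r'.2
    have haa : a ≤ a' := by
      by_contra hcon
      have : a' + 1 ≤ a := by omega
      dsimp only at h
      nlinarith
    rcases haa.eq_or_lt with rfl | hlt
    · have hrr : r ≤ r' := by
        rw [Fin.le_def]
        dsimp only at h
        omega
      have := hθ hrr
      simp only [hT]
      gcongr
    · have h1 : (a : ℝ) + 1 ≤ a' := by exact_mod_cast hlt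
      have h2 : N * θ r / (2 * Real.pi) ≤ N := by
        rw [div_le_iff₀ (by positivity)]
        exact mul_le_mul_of_nonneg_left (hθ1 r).le hN.le
      have h3 : 0 ≤ N * θ r' / (2 * Real.pi) := by
        have := hθ0 r'
        positivity
      simp only [hT]
      nlinarith
  set ε : ZMod N → ℝ := fun c =>
    N / (2 * Real.pi) * geoDist (Circle.exp (θ (β.symm c))) (ZMod.toCircle c) with hε
  have hεr : ∀ p : ℤ × Fin N, |T (shear p) - (D.symm p : ℤ)| = ε (D.symm p : ℤ) := by
    rintro ⟨a, r⟩
    have h1 : ((D.symm (a, r) : ℤ) : ZMod N) = ((r : ℕ) : ZMod N) := by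
      rw [hDs]; push_cast; simp
    have h2 : T (shear (a, r)) - (D.symm (a, r) : ℤ) =
        N / (2 * Real.pi) * (θ (γ r) - 2 * Real.pi * (r : ℕ) / N - 2 * Real.pi * q r) := by
      rw [hDs]
      simp only [hT, hshear, Equiv.coe_fn_mk]
      push_cast
      field_simp
      ring
    rw [h1, h2, abs_mul, abs_of_pos (by positivity), hq r]
    simp only [hε]
    rfl
  have hτ : ∀ j : ℤ, |T (shear (D j)) - j| = ε j := by
    intro j
    have := hεr (D j)
    rwa [Equiv.symm_apply_apply] at this
  -- An inversion of `j < j'` forces the lifted argument matched with `j'` to be at most that of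
  -- `j`, although they are within `ε` of `j'` and `j`.
  obtain ⟨k, hk⟩ := exists_translation_of_inverted_le ℓ ε
    (fun c => mul_nonneg (by positivity) (geoDist_nonneg _ _)) (by
      intro j j' _ h
      have h1 := hTmono (shear (D j')) (shear (D j)) h
      have h2 := (abs_le.1 (hτ j).le).2
      have h3 := (abs_le.1 (hτ j').le).1
      push_cast
      linarith)
  have hkey : ∀ c : ZMod N, geoDist (Circle.exp (θ (β.symm c)))
      (ZMod.toCircle ((k : ZMod N) + ((β.symm c : ℕ) : ZMod N))) ≤
      2 * Real.pi / N * (ε c + |(((c.val : ℤ) - ℓ c.val - k : ℤ) : ℝ)|) := by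
    intro c
    set r : Fin N := (finEquivZMod N).symm c with hr
    have hrc : ((r : ℕ) : ZMod N) = c := (finEquivZMod N).apply_symm_apply c
    have hrv : (r : ℕ) = c.val := rfl
    have hγr : γ r = β.symm c := by simp [hγ, hr]
    have h1 : (c.val : ℤ) = D.symm (0, r) := by rw [hDs]; simp [hrv]
    have h2 : ℓ c.val = -(q r) * N + ((γ r : ℕ) : ℤ) := by
      rw [h1, hℓ, Equiv.trans_apply, Equiv.apply_symm_apply, Equiv.trans_apply, hDs]
      simp [hshear]
    have h4 : (k : ZMod N) + ((β.symm c : ℕ) : ZMod N) = ((k + ((γ r : ℕ) : ℤ) : ℤ) : ZMod N) := by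
      rw [← hγr]; push_cast; rfl
    rw [h4, toCircle_intCast_eq_exp]
    refine (geoDist_exp_le _ _).trans ?_
    have h5 : ε c = N / (2 * Real.pi) *
        |θ (γ r) - 2 * Real.pi * (r : ℕ) / N - 2 * Real.pi * q r| := by
      rw [hq r, hrc, hγr]
    have h6 : θ (β.symm c) - 2 * Real.pi * ((k + ((γ r : ℕ) : ℤ) : ℤ) : ℝ) / N =
        (θ (γ r) - 2 * Real.pi * (r : ℕ) / N - 2 * Real.pi * q r) +
        2 * Real.pi / N * (((c.val : ℤ) - ℓ c.val - k : ℤ) : ℝ) := by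
      rw [h2, ← hrv, ← hγr]
      push_cast
      field_simp
      ring
    rw [h6, h5]
    refine (abs_add_le _ _).trans (le_of_eq ?_)
    rw [abs_mul, abs_of_pos (by positivity : 0 < 2 * Real.pi / N)]
    field_simp
  have hsumε : ∑ c, ε c = N / (2 * Real.pi) *
      ∑ l, geoDist (Circle.exp (θ l)) (ZMod.toCircle (β l)) := by
    rw [hε, ← Finset.mul_sum, ← Equiv.sum_comp β]
    simp
  refine ⟨(finEquivZMod N).symm k, ?_⟩
  calc _ = ∑ c : ZMod N, geoDist (Circle.exp (θ (β.symm c)))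
        (ZMod.toCircle ((k : ZMod N) + ((β.symm c : ℕ) : ZMod N))) := by
        rw [← Equiv.sum_comp β.symm]
        refine Finset.sum_congr rfl fun c _ => ?_
        rw [root_eq_toCircle]
        have : ((((finEquivZMod N).symm k : Fin N) : ℕ) : ZMod N) = (k : ZMod N) :=
          (finEquivZMod N).apply_symm_apply k
        rw [Nat.cast_add, this]
    _ ≤ ∑ c, 2 * Real.pi / N * (ε c + |(((c.val : ℤ) - ℓ c.val - k : ℤ) : ℝ)|) :=
        Finset.sum_le_sum fun c _ => hkey c
    _ ≤ 2 * Real.pi / N * (∑ c, ε c + ∑ c : ZMod N, (32 * ε c + 8)) := by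
        rw [← Finset.mul_sum, Finset.sum_add_distrib]
        gcongr
    _ = _ := by
        have h32 : ∑ c, 32 * ε c = 32 * ∑ c, ε c := by rw [Finset.mul_sum]
        rw [Finset.sum_add_distrib, h32, hsumε]
        simp only [Finset.sum_const, Finset.card_univ, ZMod.card, nsmul_eq_mul]
        field_simp
        ring

/-! ### Min-max bounds for the leading eigenvalues -/

section MinMax

variable {N : ℕ} {M : Fin N → Fin N → ℝ}

/-- The eigenvector of a symmetric matrix associated with the `i`-th largest eigenvalue. -/
noncomputable def rankedEigenvector (hM : (Matrix.of M).IsHermitian)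
    (i : Fin (Fintype.card (Fin N))) : EuclideanSpace ℝ (Fin N) :=
  hM.eigenvectorBasis (Fintype.equivOfCardEq (Fintype.card_fin _) i)

lemma sum_sq_eq_sum_inner_sq (hM : (Matrix.of M).IsHermitian) (x : Fin N → ℝ) :
    ∑ l, x l ^ 2 = ∑ i, inner ℝ (rankedEigenvector hM i) (WithLp.toLp 2 x) ^ 2 := by
  have h := hM.eigenvectorBasis.sum_sq_norm_inner_right (WithLp.toLp 2 x)
  rw [EuclideanSpace.norm_sq_eq] at h
  simp only [Real.norm_eq_abs, sq_abs] at h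
  rw [← h]
  exact (Equiv.sum_comp (Fintype.equivOfCardEq (Fintype.card_fin _)) (fun j =>
    inner ℝ (hM.eigenvectorBasis j) (WithLp.toLp 2 x) ^ 2)).symm

lemma quadForm_eq_sum_eigenvalues (hM : (Matrix.of M).IsHermitian) (x : Fin N → ℝ) :
    ∑ k, ∑ l, x k * x l * M k l =
      ∑ i, hM.eigenvalues₀ i * inner ℝ (rankedEigenvector hM i) (WithLp.toLp 2 x) ^ 2 := by
  have h1 : ∑ k, ∑ l, x k * x l * M k l =
      inner ℝ (WithLp.toLp 2 x) (WithLp.toLp 2 ((Matrix.of M).mulVec x)) := by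
    simp only [PiLp.inner_apply, Matrix.mulVec, dotProduct, RCLike.inner_apply, conj_trivial,
      Matrix.of_apply, Finset.sum_mul]
    exact Finset.sum_congr rfl fun k _ => Finset.sum_congr rfl fun l _ => by ring
  rw [h1, ← hM.eigenvectorBasis.sum_inner_mul_inner]
  rw [← Equiv.sum_comp (Fintype.equivOfCardEq (Fintype.card_fin _))]
  refine Finset.sum_congr rfl fun i _ => ?_
  have hvec := hM.mulVec_eigenvectorBasis (Fintype.equivOfCardEq (Fintype.card_fin _) i)
  have hval : hM.eigenvalues (Fintype.equivOfCardEq (Fintype.card_fin _) i) =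
      hM.eigenvalues₀ i := by
    rw [Matrix.IsHermitian.eigenvalues, Equiv.symm_apply_apply]
  rw [hval] at hvec
  set b := hM.eigenvectorBasis (Fintype.equivOfCardEq (Fintype.card_fin _) i) with hb
  have hb' : rankedEigenvector hM i = b := rfl
  have hsymm : inner ℝ b (WithLp.toLp 2 ((Matrix.of M).mulVec x)) =
      hM.eigenvalues₀ i * inner ℝ b (WithLp.toLp 2 x) := by
    have e1 : inner ℝ b (WithLp.toLp 2 ((Matrix.of M).mulVec x)) =
        dotProduct (WithLp.ofLp b) ((Matrix.of M).mulVec x) := by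
      simp [PiLp.inner_apply, dotProduct, mul_comm]
    have e2 : inner ℝ b (WithLp.toLp 2 x) = dotProduct (WithLp.ofLp b) x := by
      simp [PiLp.inner_apply, dotProduct, mul_comm]
    have hT : (Matrix.of M).transpose = Matrix.of M := by
      have := hM
      rwa [Matrix.IsHermitian, Matrix.conjTranspose_eq_transpose_of_trivial] at this
    rw [e1, e2, Matrix.dotProduct_mulVec, ← Matrix.mulVec_transpose, hT, hvec, smul_dotProduct,
      smul_eq_mul]
  rw [hsymm, hb', real_inner_comm]
  ring

/-- Courant–Fischer: a three-dimensional space contains a nonzero vector orthogonal to the top two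
eigenvectors, where the form is at most the third eigenvalue. -/
lemma le_eigenvalues₀_two (hM : (Matrix.of M).IsHermitian) (hN : 2 < Fintype.card (Fin N))
    (V : (Fin 3 → ℝ) →ₗ[ℝ] (Fin N → ℝ)) (hV : Function.Injective V) (m : ℝ)
    (h : ∀ a, m * ∑ l, V a l ^ 2 ≤ ∑ k, ∑ l, V a k * V a l * M k l) :
    m ≤ hM.eigenvalues₀ ⟨2, hN⟩ := by
  let L : (Fin 3 → ℝ) →ₗ[ℝ] (Fin 2 → ℝ) := LinearMap.pi fun j =>
    (innerSL ℝ (rankedEigenvector hM ⟨j, by omega⟩)).toLinearMap ∘ₗ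
      (WithLp.linearEquiv 2 ℝ (Fin N → ℝ)).symm.toLinearMap ∘ₗ V
  have hker : LinearMap.ker L ≠ ⊥ := LinearMap.ker_ne_bot_of_finrank_lt (by simp)
  obtain ⟨a, ha, ha0⟩ := Submodule.exists_mem_ne_zero_of_ne_bot hker
  have hj : ∀ j : Fin 2,
      inner ℝ (rankedEigenvector hM ⟨j, by omega⟩) (WithLp.toLp 2 (V a)) = 0 := fun j =>
    congrFun (LinearMap.mem_ker.1 ha) j
  have hx0 : V a ≠ 0 := fun h0 => ha0 (hV (by rw [h0, map_zero]))
  have hpos : 0 < ∑ l, V a l ^ 2 := by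
    obtain ⟨l, hl⟩ := Function.ne_iff.1 hx0
    exact Finset.sum_pos' (fun _ _ => sq_nonneg _) ⟨l, Finset.mem_univ _, by
      have : V a l ≠ 0 := hl
      positivity⟩
  refine le_of_mul_le_mul_right ((h a).trans ?_) hpos
  rw [quadForm_eq_sum_eigenvalues hM, sum_sq_eq_sum_inner_sq hM, Finset.mul_sum]
  refine Finset.sum_le_sum fun i _ => ?_
  by_cases hi : (i : ℕ) < 2
  · have : inner ℝ (rankedEigenvector hM i) (WithLp.toLp 2 (V a)) = 0 := hj ⟨i, hi⟩
    rw [this]; simp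
  · gcongr
    exact hM.eigenvalues₀_antitone (Fin.le_def.2 (Nat.not_lt.1 hi))

/-- The dual argument: the span of the top two eigenvectors meets the kernel of one linear form, and
the form there is at least the second eigenvalue. -/
lemma eigenvalues₀_one_le (hM : (Matrix.of M).IsHermitian) (hN : 1 < Fintype.card (Fin N))
    (φ : (Fin N → ℝ) →ₗ[ℝ] ℝ) (m : ℝ)
    (h : ∀ x, φ x = 0 → ∑ k, ∑ l, x k * x l * M k l ≤ m * ∑ l, x l ^ 2) :
    hM.eigenvalues₀ ⟨1, hN⟩ ≤ m := by
  let W : (Fin 2 → ℝ) →ₗ[ℝ] (Fin N → ℝ) := (WithLp.linearEquiv 2 ℝ (Fin N → ℝ)).toLinearMap ∘ₗ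
    Fintype.linearCombination ℝ (fun j : Fin 2 => rankedEigenvector hM ⟨j, by omega⟩)
  have hker : LinearMap.ker (φ ∘ₗ W) ≠ ⊥ := LinearMap.ker_ne_bot_of_finrank_lt (by simp)
  obtain ⟨a, ha, ha0⟩ := Submodule.exists_mem_ne_zero_of_ne_bot hker
  have hinner : ∀ i, inner ℝ (rankedEigenvector hM i) (WithLp.toLp 2 (W a)) =
      ∑ j : Fin 2, a j * if (i : ℕ) = j then 1 else 0 := by
    intro i
    have : WithLp.toLp 2 (W a) =
        ∑ j : Fin 2, a j • rankedEigenvector hM ⟨j, by omega⟩ := rfl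
    rw [this, inner_sum]
    refine Finset.sum_congr rfl fun j _ => ?_
    rw [inner_smul_right]
    congr 1
    have := orthonormal_iff_ite.1 hM.eigenvectorBasis.orthonormal
      (Fintype.equivOfCardEq (Fintype.card_fin _) i)
      (Fintype.equivOfCardEq (Fintype.card_fin _) ⟨j, by omega⟩)
    refine this.trans ?_
    simp [Fin.ext_iff]
  have hpos : 0 < ∑ l, W a l ^ 2 := by
    obtain ⟨j, hj⟩ := Function.ne_iff.1 ha0
    rw [sum_sq_eq_sum_inner_sq hM]
    refine Finset.sum_pos' (fun _ _ => sq_nonneg _) ⟨⟨j, by omega⟩, Finset.mem_univ _, ?_⟩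
    rw [hinner, Finset.sum_eq_single j]
    · have : a j ≠ 0 := hj
      simp only [if_true, mul_one]
      positivity
    · intro j' _ hjj'
      have : ¬ (j : ℕ) = j' := fun h => hjj' (Fin.ext h.symm)
      simp [this]
    · simp
  refine le_of_mul_le_mul_right (le_trans ?_ (h (W a) ha)) hpos
  rw [quadForm_eq_sum_eigenvalues hM, sum_sq_eq_sum_inner_sq hM, Finset.mul_sum]
  refine Finset.sum_le_sum fun i _ => ?_
  by_cases hi : (i : ℕ) < 2
  · gcongr
    exact hM.eigenvalues₀_antitone (Fin.le_def.2 (by dsimp only; omega))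
  · have : inner ℝ (rankedEigenvector hM i) (WithLp.toLp 2 (W a)) = 0 := by
      rw [hinner, Finset.sum_eq_zero]
      intro j _
      rw [if_neg (by omega), mul_zero]
    rw [this]; simp

end MinMax

/-! ### Perturbation of the second and third eigenvectors -/

/-- Polarization and the parallelogram identity; this allows operator norms to be handled through
quadratic forms only. -/
lemma abs_bilinForm_le {ι : Type*} [Fintype ι] {H : ι → ι → ℝ} (hsymm : ∀ k l, H k l = H l k)
    {h : ℝ} (hH : ∀ x : ι → ℝ, |∑ k, ∑ l, x k * x l * H k l| ≤ h * ∑ k, x k ^ 2) (y x : ι → ℝ) :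
    |∑ k, ∑ l, y k * x l * H k l| ≤ h / 2 * (∑ k, y k ^ 2 + ∑ k, x k ^ 2) := by
  have h1 := hH (fun k => y k + x k)
  have h2 := hH (fun k => y k - x k)
  have h3 : ∑ k, ∑ l, (y k + x k) * (y l + x l) * H k l -
      ∑ k, ∑ l, (y k - x k) * (y l - x l) * H k l = 4 * ∑ k, ∑ l, y k * x l * H k l := by
    have hsw : ∑ k, ∑ l, x k * y l * H k l = ∑ k, ∑ l, y k * x l * H k l := by
      rw [Finset.sum_comm]
      exact Finset.sum_congr rfl fun k _ => Finset.sum_congr rfl fun l _ => by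
        rw [hsymm l k]; ring
    have : 4 * ∑ k, ∑ l, y k * x l * H k l =
        2 * ∑ k, ∑ l, y k * x l * H k l + 2 * ∑ k, ∑ l, x k * y l * H k l := by rw [hsw]; ring
    rw [this]
    simp only [Finset.mul_sum, ← Finset.sum_sub_distrib, ← Finset.sum_add_distrib]
    exact Finset.sum_congr rfl fun k _ => Finset.sum_congr rfl fun l _ => by ring
  have h4 : ∑ k, (y k + x k) ^ 2 + ∑ k, (y k - x k) ^ 2 =
      2 * (∑ k, y k ^ 2 + ∑ k, x k ^ 2) := by
    simp only [Finset.mul_sum, ← Finset.sum_add_distrib]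
    exact Finset.sum_congr rfl fun k _ => by ring
  rw [abs_le] at h1 h2 ⊢
  have h5 : h * ∑ k, (y k + x k) ^ 2 + h * ∑ k, (y k - x k) ^ 2 =
      h * (2 * (∑ k, y k ^ 2 + ∑ k, x k ^ 2)) := by rw [← mul_add, h4]
  constructor <;> linarith

/-- If a vector `y` satisfies `g |y|² ≤ ⟨y, H u⟩` for a unit vector `u`, then `|y| ≤ h / g`. -/
lemma sum_sq_le_of_mul_le_bilinForm {ι : Type*} [Fintype ι] {H : ι → ι → ℝ}
    (hsymm : ∀ k l, H k l = H l k) {h g : ℝ} (hh : 0 < h) (hg : 0 < g)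
    (hH : ∀ x : ι → ℝ, |∑ k, ∑ l, x k * x l * H k l| ≤ h * ∑ k, x k ^ 2) (y u : ι → ℝ)
    (hu : ∑ k, u k ^ 2 = 1)
    (hy : g * ∑ k, y k ^ 2 ≤ |∑ k, ∑ l, y k * u l * H k l|) :
    ∑ k, y k ^ 2 ≤ h ^ 2 / g ^ 2 := by
  -- The polarized bound is not homogeneous; as `y` is expected to have norm about `h / g`, this
  -- scaling balances it against the unit vector `u`.
  have h1 := abs_bilinForm_le hsymm hH (fun k => g / h * y k) u
  have h2 : ∑ k, ∑ l, g / h * y k * u l * H k l = g / h * ∑ k, ∑ l, y k * u l * H k l := by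
    simp only [Finset.mul_sum]
    exact Finset.sum_congr rfl fun k _ => Finset.sum_congr rfl fun l _ => by ring
  have h3 : ∑ k, (g / h * y k) ^ 2 = (g / h) ^ 2 * ∑ k, y k ^ 2 := by
    simp only [Finset.mul_sum, mul_pow]
  rw [h2, h3, hu, abs_mul, abs_of_pos (by positivity)] at h1
  have h4 : g / h * (g * ∑ k, y k ^ 2) ≤ h / 2 * ((g / h) ^ 2 * ∑ k, y k ^ 2 + 1) :=
    (mul_le_mul_of_nonneg_left hy (by positivity)).trans h1
  have h5 : g ^ 2 * ∑ k, y k ^ 2 ≤ h ^ 2 := by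
    have h6 : g / h * (g * ∑ k, y k ^ 2) = g ^ 2 * (∑ k, y k ^ 2) / h := by ring
    have h7 : h / 2 * ((g / h) ^ 2 * ∑ k, y k ^ 2 + 1) =
        g ^ 2 * (∑ k, y k ^ 2) / h / 2 + h / 2 := by field_simp
    rw [h6, h7] at h4
    have h8 : g ^ 2 * (∑ k, y k ^ 2) / h ≤ h := by linarith
    rw [div_le_iff₀ hh] at h8
    linarith
  rw [le_div_iff₀ (by positivity)]
  linarith

section Perturbation

variable {N : ℕ} [NeZero N]

lemma sum_harmonics (hN : 2 < N) (τ : Fin N ≃ ZMod N) :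
    (∑ l, (ZMod.toCircle (τ l) : ℂ).re = 0) ∧ (∑ l, (ZMod.toCircle (τ l) : ℂ).im = 0) ∧
    (∑ l, (ZMod.toCircle (τ l) : ℂ).re * (ZMod.toCircle (τ l) : ℂ).im = 0) ∧
    (∑ l, (ZMod.toCircle (τ l) : ℂ).re ^ 2 = N / 2) ∧
    (∑ l, (ZMod.toCircle (τ l) : ℂ).im ^ 2 = N / 2) := by
  have h1 := sum_toCircle (N := N) (by omega)
  have h2 := sum_toCircle_pow (N := N) (m := 2) (natCast_zmod_ne_zero two_pos hN)
  rw [← Equiv.sum_comp τ] at h1 h2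
  have h3 : ∑ l, (ZMod.toCircle (τ l) : ℂ).re ^ 2 = N / 2 := by
    have := sum_mul_toCircle_re_sq hN 1
    rw [← Equiv.sum_comp τ] at this
    simpa using this
  refine ⟨?_, ?_, ?_, h3, ?_⟩
  · rw [← Complex.re_sum, h1, Complex.zero_re]
  · rw [← Complex.im_sum, h1, Complex.zero_im]
  · have := congrArg Complex.im h2
    rw [Complex.im_sum, Complex.zero_im] at this
    have e : ∀ l, ((ZMod.toCircle (τ l) : ℂ) ^ 2).im =
        2 * ((ZMod.toCircle (τ l) : ℂ).re * (ZMod.toCircle (τ l) : ℂ).im) := fun l => by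
      rw [sq, Complex.mul_im]; ring
    simp only [e] at this
    rw [← Finset.mul_sum] at this
    linarith
  · have e : ∀ l, (ZMod.toCircle (τ l) : ℂ).im ^ 2 = 1 - (ZMod.toCircle (τ l) : ℂ).re ^ 2 :=
      fun l => by
        have := Circle.normSq_coe (ZMod.toCircle (τ l))
        rw [Complex.normSq_apply] at this
        linarith
    simp only [e]
    rw [Finset.sum_sub_distrib, h3]
    simp
    ring

lemma sum_affinity_mul_harmonics (τ : Fin N ≃ ZMod N) (k : Fin N) :
    (∑ l, affinity (ZMod.toCircle (τ k)) (ZMod.toCircle (τ l)) = zerothEigenvalue N) ∧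
    (∑ l, affinity (ZMod.toCircle (τ k)) (ZMod.toCircle (τ l)) * (ZMod.toCircle (τ l) : ℂ).re =
      firstEigenvalue N * (ZMod.toCircle (τ k) : ℂ).re) ∧
    (∑ l, affinity (ZMod.toCircle (τ k)) (ZMod.toCircle (τ l)) * (ZMod.toCircle (τ l) : ℂ).im =
      firstEigenvalue N * (ZMod.toCircle (τ k) : ℂ).im) := by
  have h1 := sum_affinity (τ k)
  have h2 := sum_affinity_mul_toCircle (τ k)
  rw [← Equiv.sum_comp τ] at h1 h2
  refine ⟨h1, ?_, ?_⟩
  · have := congrArg Complex.re h2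
    rw [Complex.re_sum] at this
    simpa only [Complex.re_ofReal_mul] using this
  · have := congrArg Complex.im h2
    rw [Complex.im_sum] at this
    simpa only [Complex.im_ofReal_mul] using this

/-- The component of `u` that is orthogonal to the first harmonics of the grid. -/
noncomputable def residual (τ : Fin N ≃ ZMod N) (u : Fin N → ℝ) (l : Fin N) : ℝ :=
  u l - 2 / N * (∑ m, u m * (ZMod.toCircle (τ m) : ℂ).re) * (ZMod.toCircle (τ l) : ℂ).re -
    2 / N * (∑ m, u m * (ZMod.toCircle (τ m) : ℂ).im) * (ZMod.toCircle (τ l) : ℂ).im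

variable {M : Fin N → Fin N → ℝ} {τ : Fin N ≃ ZMod N} {h : ℝ}

/-- An eigenvector whose eigenvalue is close to the second one of the affinity matrix of the grid
almost lies in the span of the first harmonics. -/
lemma sum_residual_sq_le (hN : 2 < N) (hM : ∀ k l, M k l = M l k) (hh : 0 < h)
    (hhN : h ≤ 0.005 * N)
    (hH : ∀ x : Fin N → ℝ, |∑ k, ∑ l, x k * x l *
      (M k l - affinity (ZMod.toCircle (τ k)) (ZMod.toCircle (τ l)))| ≤ h * ∑ k, x k ^ 2)
    (u : Fin N → ℝ) (hu : ∑ k, u k ^ 2 = 1) (α : ℝ) (hα : ∀ k, ∑ l, M k l * u l = α * u k)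
    (hα1 : firstEigenvalue N - h ≤ α) (hα2 : α ≤ 0.254 * N + h) :
    ∑ l, residual τ u l ^ 2 ≤ 750 * h ^ 2 / N ^ 2 := by
  have hNpos : (0 : ℝ) < N := Nat.cast_pos.2 (by omega)
  obtain ⟨s1, s2, s3, s4, s5⟩ := sum_harmonics hN τ
  have hF := fun k => sum_affinity_mul_harmonics τ k
  have hl := (abs_le.1 (abs_firstEigenvalue_sub_le hN)).1
  have hl0 := le_zerothEigenvalue (N := N)
  set F : Fin N → Fin N → ℝ := fun k l => affinity (ZMod.toCircle (τ k)) (ZMod.toCircle (τ l))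
    with hFdef
  set c : Fin N → ℝ := fun l => (ZMod.toCircle (τ l) : ℂ).re with hc
  set s : Fin N → ℝ := fun l => (ZMod.toCircle (τ l) : ℂ).im with hs
  replace s1 : ∑ l, c l = 0 := s1
  replace s2 : ∑ l, s l = 0 := s2
  replace s3 : ∑ l, c l * s l = 0 := s3
  replace s4 : ∑ l, c l ^ 2 = N / 2 := s4
  replace s5 : ∑ l, s l ^ 2 = N / 2 := s5
  set lam := firstEigenvalue N
  set lam0 := zerothEigenvalue N
  have hFsymm : ∀ k l, F k l = F l k := fun k l => by
    simp only [hFdef, affinity, geoDist_comm]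
  have hsymm : ∀ k l, M k l - F k l = M l k - F l k := fun k l => by rw [hM, hFsymm]
  -- As `M u = α u`, testing the perturbation against a component `y` of `u` gives `α ⟨y, u⟩ - ⟨y, F
  -- u⟩`. Where `F` is far from `α`, this is at least the gap times `|y|²` in absolute value.
  have hBil : ∀ y : Fin N → ℝ, ∑ k, ∑ l, y k * u l * (M k l - F k l) =
      α * ∑ k, y k * u k - ∑ k, y k * ∑ l, F k l * u l := by
    intro y
    have : ∀ k, ∑ l, y k * u l * (M k l - F k l) =
        α * (y k * u k) - y k * ∑ l, F k l * u l := by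
      intro k
      have e : α * (y k * u k) = y k * ∑ l, M k l * u l := by rw [hα]; ring
      rw [e, ← mul_sub, ← Finset.sum_sub_distrib, Finset.mul_sum]
      exact Finset.sum_congr rfl fun l _ => by ring
    simp only [this]
    rw [Finset.sum_sub_distrib, ← Finset.mul_sum]
  set A0 : ℝ := ∑ m, u m with hA0
  set A1 : ℝ := ∑ m, u m * c m with hA1
  set A2 : ℝ := ∑ m, u m * s m with hA2
  -- the component on the constants
  have hconst : A0 ^ 2 / N ≤ 17.3 * h ^ 2 / N ^ 2 := by
    have hB : ∑ k, ∑ l, (A0 * u l) * (M k l - F k l) = -((lam0 - α) * A0 ^ 2) := by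
      rw [hBil (fun _ => A0), ← Finset.mul_sum, ← Finset.mul_sum, Finset.sum_comm]
      have : ∀ l, ∑ k, F k l * u l = lam0 * u l := fun l => by
        rw [← Finset.sum_mul]
        congr 1
        simp only [hFsymm _ l]
        exact (hF l).1
      simp only [this]
      rw [← Finset.mul_sum, ← hA0]
      ring
    -- `0.241 = 0.5 - 0.254 - 0.005`. The gap has no factor `N` here, since the test vector is the
    -- constant `A0`, with squared norm `N A0²`.
    have h1 := sum_sq_le_of_mul_le_bilinForm hsymm hh (g := 0.241) (by norm_num) hH
      (fun _ => A0) u hu (by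
        rw [hB, abs_neg]
        refine le_trans ?_ (le_abs_self _)
        simp only [Finset.sum_const, Finset.card_univ, Fintype.card_fin, nsmul_eq_mul]
        have : 0.241 * N ≤ lam0 - α := by linarith
        nlinarith [sq_nonneg A0])
    simp only [Finset.sum_const, Finset.card_univ, Fintype.card_fin, nsmul_eq_mul] at h1
    rw [div_le_div_iff₀ hNpos (by positivity)]
    have h2 : N * A0 ^ 2 ≤ 17.3 * h ^ 2 := by
      refine h1.trans ?_
      rw [div_le_iff₀ (by positivity)]
      nlinarith [sq_nonneg h]
    nlinarith
  -- the component orthogonal to the constants and to the first harmonics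
  set p : Fin N → ℝ := fun l => u l - A0 / N - 2 / N * A1 * c l - 2 / N * A2 * s l with hp
  have hp0 : ∑ l, p l = 0 := by
    simp only [hp, Finset.sum_sub_distrib, ← Finset.mul_sum, s1, s2]
    simp only [Finset.sum_const, Finset.card_univ, Fintype.card_fin, nsmul_eq_mul]
    field_simp
    rw [hA0]; ring
  have hpc : ∑ l, p l * c l = 0 := by
    have : ∀ l, p l * c l = u l * c l - A0 / N * c l - 2 / N * A1 * c l ^ 2 -
        2 / N * A2 * (c l * s l) := fun l => by simp only [hp]; ring
    simp only [this, Finset.sum_sub_distrib, ← Finset.mul_sum, s1, s3, s4]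
    rw [← hA1]; field_simp; ring
  have hps : ∑ l, p l * s l = 0 := by
    have : ∀ l, p l * s l = u l * s l - A0 / N * s l - 2 / N * A1 * (c l * s l) -
        2 / N * A2 * s l ^ 2 := fun l => by simp only [hp]; ring
    simp only [this, Finset.sum_sub_distrib, ← Finset.mul_sum, s2, s3, s5]
    rw [← hA2]; field_simp; ring
  have hu' : ∀ l, u l = p l + A0 / N + 2 / N * A1 * c l + 2 / N * A2 * s l := fun l => by
    simp only [hp]; ring
  have hpu : ∑ l, p l * u l = ∑ l, p l ^ 2 := by
    have : ∀ l, p l * u l = p l ^ 2 + A0 / N * p l + 2 / N * A1 * (p l * c l) +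
        2 / N * A2 * (p l * s l) := fun l => by rw [hu' l]; ring
    simp only [this, Finset.sum_add_distrib, ← Finset.mul_sum, hp0, hpc, hps]
    ring
  have hpF : ∑ k, p k * ∑ l, F k l * u l = ∑ k, ∑ l, p k * p l * F k l := by
    have e1 : ∀ k, ∑ l, F k l * u l = ∑ l, F k l * p l + A0 / N * lam0 +
        2 / N * A1 * (lam * c k) + 2 / N * A2 * (lam * s k) := by
      intro k
      obtain ⟨f0, f1, f2⟩ := hF k
      rw [← f0, ← f1, ← f2]
      simp only [Finset.mul_sum, ← Finset.sum_add_distrib]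
      exact Finset.sum_congr rfl fun l _ => by rw [hu' l]; simp only [hFdef]; ring
    have e2 : ∀ k, p k * ∑ l, F k l * u l = ∑ l, p k * p l * F k l + A0 / N * lam0 * p k +
        2 / N * A1 * lam * (p k * c k) + 2 / N * A2 * lam * (p k * s k) := by
      intro k
      rw [e1]
      have : ∑ l, p k * p l * F k l = p k * ∑ l, F k l * p l := by
        rw [Finset.mul_sum]
        exact Finset.sum_congr rfl fun l _ => by ring
      rw [this]; ring
    simp only [e2, Finset.sum_add_distrib, ← Finset.mul_sum, hp0, hpc, hps]
    ring
  have hpq : |∑ k, ∑ l, p k * p l * F k l| ≤ 0.034 * N * ∑ l, p l ^ 2 := by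
    have h1 := abs_quadForm_affinity_sub_le (fun l => ZMod.toCircle (τ l)) p
    have h2 : ∑ k, (p k : ℂ) * (ZMod.toCircle (τ k) : ℂ) = 0 := by
      apply Complex.ext
      · rw [Complex.re_sum, Complex.zero_re]
        simpa only [Complex.re_ofReal_mul] using hpc
      · rw [Complex.im_sum, Complex.zero_im]
        simpa only [Complex.im_ofReal_mul] using hps
    rw [hp0, h2, Fintype.card_fin] at h1
    simpa using h1
  have hpp : ∑ l, p l ^ 2 ≤ 730.5 * h ^ 2 / N ^ 2 := by
    -- `0.037 = 0.076 - 0.005 - 0.034`: the lower bound on `α` minus the size of the form on the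
    -- remaining frequencies.
    have h1 := sum_sq_le_of_mul_le_bilinForm hsymm hh (g := 0.037 * N) (by positivity) hH
      p u hu (by
        rw [hBil, hpu, hpF]
        refine le_trans ?_ (le_abs_self _)
        have h2 := (abs_le.1 hpq).2
        have h3 : 0.071 * N ≤ α := by linarith
        have h4 : 0 ≤ ∑ l, p l ^ 2 := Finset.sum_nonneg fun _ _ => sq_nonneg _
        nlinarith)
    refine h1.trans ?_
    rw [div_le_div_iff₀ (by positivity) (by positivity)]
    have : 0 ≤ h ^ 2 * N ^ 2 := by positivity
    nlinarith
  have hres : ∑ l, residual τ u l ^ 2 = ∑ l, p l ^ 2 + A0 ^ 2 / N := by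
    have : ∀ l, residual τ u l ^ 2 = p l ^ 2 + 2 * (A0 / N) * p l + (A0 / N) ^ 2 := fun l => by
      simp only [residual, hp]; ring
    simp only [this, Finset.sum_add_distrib, ← Finset.mul_sum, hp0]
    simp only [Finset.sum_const, Finset.card_univ, Fintype.card_fin, nsmul_eq_mul]
    field_simp
    ring
  rw [hres]
  have : 730.5 * h ^ 2 / N ^ 2 + 17.3 * h ^ 2 / N ^ 2 ≤ 750 * h ^ 2 / N ^ 2 := by
    rw [← add_div]
    gcongr
    nlinarith [sq_nonneg h]
  linarith

/-- Location of the second and third eigenvalues of a perturbation of the affinity matrix of the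
grid. -/
lemma eigenvalues₀_bounds (hN : 2 < N) (hM : (Matrix.of M).IsHermitian)
    (hcard : 2 < Fintype.card (Fin N))
    (hH : ∀ x : Fin N → ℝ, |∑ k, ∑ l, x k * x l *
      (M k l - affinity (ZMod.toCircle (τ k)) (ZMod.toCircle (τ l)))| ≤ h * ∑ k, x k ^ 2) :
    firstEigenvalue N - h ≤ hM.eigenvalues₀ ⟨2, hcard⟩ ∧
      hM.eigenvalues₀ ⟨1, by omega⟩ ≤ 0.254 * N + h := by
  have hNpos : (0 : ℝ) < N := Nat.cast_pos.2 (by omega)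
  have hsplit : ∀ x : Fin N → ℝ, ∑ k, ∑ l, x k * x l * M k l =
      ∑ k, ∑ l, x k * x l * affinity (ZMod.toCircle (τ k)) (ZMod.toCircle (τ l)) +
      ∑ k, ∑ l, x k * x l *
        (M k l - affinity (ZMod.toCircle (τ k)) (ZMod.toCircle (τ l))) := by
    intro x
    simp only [← Finset.sum_add_distrib]
    exact Finset.sum_congr rfl fun k _ => Finset.sum_congr rfl fun l _ => by ring
  constructor
  · obtain ⟨s1, s2, s3, s4, s5⟩ := sum_harmonics hN τ
    have hF := fun k => sum_affinity_mul_harmonics τ k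
    have hl := (abs_le.1 (abs_firstEigenvalue_sub_le hN)).2
    have hl0 := le_zerothEigenvalue (N := N)
    -- The trial space is spanned by the constants and the first harmonics, an orthogonal family;
    -- the affinity form there is at least `firstEigenvalue N` because `zerothEigenvalue N` is
    -- larger.
    let V : (Fin 3 → ℝ) →ₗ[ℝ] (Fin N → ℝ) := Fintype.linearCombination ℝ
      ![fun _ => 1, fun l => (ZMod.toCircle (τ l) : ℂ).re, fun l => (ZMod.toCircle (τ l) : ℂ).im]
    have hVa : ∀ a l, V a l = a 0 + a 1 * (ZMod.toCircle (τ l) : ℂ).re +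
        a 2 * (ZMod.toCircle (τ l) : ℂ).im := by
      intro a l
      simp [V, Fintype.linearCombination_apply, Fin.sum_univ_three]
    have hsq : ∀ a, ∑ l, V a l ^ 2 = N * a 0 ^ 2 + N / 2 * a 1 ^ 2 + N / 2 * a 2 ^ 2 := by
      intro a
      have : ∀ l, V a l ^ 2 = a 0 ^ 2 + a 1 ^ 2 * (ZMod.toCircle (τ l) : ℂ).re ^ 2 +
          a 2 ^ 2 * (ZMod.toCircle (τ l) : ℂ).im ^ 2 +
          2 * a 0 * a 1 * (ZMod.toCircle (τ l) : ℂ).re +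
          2 * a 0 * a 2 * (ZMod.toCircle (τ l) : ℂ).im +
          2 * a 1 * a 2 * ((ZMod.toCircle (τ l) : ℂ).re * (ZMod.toCircle (τ l) : ℂ).im) :=
        fun l => by rw [hVa]; ring
      simp only [this, Finset.sum_add_distrib, ← Finset.mul_sum, s1, s2, s3, s4, s5]
      simp only [Finset.sum_const, Finset.card_univ, Fintype.card_fin, nsmul_eq_mul]
      ring
    have hquad : ∀ a, ∑ k, ∑ l, V a k * V a l *
        affinity (ZMod.toCircle (τ k)) (ZMod.toCircle (τ l)) =
        zerothEigenvalue N * (N * a 0 ^ 2) +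
          firstEigenvalue N * (N / 2 * a 1 ^ 2 + N / 2 * a 2 ^ 2) := by
      intro a
      have e1 : ∀ k, ∑ l, V a k * V a l * affinity (ZMod.toCircle (τ k)) (ZMod.toCircle (τ l)) =
          V a k * (zerothEigenvalue N * a 0 + firstEigenvalue N * (V a k - a 0)) := by
        intro k
        obtain ⟨f0, f1, f2⟩ := hF k
        have : firstEigenvalue N * (V a k - a 0) =
            a 1 * (firstEigenvalue N * (ZMod.toCircle (τ k) : ℂ).re) +
            a 2 * (firstEigenvalue N * (ZMod.toCircle (τ k) : ℂ).im) := by rw [hVa]; ring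
        rw [this, ← f0, ← f1, ← f2]
        simp only [Finset.mul_sum, Finset.sum_mul, ← Finset.sum_add_distrib]
        exact Finset.sum_congr rfl fun l _ => by rw [hVa a l]; ring
      have e2 : ∑ k, V a k = N * a 0 := by
        simp only [hVa, Finset.sum_add_distrib, ← Finset.mul_sum, s1, s2]
        simp
      have e3 : ∀ k, V a k * (zerothEigenvalue N * a 0 + firstEigenvalue N * (V a k - a 0)) =
          (zerothEigenvalue N - firstEigenvalue N) * a 0 * V a k +
            firstEigenvalue N * V a k ^ 2 := fun k => by ring
      simp only [e1, e3, Finset.sum_add_distrib, ← Finset.mul_sum, e2, hsq]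
      ring
    refine le_eigenvalues₀_two hM hcard V ?_ _ ?_
    · rw [injective_iff_map_eq_zero]
      intro a ha
      have h0 := hsq a
      simp only [ha, Pi.zero_apply] at h0
      have hz : (N : ℝ) * a 0 ^ 2 + N / 2 * a 1 ^ 2 + N / 2 * a 2 ^ 2 = 0 := by
        rw [← h0]; simp
      have p0 : 0 ≤ (N : ℝ) * a 0 ^ 2 := by positivity
      have p1 : 0 ≤ (N : ℝ) / 2 * a 1 ^ 2 := by positivity
      have p2 : 0 ≤ (N : ℝ) / 2 * a 2 ^ 2 := by positivity
      have z0 : (N : ℝ) * a 0 ^ 2 = 0 := by linarith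
      have z1 : (N : ℝ) / 2 * a 1 ^ 2 = 0 := by linarith
      have z2 : (N : ℝ) / 2 * a 2 ^ 2 = 0 := by linarith
      funext i
      fin_cases i
      · simpa [hNpos.ne'] using z0
      · simpa [hNpos.ne'] using z1
      · simpa [hNpos.ne'] using z2
    · intro a
      have h1 := (abs_le.1 (hH (V a))).1
      rw [hsplit, hquad]
      rw [hsq] at h1 ⊢
      have h2 : firstEigenvalue N ≤ zerothEigenvalue N := by linarith
      have h3 : firstEigenvalue N * (N * a 0 ^ 2) ≤ zerothEigenvalue N * (N * a 0 ^ 2) :=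
        mul_le_mul_of_nonneg_right h2 (by positivity)
      linarith
  -- Orthogonality to the constants removes the term `3/4`. Cauchy–Schwarz on the first harmonic is
  -- crude (`0.22 N` for about `0.11 N`), but `0.254 N` is still well below `N / 2`.
  · let φ : (Fin N → ℝ) →ₗ[ℝ] ℝ := ∑ l, LinearMap.proj l
    refine eigenvalues₀_one_le hM (by omega) φ _ fun x hx => ?_
    have hx0 : ∑ l, x l = 0 := by simpa [φ] using hx
    have h1 := (abs_le.1 (hH x)).2
    have h2 := (abs_le.1 (abs_quadForm_affinity_sub_le (fun l => ZMod.toCircle (τ l)) x)).2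
    rw [hx0, Fintype.card_fin] at h2
    have h3 : ‖∑ k, (x k : ℂ) * (ZMod.toCircle (τ k) : ℂ)‖ ^ 2 ≤ N * ∑ k, x k ^ 2 := by
      calc _ ≤ (∑ k, |x k|) ^ 2 := by
            gcongr
            refine (norm_sum_le _ _).trans (Finset.sum_le_sum fun g _ => ?_)
            rw [norm_mul, Circle.norm_coe, mul_one, Complex.norm_real, Real.norm_eq_abs]
        _ ≤ (Finset.univ : Finset (Fin N)).card * ∑ k, |x k| ^ 2 := sq_sum_le_card_mul_sum_sq
        _ = _ := by simp
    rw [hsplit]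
    linarith

end Perturbation

/-! ### Spectral localization is accurate in mean -/

/-- For the moduli `α`, `β` of the two harmonic coefficients: a small product makes the smaller one
small, and then the norm identity forces the other one to be close to `1`. -/
lemma coefficient_bounds {α β n S ζ : ℝ} (hα : 0 ≤ α) (hβ : 0 ≤ β) (hβα : β ≤ α) (hn : 0 < n)
    (hS0 : 0 ≤ S) (hS : S ≤ n * ζ) (hαβ : 2 * (α * β) * n ≤ S)
    (hnorm : n * (α ^ 2 + β ^ 2) + S = n) :
    α ≤ 1 ∧ β ^ 2 ≤ ζ / 2 ∧ (1 - α) ^ 2 ≤ 3 / 2 * ζ := by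
  have h1 : α ^ 2 + β ^ 2 ≤ 1 := le_of_mul_le_mul_left (a := n) (by linarith) hn
  have h2 : 1 - ζ ≤ α ^ 2 + β ^ 2 := le_of_mul_le_mul_left (a := n) (by linarith) hn
  have h3 : 2 * (α * β) ≤ ζ := le_of_mul_le_mul_left (a := n) (by linarith) hn
  have h4 : β ^ 2 ≤ α * β := by rw [sq]; exact mul_le_mul_of_nonneg_right hβα hβ
  have h5 : α ≤ 1 := by
    rw [← sq_le_one_iff₀ hα]
    linarith [sq_nonneg β]
  have h6 : (1 - α) ^ 2 ≤ 1 - α ^ 2 := by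
    have := mul_nonneg hα (sub_nonneg.2 h5)
    linarith [this, (by ring : (1 - α) ^ 2 = 1 - α ^ 2 - 2 * (α * (1 - α)))]
  exact ⟨h5, by linarith, by linarith⟩

lemma add_three_sq_le (x y z : ℝ) : (x + y + z) ^ 2 ≤ 3 * (x ^ 2 + y ^ 2 + z ^ 2) := by
  linarith [sq_nonneg (x - y), sq_nonneg (y - z), sq_nonneg (x - z),
    (by ring : 3 * (x ^ 2 + y ^ 2 + z ^ 2) - (x + y + z) ^ 2 =
      (x - y) ^ 2 + (y - z) ^ 2 + (x - z) ^ 2)]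

open ComplexConjugate in
/-- Vectors with the moments of the regular grid that are close to the span of `r` and `conj r` are
close to a rotation of `r`, if their component on `r` dominates. -/
lemma exists_rotation_close {ι : Type*} [Fintype ι] [Nonempty ι] {r w : ι → ℂ} {a b : ℂ} {ζ : ℝ}
    (hr : ∀ l, r l * conj (r l) = 1) (hr2 : ∑ l, r l ^ 2 = 0)
    (hw2 : ∑ l, w l ^ 2 = 0) (hw : ∑ l, ‖w l‖ ^ 2 = Fintype.card ι)
    (ha : Fintype.card ι * a = ∑ l, w l * conj (r l)) (hb : Fintype.card ι * b = ∑ l, w l * r l)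
    (hP : ∑ l, ‖w l - (a * r l + b * conj (r l))‖ ^ 2 ≤ Fintype.card ι * ζ)
    (hba : ‖b‖ ≤ ‖a‖) :
    ∃ q : Circle, ∑ l, ‖w l - q * r l‖ ^ 2 ≤ 9 * Fintype.card ι * ζ := by
  set n : ℕ := Fintype.card ι with hn
  have hn0 : (0 : ℝ) < n := Nat.cast_pos.2 Fintype.card_pos
  have hr2c : ∑ l, conj (r l) ^ 2 = 0 := by
    have := congrArg conj hr2
    simpa [map_sum] using this
  set P : ι → ℂ := fun l => w l - (a * r l + b * conj (r l)) with hPdef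
  have hPr : ∑ l, P l * conj (r l) = 0 := by
    have : ∀ l, P l * conj (r l) = w l * conj (r l) - a * (r l * conj (r l)) -
        b * conj (r l) ^ 2 := fun l => by simp only [hPdef]; ring
    simp only [this, Finset.sum_sub_distrib, ← Finset.mul_sum, hr, hr2c, ← ha]
    simp [hn]; ring
  have hPr' : ∑ l, P l * r l = 0 := by
    have : ∀ l, P l * r l = w l * r l - a * r l ^ 2 - b * (r l * conj (r l)) :=
      fun l => by simp only [hPdef]; ring
    simp only [this, Finset.sum_sub_distrib, ← Finset.mul_sum, hr, hr2, ← hb]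
    simp [hn]; ring
  have hPrc : ∑ l, conj (P l) * r l = 0 := by
    have := congrArg conj hPr
    simpa [map_sum] using this
  have hPrc' : ∑ l, conj (P l) * conj (r l) = 0 := by
    have := congrArg conj hPr'
    simpa [map_sum] using this
  have hwP : ∀ l, w l = a * r l + b * conj (r l) + P l := fun l => by simp only [hPdef]; ring
  -- the product of the two coefficients is small
  have hab : 2 * a * b * n = -∑ l, P l ^ 2 := by
    have : ∀ l, w l ^ 2 = a ^ 2 * r l ^ 2 + b ^ 2 * conj (r l) ^ 2 +
        2 * a * b * (r l * conj (r l)) + 2 * a * (P l * r l) + 2 * b * (P l * conj (r l)) +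
        P l ^ 2 := fun l => by rw [hwP l]; ring
    simp only [this, Finset.sum_add_distrib, ← Finset.mul_sum, hr, hr2, hr2c, hPr, hPr'] at hw2
    simp only [Finset.sum_const, Finset.card_univ, nsmul_eq_mul] at hw2
    linear_combination hw2
  have hS : ∑ l, ‖P l‖ ^ 2 ≤ n * ζ := hP
  set S : ℝ := ∑ l, ‖P l‖ ^ 2 with hSdef
  have hS0 : 0 ≤ S := Finset.sum_nonneg fun _ _ => by positivity
  have habn : 2 * (‖a‖ * ‖b‖) * n ≤ S := by
    have h1 := congrArg norm hab
    rw [norm_neg] at h1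
    have h2 : ‖∑ l, P l ^ 2‖ ≤ S := by
      refine (norm_sum_le _ _).trans (le_of_eq ?_)
      simp [hSdef]
    rw [← h1] at h2
    simpa [mul_assoc] using h2
  -- the two coefficients have almost unit norm
  have hnorm : n * (‖a‖ ^ 2 + ‖b‖ ^ 2) + S = n := by
    have h0 : ∀ z : ℂ, ((‖z‖ ^ 2 : ℝ) : ℂ) = z * conj z := fun z => by
      rw [Complex.mul_conj, Complex.normSq_eq_norm_sq]
    have h1 : ∀ l, w l * conj (w l) = (a * conj a + b * conj b) * (r l * conj (r l)) +
        a * conj b * r l ^ 2 + b * conj a * conj (r l) ^ 2 + a * (conj (P l) * r l) +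
        b * (conj (P l) * conj (r l)) + conj a * (P l * conj (r l)) + conj b * (P l * r l) +
        P l * conj (P l) := fun l => by
      rw [hwP l]; simp only [map_add, map_mul, Complex.conj_conj]; ring
    have h2 : ∑ l, w l * conj (w l) = (a * conj a + b * conj b) * n + ∑ l, P l * conj (P l) := by
      simp only [h1, Finset.sum_add_distrib, ← Finset.mul_sum, hr, hr2, hr2c, hPr, hPr', hPrc,
        hPrc']
      simp only [Finset.sum_const, Finset.card_univ, nsmul_eq_mul]
      rw [← hn]; ring
    simp only [← h0, ← Complex.ofReal_sum] at h2
    rw [hw] at h2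
    have h3 : (n : ℝ) = (‖a‖ ^ 2 + ‖b‖ ^ 2) * n + S := by exact_mod_cast h2
    linarith
  have hα0 : 0 ≤ ‖a‖ := norm_nonneg a
  have hβ0 : 0 ≤ ‖b‖ := norm_nonneg b
  obtain ⟨ha_le, hb2, hdiff⟩ := coefficient_bounds hα0 hβ0 hba hn0 hS0 hS habn hnorm
  -- The rotation is the phase of the dominant coefficient, so that replacing `a` by it costs
  -- exactly `1 - ‖a‖`.
  refine ⟨Circle.exp (Complex.arg a), ?_⟩
  set q : ℂ := (Circle.exp (Complex.arg a) : ℂ) with hq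
  have haq : a = ‖a‖ * q := by
    rw [hq, Circle.coe_exp, Complex.norm_mul_exp_arg_mul_I]
  have haq' : ‖a - q‖ = 1 - ‖a‖ := by
    have : a - q = ((‖a‖ - 1 : ℝ) : ℂ) * q := by
      push_cast; linear_combination haq
    rw [this, norm_mul, hq, Circle.norm_coe, Complex.norm_real, Real.norm_eq_abs, mul_one,
      abs_of_nonpos (by linarith)]
    ring
  have hrn : ∀ l, ‖r l‖ = 1 := fun l => by
    have h1 := congrArg norm (hr l)
    rw [norm_mul, Complex.norm_conj, norm_one] at h1
    nlinarith [norm_nonneg (r l)]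
  calc ∑ l, ‖w l - q * r l‖ ^ 2 ≤ ∑ l, 3 * (2 * ζ + ‖P l‖ ^ 2) := by
        refine Finset.sum_le_sum fun l _ => ?_
        have h1 : w l - q * r l = (a - q) * r l + b * conj (r l) + P l := by
          simp only [hPdef]; ring
        have h2 : ‖w l - q * r l‖ ≤ (1 - ‖a‖) + ‖b‖ + ‖P l‖ := by
          rw [h1]
          refine (norm_add₃_le).trans (le_of_eq ?_)
          rw [norm_mul, norm_mul, Complex.norm_conj, hrn, haq', mul_one, mul_one]
        have h3 : ‖w l - q * r l‖ ^ 2 ≤ ((1 - ‖a‖) + ‖b‖ + ‖P l‖) ^ 2 := by gcongr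
        linarith [add_three_sq_le (1 - ‖a‖) ‖b‖ ‖P l‖]
    _ = 3 * (2 * n * ζ + S) := by
        rw [← Finset.mul_sum, Finset.sum_add_distrib]
        simp only [Finset.sum_const, Finset.card_univ, nsmul_eq_mul, ← hn]
        ring
    _ ≤ _ := by linarith

open ComplexConjugate in
/-- The output of the vanilla spectral algorithm, on a perturbation of the affinity matrix of the
regular grid, is close to the grid up to an orthogonal transformation. -/
lemma IsVSA.exists_isometry_close {N : ℕ} [NeZero N] {M : Fin N → Fin N → ℝ} {τ : Fin N ≃ ZMod N}
    {h : ℝ} {w : Fin N → ℂ} (hw : IsVSA M w) (hh : 0 < h) (hhN : h ≤ 0.005 * N)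
    (hH : ∀ x : Fin N → ℝ, |∑ k, ∑ l, x k * x l *
      (M k l - affinity (ZMod.toCircle (τ k)) (ZMod.toCircle (τ l)))| ≤ h * ∑ k, x k ^ 2) :
    ∃ Q : ℂ ≃ₗᵢ[ℝ] ℂ, ∑ l, ‖w l - Q (ZMod.toCircle (τ l) : ℂ)‖ ^ 2 ≤ 6750 * h ^ 2 / N := by
  obtain ⟨hM, hcard, u, v, hu, hv, huu, hvv, huv, hwl⟩ := hw
  have hN : 2 < N := by simpa using hcard
  have hNpos : (0 : ℝ) < N := Nat.cast_pos.2 (by omega)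
  have hMsymm : ∀ k l, M k l = M l k := fun k l => by
    have := hM.apply l k
    simpa using this
  obtain ⟨hlow, hup⟩ := eigenvalues₀_bounds hN hM hcard hH
  have hanti : hM.eigenvalues₀ ⟨2, hcard⟩ ≤ hM.eigenvalues₀ ⟨1, by omega⟩ :=
    hM.eigenvalues₀_antitone (Fin.le_def.2 (by simp))
  have hsqu : ∑ k, u k ^ 2 = 1 := by rw [← huu]; simp [dotProduct, sq]
  have hsqv : ∑ k, v k ^ 2 = 1 := by rw [← hvv]; simp [dotProduct, sq]
  have huv0 : ∑ k, u k * v k = 0 := huv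
  have hru := sum_residual_sq_le hN hMsymm hh hhN hH u hsqu _
    (fun k => congrFun hu k) (hlow.trans hanti) hup
  have hrv := sum_residual_sq_le hN hMsymm hh hhN hH v hsqv _
    (fun k => congrFun hv k) hlow (hanti.trans hup)
  set ζ : ℝ := 750 * h ^ 2 / N ^ 2 with hζ
  have hwu : ∀ l, (w l).re = Real.sqrt (N / 2) * u l := fun l => by rw [hwl]
  have hwv : ∀ l, (w l).im = Real.sqrt (N / 2) * v l := fun l => by rw [hwl]
  have hsqrt : Real.sqrt (N / 2) ^ 2 = N / 2 := Real.sq_sqrt (by positivity)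
  have hw1 : ∑ l, ‖w l‖ ^ 2 = Fintype.card (Fin N) := by
    have : ∀ l, ‖w l‖ ^ 2 = N / 2 * (u l ^ 2) + N / 2 * (v l ^ 2) := fun l => by
      rw [← Complex.normSq_eq_norm_sq, Complex.normSq_apply, hwu, hwv]
      linear_combination (u l ^ 2 + v l ^ 2) * hsqrt
    simp only [this, Finset.sum_add_distrib, ← Finset.mul_sum, hsqu, hsqv, Fintype.card_fin]
    ring
  -- Equal norms and orthogonality of `u` and `v` are the real and imaginary parts of this identity,
  -- which the grid also satisfies. It will rule out a mixture of the two orientations.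
  have hw2 : ∑ l, w l ^ 2 = 0 := by
    apply Complex.ext
    · have : ∀ l, (w l ^ 2).re = N / 2 * (u l ^ 2) - N / 2 * (v l ^ 2) := fun l => by
        rw [sq, Complex.mul_re, hwu, hwv]
        linear_combination (u l ^ 2 - v l ^ 2) * hsqrt
      simp only [Complex.re_sum, this, Finset.sum_sub_distrib, ← Finset.mul_sum, hsqu, hsqv]
      simp
    · have : ∀ l, (w l ^ 2).im = N * (u l * v l) := fun l => by
        rw [sq, Complex.mul_im, hwu, hwv]
        have : Real.sqrt (N / 2) * u l * (Real.sqrt (N / 2) * v l) +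
          Real.sqrt (N / 2) * v l * (Real.sqrt (N / 2) * u l) =
            2 * Real.sqrt (N / 2) ^ 2 * (u l * v l) := by ring
        rw [this, hsqrt]; ring
      simp only [Complex.im_sum, this, ← Finset.mul_sum, huv0]
      simp
  set r : Fin N → ℂ := fun l => (ZMod.toCircle (τ l) : ℂ) with hr
  have hr1 : ∀ l, r l * conj (r l) = 1 := fun l => by
    rw [Complex.mul_conj, hr]; simp only [Circle.normSq_coe]; simp
  have hr2 : ∑ l, r l ^ 2 = 0 := by
    have := sum_toCircle_pow (N := N) (m := 2) (natCast_zmod_ne_zero two_pos hN)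
    rwa [← Equiv.sum_comp τ] at this
  set a : ℂ := (∑ l, w l * conj (r l)) / N with ha
  set b : ℂ := (∑ l, w l * r l) / N with hb
  have hNc : (N : ℂ) ≠ 0 := by exact_mod_cast hNpos.ne'
  -- The complex span of `r` and `conj r` is the complexified span of the two real harmonics, so the
  -- residuals of `u` and `v` are the real and imaginary parts of the complex one, up to scaling.
  have hPl : ∀ l, ‖w l - (a * r l + b * conj (r l))‖ ^ 2 =
      N / 2 * (residual τ u l ^ 2) + N / 2 * (residual τ v l ^ 2) := by
    intro l
    have e : a * r l + b * conj (r l) = ∑ m, (2 / N * ((r m).re * (r l).re + (r m).im * (r l).im) :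
        ℝ) * w m := by
      rw [ha, hb, div_mul_eq_mul_div, div_mul_eq_mul_div, ← add_div, Finset.sum_mul,
        Finset.sum_mul, ← Finset.sum_add_distrib, Finset.sum_div]
      refine Finset.sum_congr rfl fun m _ => ?_
      have h1 : conj (r m) * r l + r m * conj (r l) =
          ((2 * ((r m).re * (r l).re + (r m).im * (r l).im) : ℝ) : ℂ) := by
        apply Complex.ext
        · simp [Complex.mul_re]; ring
        · simp [Complex.mul_im]; ring
      have h2 : w m * conj (r m) * r l + w m * r m * conj (r l) =
          w m * (conj (r m) * r l + r m * conj (r l)) := by ring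
      rw [h2, h1]
      push_cast
      ring
    have ere : (w l - (a * r l + b * conj (r l))).re = Real.sqrt (N / 2) * residual τ u l := by
      rw [e, Complex.sub_re, Complex.re_sum, hwu]
      simp only [Complex.re_ofReal_mul, hwu, residual]
      rw [mul_sub, mul_sub, sub_sub]
      congr 1
      simp only [Finset.mul_sum, Finset.sum_mul, ← Finset.sum_add_distrib]
      exact Finset.sum_congr rfl fun m _ => by simp only [hr]; ring
    have eim : (w l - (a * r l + b * conj (r l))).im = Real.sqrt (N / 2) * residual τ v l := by
      rw [e, Complex.sub_im, Complex.im_sum, hwv]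
      simp only [Complex.im_ofReal_mul, hwv, residual]
      rw [mul_sub, mul_sub, sub_sub]
      congr 1
      simp only [Finset.mul_sum, Finset.sum_mul, ← Finset.sum_add_distrib]
      exact Finset.sum_congr rfl fun m _ => by simp only [hr]; ring
    rw [← Complex.normSq_eq_norm_sq, Complex.normSq_apply, ere, eim]
    linear_combination (residual τ u l ^ 2 + residual τ v l ^ 2) * hsqrt
  have hP : ∑ l, ‖w l - (a * r l + b * conj (r l))‖ ^ 2 ≤ Fintype.card (Fin N) * ζ := by
    simp only [hPl, Finset.sum_add_distrib, ← Finset.mul_sum, Fintype.card_fin]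
    nlinarith
  have hfin : 9 * (Fintype.card (Fin N) : ℝ) * ζ = 6750 * h ^ 2 / N := by
    rw [hζ, Fintype.card_fin]; field_simp; ring
  have haN : (Fintype.card (Fin N) : ℂ) * a = ∑ l, w l * conj (r l) := by
    rw [ha, Fintype.card_fin]; field_simp
  have hbN : (Fintype.card (Fin N) : ℂ) * b = ∑ l, w l * r l := by
    rw [hb, Fintype.card_fin]; field_simp
  -- The dominant coefficient decides the orientation: a rotation for `a`, a reflection for `b`.
  rcases le_total ‖b‖ ‖a‖ with hab | hab
  · obtain ⟨q, hq⟩ := exists_rotation_close hr1 hr2 hw2 hw1 haN hbN hP hab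
    refine ⟨rotation q, ?_⟩
    rw [hfin] at hq
    simpa using hq
  · obtain ⟨q, hq⟩ := exists_rotation_close (r := fun l => conj (r l)) (a := b) (b := a)
      (fun l => by rw [Complex.conj_conj, mul_comm]; exact hr1 l)
      (by have := congrArg conj hr2
          simpa [map_sum] using this) hw2 hw1
      (by simpa using hbN) haN (by
        refine le_trans (le_of_eq ?_) hP
        refine Finset.sum_congr rfl fun l _ => ?_
        rw [Complex.conj_conj, add_comm (b * _)]) hab
    refine ⟨Complex.conjLIE.trans (rotation q), ?_⟩
    rw [hfin] at hq
    simpa using hq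

lemma l1Norm_le (z : ℂ) : l1Norm z ≤ 2 * ‖z‖ := by
  unfold l1Norm
  linarith [Complex.abs_re_le_norm z, Complex.abs_im_le_norm z]

lemma norm_le_l1Norm (z : ℂ) : ‖z‖ ≤ l1Norm z := Complex.norm_le_abs_re_add_abs_im z

/-- The uniform approximation step outputs an enumeration of the regular grid. -/
lemma IsUniformApprox.exists_equiv {N : ℕ} [NeZero N] {w : Fin N → ℂ} {y : Fin N → Circle}
    (hy : IsUniformApprox w y) : ∃ β : Fin N ≃ ZMod N, ∀ l, y l = ZMod.toCircle (β l) := by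
  obtain ⟨z, σ, k, -, -, -, hk⟩ := hy
  refine ⟨σ.symm.trans ((finEquivZMod N).trans (Equiv.addLeft ((k : ℕ) : ZMod N))), fun l => ?_⟩
  have := hk (σ.symm l)
  rw [Equiv.apply_symm_apply] at this
  rw [this, root_eq_toCircle, Nat.cast_add]
  rfl

/-- The uniform approximation step preserves the mean accuracy of its input. -/
lemma IsUniformApprox.sum_geoDist_le {N : ℕ} [NeZero N] {w : Fin N → ℂ} {y : Fin N → Circle}
    (hy : IsUniformApprox w y) (τ : Fin N ≃ ZMod N) (Q : ℂ ≃ₗᵢ[ℝ] ℂ) :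
    ∑ l, geoDist (y l) (act Q (ZMod.toCircle (τ l))) ≤
      532 * ∑ l, ‖w l - Q (ZMod.toCircle (τ l) : ℂ)‖ + 1312 := by
  obtain ⟨z, σ, k, hz, hmono, hmin, hk⟩ := hy
  have hN : (0 : ℝ) < N := Nat.cast_pos.2 (NeZero.pos N)
  have hpi := Real.pi_pos
  have hpi4 := Real.pi_le_four
  set S := ∑ l, ‖w l - Q (ZMod.toCircle (τ l) : ℂ)‖ with hS
  have hS0 : 0 ≤ S := Finset.sum_nonneg fun _ _ => norm_nonneg _
  -- The target has modulus one, so normalizing `w l` moves it by no more than its own error. This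
  -- also covers `w l = 0`, with any choice of `z l`.
  have hz2 : ∀ l, ‖(z l : ℂ) - Q (ZMod.toCircle (τ l) : ℂ)‖ ≤
      2 * ‖w l - Q (ZMod.toCircle (τ l) : ℂ)‖ := by
    intro l
    have h1 : ‖(z l : ℂ) - w l‖ ≤ ‖w l - Q (ZMod.toCircle (τ l) : ℂ)‖ := by
      have e : (z l : ℂ) - w l = ((1 - ‖w l‖ : ℝ) : ℂ) * (z l : ℂ) := by
        push_cast; linear_combination hz l
      rw [e, norm_mul, Circle.norm_coe, mul_one, Complex.norm_real, Real.norm_eq_abs]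
      have h2 : ‖Q (ZMod.toCircle (τ l) : ℂ)‖ = 1 := by
        rw [LinearIsometryEquiv.norm_map, Circle.norm_coe]
      rw [← h2, norm_sub_rev (w l)]
      exact abs_norm_sub_norm_le _ _
    calc _ ≤ ‖(z l : ℂ) - w l‖ + ‖w l - Q (ZMod.toCircle (τ l) : ℂ)‖ := 
          norm_sub_le_norm_sub_add_norm_sub _ _ _
      _ ≤ _ := by linarith
  have hD1 : ∑ l, geoDist (z l) (act Q (ZMod.toCircle (τ l))) ≤ 4 * S := by
    rw [hS, Finset.mul_sum]
    refine Finset.sum_le_sum fun l _ => ?_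
    have h1 := geoDist_le_norm_sub (z l) (act Q (ZMod.toCircle (τ l)))
    rw [coe_act] at h1
    have h2 := hz2 l
    have h3 := norm_nonneg ((z l : ℂ) - Q (ZMod.toCircle (τ l) : ℂ))
    nlinarith
  -- Rounding `Q` to a permutation of the grid gives a bijective matching with the grid, at a total
  -- cost of at most `2π`.
  obtain ⟨ρ, hρ⟩ := exists_perm_geoDist_act_le (N := N) Q
  have hD2 : ∑ l, geoDist (z l) (ZMod.toCircle (ρ (τ l))) ≤ 4 * S + 8 := by
    calc _ ≤ ∑ l, (geoDist (z l) (act Q (ZMod.toCircle (τ l))) + 2 * Real.pi / N) :=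
          Finset.sum_le_sum fun l _ => (geoDist_triangle _ _ _).trans
            (add_le_add_right (hρ (τ l)) _)
      _ = ∑ l, geoDist (z l) (act Q (ZMod.toCircle (τ l))) + 2 * Real.pi := by
          rw [Finset.sum_add_distrib]
          simp only [Finset.sum_const, Finset.card_univ, Fintype.card_fin, nsmul_eq_mul]
          field_simp
      _ ≤ _ := by linarith
  obtain ⟨k₀, hk₀⟩ := exists_shift_of_matching (fun l => argument (z (σ l))) hmono
    (fun l => argument_nonneg _) (fun l => argument_lt _) (σ.trans (τ.trans ρ))
  simp only [exp_argument, Equiv.trans_apply] at hk₀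
  rw [Equiv.sum_comp σ (fun l => geoDist (z l) (ZMod.toCircle (ρ (τ l))))] at hk₀
  have hcost : shiftCost z σ k ≤ 2 * (33 * (4 * S + 8) + 64) := by
    refine (hmin k₀).trans ?_
    calc shiftCost z σ k₀ ≤ ∑ l, 2 * geoDist (z (σ l)) (root N (k₀ + l)) := by
          refine Finset.sum_le_sum fun l _ => (l1Norm_le _).trans ?_
          rw [norm_sub_rev]
          gcongr
          exact norm_sub_le_geoDist _ _
      _ ≤ _ := by
          rw [← Finset.mul_sum]
          linarith
  have hD3 : ∑ l, geoDist (y l) (z l) ≤ 2 * shiftCost z σ k := by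
    rw [← Equiv.sum_comp σ, shiftCost, Finset.mul_sum]
    refine Finset.sum_le_sum fun l _ => ?_
    rw [hk]
    have h1 := geoDist_le_norm_sub (root N (k + l)) (z (σ l))
    have h2 := norm_le_l1Norm ((root N (k + l) : ℂ) - (z (σ l) : ℂ))
    have h3 := norm_nonneg ((root N (k + l) : ℂ) - (z (σ l) : ℂ))
    nlinarith
  calc _ ≤ ∑ l, (geoDist (y l) (z l) + geoDist (z l) (act Q (ZMod.toCircle (τ l)))) :=
        Finset.sum_le_sum fun l _ => geoDist_triangle _ _ _
    _ ≤ _ := by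
        rw [Finset.sum_add_distrib]
        linarith

/-- Mean accuracy of spectral localization on a perturbation of the affinity matrix of the regular
grid. -/
lemma IsSpectralLocalization.sum_geoDist_le {N : ℕ} [NeZero N] {M : Fin N → Fin N → ℝ}
    {y : Fin N → Circle} (hy : IsSpectralLocalization M y) {τ : Fin N ≃ ZMod N} {h : ℝ}
    (hh : 0 < h) (hhN : h ≤ 0.005 * N)
    (hH : ∀ x : Fin N → ℝ, |∑ k, ∑ l, x k * x l *
      (M k l - affinity (ZMod.toCircle (τ k)) (ZMod.toCircle (τ l)))| ≤ h * ∑ k, x k ^ 2) :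
    (∃ β : Fin N ≃ ZMod N, ∀ l, y l = ZMod.toCircle (β l)) ∧
    ∃ Q : ℂ ≃ₗᵢ[ℝ] ℂ, ∑ l, geoDist (y l) (act Q (ZMod.toCircle (τ l))) ≤ 44000 * h + 1312 := by
  obtain ⟨w, hw, hy⟩ := hy
  obtain ⟨Q, hQ⟩ := hw.exists_isometry_close hh hhN hH
  have hN : (0 : ℝ) < N := Nat.cast_pos.2 (NeZero.pos N)
  refine ⟨hy.exists_equiv, Q, (hy.sum_geoDist_le τ Q).trans ?_⟩
  -- Cauchy–Schwarz trades the `ℓ²` bound for an `ℓ¹` bound; `82.5² > 6750` and `532 · 82.5 <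
  -- 44000`.
  have h1 : (∑ l, ‖w l - Q (ZMod.toCircle (τ l) : ℂ)‖) ^ 2 ≤ 6750 * h ^ 2 := by
    calc _ ≤ (Finset.univ : Finset (Fin N)).card *
          ∑ l, ‖w l - Q (ZMod.toCircle (τ l) : ℂ)‖ ^ 2 := sq_sum_le_card_mul_sum_sq
      _ ≤ N * (6750 * h ^ 2 / N) := by
          rw [Finset.card_univ, Fintype.card_fin]
          gcongr
      _ = _ := by field_simp
  have h2 : ∑ l, ‖w l - Q (ZMod.toCircle (τ l) : ℂ)‖ ≤ 82.5 * h := by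
    refine abs_le_of_sq_le_sq' (h1.trans ?_) (by positivity) |>.2
    nlinarith [sq_nonneg h]
  linarith

/-! ### The refinement step -/

lemma affinity_act (Q : ℂ ≃ₗᵢ[ℝ] ℂ) (x y : Circle) :
    affinity (act Q x) (act Q y) = affinity x y := by
  unfold affinity; rw [geoDist_act]

lemma affinity_self (x : Circle) : affinity x x = 1 := by
  simp [affinity, geoDist_self]

/-- A minimizer of the refinement criterion is accurate, when the initial positions are accurate in
mean and the noise is controlled. -/
lemma IsRefined.geoDist_le {n N : ℕ} [NeZero N] (hN : 2 < N) {A : Fin n → Fin n → ℝ}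
    {S : Finset (Fin n)} {hS : S.card = N} {y : Fin N → Circle} {i : Fin n} {z : Circle}
    (hz : IsRefined A S hS y i z) {β : Fin N ≃ ZMod N} (hβ : ∀ l, y l = ZMod.toCircle (β l))
    (x : Fin n → Circle) (Q : ℂ ≃ₗᵢ[ℝ] ℂ) {D t : ℝ}
    (hD : ∑ l, geoDist (y l) (act Q (x (S.orderEmbOfFin hS l))) ≤ D)
    (ht : ∀ a b : ZMod N, |∑ l, (A i (S.orderEmbOfFin hS l) -
      affinity (x i) (x (S.orderEmbOfFin hS l))) * (geoDist (ZMod.toCircle a) (y l) -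
        geoDist (ZMod.toCircle b) (y l))| ≤ t * geoDist (ZMod.toCircle a) (ZMod.toCircle b)) :
    geoDist z (act Q (x i)) ≤ (t + 1 + D / (2 * Real.pi)) / (0.007 * N) + 2 * Real.pi / N := by
  have hNpos : (0 : ℝ) < N := Nat.cast_pos.2 (by omega)
  have hpi := Real.pi_pos
  obtain ⟨hzg, hmin⟩ := hz
  obtain ⟨a, rfl⟩ := exists_toCircle_of_mem_grid hzg
  obtain ⟨b, hb⟩ := exists_geoDist_toCircle_le (N := N) (act Q (x i))
  set d := geoDist (ZMod.toCircle a) (ZMod.toCircle b) with hd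
  have hd0 : 0 ≤ d := geoDist_nonneg _ _
  set idx := S.orderEmbOfFin hS with hidx
  set G : Fin N → ℝ := fun l => geoDist (ZMod.toCircle a) (y l) - geoDist (ZMod.toCircle b) (y l)
    with hG
  have hGd : ∀ l, |G l| ≤ d := fun l => abs_geoDist_sub_le _ _ _
  have h1 : ∑ l, A i (idx l) * G l ≤ 0 := by
    have := isMinOn_iff.1 hmin _ (toCircle_mem_grid b)
    simp only [hG, mul_sub, Finset.sum_sub_distrib]
    linarith
  -- Noise, plus the errors of position, plus the noiseless criterion on the exact grid. Each of the
  -- first two is at most linear in `d`, the third grows like `d²`.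
  have h2 : ∑ l, A i (idx l) * G l = ∑ l, (A i (idx l) - affinity (x i) (x (idx l))) * G l +
      ∑ l, (affinity (x i) (x (idx l)) - affinity (ZMod.toCircle b) (y l)) * G l +
      ∑ l, affinity (ZMod.toCircle b) (y l) * G l := by
    simp only [← Finset.sum_add_distrib]
    exact Finset.sum_congr rfl fun l _ => by ring
  have h3 := (abs_le.1 (ht a b)).1
  have h4 : |∑ l, (affinity (x i) (x (idx l)) - affinity (ZMod.toCircle b) (y l)) * G l| ≤
      (1 + D / (2 * Real.pi)) * d := by
    calc _ ≤ ∑ l, (2 * Real.pi / N + geoDist (y l) (act Q (x (idx l)))) / (2 * Real.pi) * d := by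
          refine (Finset.abs_sum_le_sum_abs _ _).trans (Finset.sum_le_sum fun l _ => ?_)
          rw [abs_mul]
          refine mul_le_mul ?_ (hGd l) (abs_nonneg _)
            (div_nonneg (add_nonneg (by positivity) (geoDist_nonneg _ _)) (by positivity))
          rw [← affinity_act Q]
          refine (abs_affinity_sub_le _ _ _ _).trans ?_
          rw [geoDist_comm (y l)]
          gcongr
      _ = (1 + (∑ l, geoDist (y l) (act Q (x (idx l)))) / (2 * Real.pi)) * d := by
          rw [← Finset.sum_mul, ← Finset.sum_div, Finset.sum_add_distrib]
          simp only [Finset.sum_const, Finset.card_univ, Fintype.card_fin, nsmul_eq_mul]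
          field_simp
      _ ≤ _ := by gcongr
  have h5 : 0.007 * N * d ^ 2 ≤ ∑ l, affinity (ZMod.toCircle b) (y l) * G l := by
    refine (le_sum_affinity_mul_geoDist_sub hN a b).trans (le_of_eq ?_)
    rw [← Equiv.sum_comp β]
    simp only [hG, hβ]
  have h6 := (abs_le.1 h4).1
  have h7 : 0.007 * N * d ^ 2 ≤ (t + 1 + D / (2 * Real.pi)) * d := by linarith
  have h8 : geoDist (ZMod.toCircle a) (act Q (x i)) ≤ d + 2 * Real.pi / N := by
    refine (geoDist_triangle _ (ZMod.toCircle b) _).trans ?_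
    rw [geoDist_comm _ (act Q (x i))]
    linarith
  rcases hd0.eq_or_lt with h0 | hpos
  -- When `d = 0` only the sign of the bound matters; `0 ≤ t` is read off the noise bound at two
  -- distinct grid points.
  · have ht0 := ht 0 1
    have hDnonneg : 0 ≤ D := (Finset.sum_nonneg fun l _ => geoDist_nonneg _ _).trans hD
    have h01 : 0 < geoDist (ZMod.toCircle (0 : ZMod N)) (ZMod.toCircle (1 : ZMod N)) := by
      refine (geoDist_nonneg _ _).lt_of_ne fun h => ?_
      have h9 := norm_sub_le_geoDist (ZMod.toCircle (0 : ZMod N))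
        (ZMod.toCircle (1 : ZMod N))
      rw [← h] at h9
      have h10 := sub_eq_zero.1 (norm_le_zero_iff.1 h9)
      have h11 := ZMod.injective_toCircle (Circle.ext h10)
      have := natCast_zmod_ne_zero (N := N) (m := 1) one_pos (by omega)
      exact this (by simpa using h11.symm)
    have ht1 : 0 ≤ t := nonneg_of_mul_nonneg_left ((abs_nonneg _).trans ht0) h01
    have : 0 ≤ (t + 1 + D / (2 * Real.pi)) / (0.007 * N) := by positivity
    linarith
  · have h9 : d ≤ (t + 1 + D / (2 * Real.pi)) / (0.007 * N) := by
      rw [le_div_iff₀ (by positivity)]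
      refine le_of_mul_le_mul_right ?_ hpos
      calc d * (0.007 * N) * d = 0.007 * N * d ^ 2 := by ring
        _ ≤ _ := h7
    linarith

/-! ### The noise matrix -/

/-- The noise matrix, with null diagonal. -/
noncomputable def noise {n : ℕ} (x : Fin n → Circle) (A : Fin n → Fin n → ℝ) (i j : Fin n) : ℝ :=
  if i = j then 0 else A i j - affinity (x i) (x j)

/-- The block of the data matrix associated with a representative subset is close to the affinity
matrix of the regular grid. -/
lemma abs_quadForm_block_sub_le {n N : ℕ} [NeZero N] {x : Fin n → Circle}
    {A : Fin n → Fin n → ℝ} (hA : ∀ i, A i i = 0) {S : Finset (Fin n)} {hS : S.card = N}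
    {τ : Fin N ≃ ZMod N} {m κ : ℝ}
    (hm : ∀ y : Fin n → ℝ, |∑ i, ∑ j, y i * y j * noise x A i j| ≤ m * ∑ i, y i ^ 2)
    (hκ : ∀ l, geoDist (x (S.orderEmbOfFin hS l)) (ZMod.toCircle (τ l)) ≤ κ) (y : Fin N → ℝ) :
    |∑ k, ∑ l, y k * y l * (block S hS A k l -
      affinity (ZMod.toCircle (τ k)) (ZMod.toCircle (τ l)))| ≤
      (m + κ * N + 1) * ∑ k, y k ^ 2 := by
  have hpi := Real.pi_gt_three
  set idx := S.orderEmbOfFin hS with hidx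
  have hinj : Function.Injective idx := idx.injective
  have hκ0 : 0 ≤ κ := (geoDist_nonneg _ _).trans (hκ 0)
  set Y : Fin n → ℝ := Function.extend idx y 0 with hY
  have hYi : ∀ l, Y (idx l) = y l := fun l => hinj.extend_apply _ _ _
  have hYo : ∀ i, i ∉ Set.range idx → Y i = 0 := fun i hi => by
    rw [hY, Function.extend_apply' _ _ _ (fun ⟨l, hl⟩ => hi ⟨l, hl⟩)]; rfl
  have e1 : ∑ k, y k ^ 2 = ∑ i, Y i ^ 2 :=
    Fintype.sum_of_injective idx hinj _ _ (fun i hi => by rw [hYo i hi]; simp)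
      (fun l => by rw [hYi])
  have e2 : ∑ k, ∑ l, y k * y l * noise x A (idx k) (idx l) =
      ∑ i, ∑ j, Y i * Y j * noise x A i j := by
    refine Fintype.sum_of_injective idx hinj _ _ (fun i hi => ?_) (fun k => ?_)
    · simp [hYo i hi]
    · refine Fintype.sum_of_injective idx hinj _ _ (fun i hi => ?_) (fun l => ?_)
      · simp [hYo i hi]
      · rw [hYi, hYi]
  have h1 := hm Y
  rw [← e1, ← e2] at h1
  have e3 : ∑ k, ∑ l, y k * y l * (block S hS A k l -
      affinity (ZMod.toCircle (τ k)) (ZMod.toCircle (τ l))) =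
      ∑ k, ∑ l, y k * y l * noise x A (idx k) (idx l) +
      ∑ k, ∑ l, y k * y l * (affinity (x (idx k)) (x (idx l)) -
        affinity (ZMod.toCircle (τ k)) (ZMod.toCircle (τ l))) - ∑ k, y k ^ 2 := by
    -- The diagonal of the data is `0` while the affinity of a point with itself is `1`; this is the
    -- `+ 1` of the bound.
    have e4 : ∑ k, y k ^ 2 = ∑ k, ∑ l, y k * y l * if k = l then 1 else 0 := by
      refine Finset.sum_congr rfl fun k _ => ?_
      simp [sq]
    rw [e4]
    simp only [← Finset.sum_add_distrib, ← Finset.sum_sub_distrib]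
    refine Finset.sum_congr rfl fun k _ => Finset.sum_congr rfl fun l _ => ?_
    have e5 : block S hS A k l = A (idx k) (idx l) := rfl
    rw [e5, noise]
    by_cases hkl : k = l
    · subst hkl
      simp [hA, affinity_self]
    · have : idx k ≠ idx l := fun h => hkl (hinj h)
      simp [hkl, this]
      ring
  have h2 : |∑ k, ∑ l, y k * y l * (affinity (x (idx k)) (x (idx l)) -
        affinity (ZMod.toCircle (τ k)) (ZMod.toCircle (τ l)))| ≤ κ * N * ∑ k, y k ^ 2 := by
    calc _ ≤ ∑ k, ∑ l, |y k| * |y l| * κ := by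
          refine (Finset.abs_sum_le_sum_abs _ _).trans (Finset.sum_le_sum fun k _ => ?_)
          refine (Finset.abs_sum_le_sum_abs _ _).trans (Finset.sum_le_sum fun l _ => ?_)
          rw [abs_mul, abs_mul]
          gcongr
          refine (abs_affinity_sub_le _ _ _ _).trans ?_
          rw [div_le_iff₀ (by positivity)]
          nlinarith [hκ k, hκ l]
      _ = κ * (∑ k, |y k|) ^ 2 := by
          rw [sq, Finset.sum_mul_sum, Finset.mul_sum]
          refine Finset.sum_congr rfl fun k _ => ?_
          rw [Finset.mul_sum]
          exact Finset.sum_congr rfl fun l _ => by ring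
      _ ≤ κ * ((Finset.univ : Finset (Fin N)).card * ∑ k, |y k| ^ 2) := by
          gcongr
          exact sq_sum_le_card_mul_sum_sq
      _ = _ := by simp; ring
  have h3 : 0 ≤ ∑ k, y k ^ 2 := Finset.sum_nonneg fun _ _ => sq_nonneg _
  rw [e3, abs_le]
  rw [abs_le] at h1 h2
  constructor <;> linarith

/-- Uniform accuracy of the refined positions. -/
lemma exists_isometry_geoDist_refined_le {n N : ℕ} [NeZero N] (hN : 2 < N) {x : Fin n → Circle}
    {A : Fin n → Fin n → ℝ} (hA : ∀ i, A i i = 0) {S : Finset (Fin n)} {hS : S.card = N}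
    {y : Fin N → Circle} (hy : IsSpectralLocalization (block S hS A) y)
    {τ : Fin N ≃ ZMod N} {m κ h : ℝ} (hh1 : 1 ≤ h) (hhm : m + κ * N + 1 ≤ h) (hκh : κ * N ≤ h)
    (hhN : h ≤ 0.005 * N)
    (hm : ∀ y : Fin n → ℝ, |∑ i, ∑ j, y i * y j * noise x A i j| ≤ m * ∑ i, y i ^ 2)
    (hκ : ∀ l, geoDist (x (S.orderEmbOfFin hS l)) (ZMod.toCircle (τ l)) ≤ κ)
    (ht : ∀ i, i ∉ S → ∀ a b : ZMod N, |∑ l, (A i (S.orderEmbOfFin hS l) -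
      affinity (x i) (x (S.orderEmbOfFin hS l))) * (geoDist (ZMod.toCircle a) (y l) -
        geoDist (ZMod.toCircle b) (y l))| ≤ h * geoDist (ZMod.toCircle a) (ZMod.toCircle b)) :
    ∃ Q : ℂ ≃ₗᵢ[ℝ] ℂ, ∀ i, i ∉ S → ∀ z, IsRefined A S hS y i z →
      geoDist z (act Q (x i)) ≤ 1100000 * h / N := by
  have hNpos : (0 : ℝ) < N := Nat.cast_pos.2 (by omega)
  have hpi3 := Real.pi_gt_three
  have hpi4 := Real.pi_le_four
  obtain ⟨⟨β, hβ⟩, Q, hQ⟩ := hy.sum_geoDist_le (τ := τ) (h := h) (by linarith) hhN (fun y =>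
    (abs_quadForm_block_sub_le hA hm hκ y).trans
      (mul_le_mul_of_nonneg_right hhm (Finset.sum_nonneg fun _ _ => sq_nonneg _)))
  refine ⟨Q, fun i hi z hz => ?_⟩
  have hD : ∑ l, geoDist (y l) (act Q (x (S.orderEmbOfFin hS l))) ≤ 46000 * h := by
    calc _ ≤ ∑ l, (geoDist (y l) (act Q (ZMod.toCircle (τ l))) + κ) := by
          refine Finset.sum_le_sum fun l _ =>
            (geoDist_triangle _ (act Q (ZMod.toCircle (τ l))) _).trans ?_
          gcongr
          rw [geoDist_act, geoDist_comm]
          exact hκ l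
      _ ≤ _ := by
          rw [Finset.sum_add_distrib]
          simp only [Finset.sum_const, Finset.card_univ, Fintype.card_fin, nsmul_eq_mul]
          linarith
  refine (hz.geoDist_le hN hβ x Q hD (ht i hi)).trans ?_
  have h1 : 46000 * h / (2 * Real.pi) ≤ 7670 * h := by
    rw [div_le_iff₀ (by positivity)]
    nlinarith
  have h2 : (h + 1 + 46000 * h / (2 * Real.pi)) / (0.007 * N) ≤ 1099990 * h / N := by
    rw [div_le_div_iff₀ (by positivity) hNpos]
    nlinarith
  have h3 : 2 * Real.pi / N ≤ 10 * h / N :=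
    div_le_div_of_nonneg_right (by linarith) hNpos.le
  have h4 : 1100000 * h / N = 1099990 * h / N + 10 * h / N := by ring
  linarith

/-! ### The synchronization step -/

lemma exists_forall_regular {n : ℕ} {x : Fin n → Circle} {κ : ℝ} (hx : distToRegular x ≤ κ) :
    ∃ σ : Equiv.Perm (Fin n), ∀ i, geoDist (x i) (root n (σ i)) ≤ κ := by
  have hfin : (regularPositions n).Finite := by
    refine (Set.finite_range fun σ : Equiv.Perm (Fin n) => fun j => root n (σ j)).subset ?_
    rintro y ⟨σ, hσ⟩
    exact ⟨σ, funext fun j => (hσ j).symm⟩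
  have : Finite (regularPositions n) := hfin
  have : Nonempty (regularPositions n) := ⟨⟨fun j => root n ((1 : Equiv.Perm (Fin n)) j), 1,
    fun _ => rfl⟩⟩
  obtain ⟨⟨y, σ, hσ⟩, hy⟩ := exists_eq_ciInf_of_finite
    (f := fun y : regularPositions n => dInf x y.1)
  refine ⟨σ, fun i => ?_⟩
  rw [← hσ i]
  refine le_trans ?_ (hy.le.trans hx)
  exact le_ciSup (f := fun i => geoDist (x i) (y i)) (Set.finite_range _).bddAbove i

open ComplexConjugate in
/-- An orthogonal transformation that almost fixes half of a set of almost regular points almost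
fixes the whole circle. -/
lemma geoDist_act_self_le {n : ℕ} [NeZero n] (hn : 4 < n) {x : Fin n → Circle}
    {σ : Equiv.Perm (Fin n)} {κ μ : ℝ} (hσ : ∀ i, geoDist (x i) (root n (σ i)) ≤ κ)
    {J : Finset (Fin n)} (hJ : n ≤ 2 * J.card) {R : ℂ ≃ₗᵢ[ℝ] ℂ}
    (hR : ∀ j ∈ J, geoDist (act R (x j)) (x j) ≤ μ) (hκμ : 2 * κ + μ ≤ 0.1) (w : Circle) :
    geoDist (act R w) w ≤ μ := by
  have hnpos : (0 : ℝ) < n := Nat.cast_pos.2 (by omega)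
  obtain ⟨j₀, hj₀⟩ : J.Nonempty := Finset.card_pos.1 (by omega)
  obtain ⟨q, hq | hq⟩ := linear_isometry_complex R
  · have h : ∀ z : Circle, geoDist (act R z) z = geoDist q 1 := fun z => by
      have e : act R z = z * q := by ext; simp [coe_act, hq, mul_comm]
      rw [e]
      nth_rewrite 2 [← mul_one z]
      exact geoDist_mul_left _ _ _
    rw [h, ← h (x j₀)]
    exact hR _ hj₀
  -- If `R z = q conj z` almost fixes `x j`, then `(x j)²` is close to `q`, so `ζ j` is close to `1`
  -- on half of the indices. Then `(Re ζ + 1)²` sums to at least `3.61 n / 2`, while its sum over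
  -- the whole grid is `3 n / 2`. The sum of `Re ζ` alone would give no contradiction.
  · exfalso
    set ζ : Fin n → Circle := fun i => q⁻¹ * root n (σ i) ^ 2 with hζ
    have hsum : ∑ i : Fin n, ((ζ i : ℂ).re + 1) ^ 2 = 3 / 2 * (n : ℝ) := by
      have e1 : ∀ i, ((ζ i : ℂ).re + 1) ^ 2 = 3 / 2 + 2 * (ζ i : ℂ).re +
          ((ζ i : ℂ) ^ 2).re / 2 := fun i => by
        have := re_sq_of_circle (ζ i)
        linear_combination this
      have e2 : ∀ m : ℕ, (m : ZMod n) ≠ 0 →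
          ∑ i, (root n (σ i) : ℂ) ^ m = 0 := by
        intro m hm
        rw [← sum_toCircle_pow hm, ← Equiv.sum_comp (σ.trans (finEquivZMod n))]
        exact Finset.sum_congr rfl fun i _ => by rw [root_eq_toCircle]; rfl
      have e3 : ∑ i, (ζ i : ℂ) = 0 := by
        simp only [hζ, Circle.coe_mul, Circle.coe_pow]
        rw [← Finset.mul_sum, e2 2 (natCast_zmod_ne_zero two_pos (by omega)), mul_zero]
      have e4 : ∑ i, (ζ i : ℂ) ^ 2 = 0 := by
        simp only [hζ, Circle.coe_mul, Circle.coe_pow, mul_pow, ← pow_mul]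
        rw [← Finset.mul_sum, e2 (2 * 2) (natCast_zmod_ne_zero (by norm_num) (by omega)), mul_zero]
      simp only [e1, Finset.sum_add_distrib, ← Finset.mul_sum, ← Finset.sum_div,
        ← Complex.re_sum, e3, e4]
      simp
      ring
    have hζJ : ∀ j ∈ J, 0.9 ≤ (ζ j : ℂ).re := by
      intro j hj
      have h1 : ‖(q : ℂ) - (x j : ℂ) ^ 2‖ ≤ μ := by
        have e : (q : ℂ) - (x j : ℂ) ^ 2 = ((act R (x j) : ℂ) - x j) * x j := by
          have h2 : conj (x j : ℂ) * x j = 1 := by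
            rw [mul_comm, Complex.mul_conj, Circle.normSq_coe, Complex.ofReal_one]
          have h3 : (act R (x j) : ℂ) = q * conj (x j : ℂ) := by simp [coe_act, hq]
          rw [h3]
          linear_combination (-(q : ℂ)) * h2
        rw [e, norm_mul, Circle.norm_coe, mul_one]
        exact (norm_sub_le_geoDist _ _).trans (hR j hj)
      have h4 : ‖(x j : ℂ) ^ 2 - (root n (σ j) : ℂ) ^ 2‖ ≤ 2 * κ := by
        have e : (x j : ℂ) ^ 2 - (root n (σ j) : ℂ) ^ 2 =
            ((x j : ℂ) + root n (σ j)) * ((x j : ℂ) - root n (σ j)) := by ring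
        rw [e, norm_mul]
        have h5 : ‖(x j : ℂ) + root n (σ j)‖ ≤ 2 := by
          refine (norm_add_le _ _).trans ?_
          rw [Circle.norm_coe, Circle.norm_coe]; norm_num
        exact mul_le_mul h5 ((norm_sub_le_geoDist _ _).trans (hσ j)) (norm_nonneg _) (by norm_num)
      have h6 : ‖(1 : ℂ) - ζ j‖ ≤ 0.1 := by
        have e : (1 : ℂ) - ζ j = ((q⁻¹ : Circle) : ℂ) * ((q : ℂ) - (root n (σ j) : ℂ) ^ 2) := by
          simp only [hζ, Circle.coe_mul, Circle.coe_pow]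
          rw [mul_sub, ← Circle.coe_mul, inv_mul_cancel, Circle.coe_one]
        rw [e, norm_mul, Circle.norm_coe, one_mul]
        refine (norm_sub_le_norm_sub_add_norm_sub _ ((x j : ℂ) ^ 2) _).trans ?_
        linarith
      have h7 := (Complex.re_le_norm _).trans h6
      rw [Complex.sub_re, Complex.one_re] at h7
      linarith
    have h8 : ∑ j ∈ J, (3.61 : ℝ) ≤ ∑ i, ((ζ i : ℂ).re + 1) ^ 2 := by
      calc _ ≤ ∑ j ∈ J, ((ζ j : ℂ).re + 1) ^ 2 :=
            Finset.sum_le_sum fun j hj => by nlinarith [hζJ j hj]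
        _ ≤ _ := Finset.sum_le_univ_sum_of_nonneg fun _ => sq_nonneg _
    rw [hsum, Finset.sum_const, nsmul_eq_mul] at h8
    have h9 : (n : ℝ) ≤ 2 * J.card := by exact_mod_cast hJ
    nlinarith

/-- The merging of two accurate families of positions is accurate. -/
lemma IsSynchronization.geoDist_le {n : ℕ} [NeZero n] (hn : 4 < n) {x : Fin n → Circle}
    {σ : Equiv.Perm (Fin n)} {κ ρ : ℝ} (hσ : ∀ i, geoDist (x i) (root n (σ i)) ≤ κ)
    {S S' : Finset (Fin n)} (hS : 4 * S.card ≤ n) (hS' : 4 * S'.card ≤ n) (hdisj : Disjoint S S')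
    {x2 x2' : Fin n → Circle} {Q Q₁ Q₂ : ℂ ≃ₗᵢ[ℝ] ℂ} (hQ : IsSynchronization S S' x2 x2' Q)
    (h1 : ∀ i, i ∉ S → geoDist (x2 i) (act Q₁ (x i)) ≤ ρ)
    (h2 : ∀ i, i ∉ S' → geoDist (x2' i) (act Q₂ (x i)) ≤ ρ) (hκρ : 2 * κ + 4 * ρ ≤ 0.1)
    (j : Fin n) :
    geoDist (if j ∈ S then act Q (x2' j) else x2 j) (act Q₁ (x j)) ≤ 5 * ρ := by
  classical
  set J : Finset (Fin n) := (S ∪ S')ᶜ with hJ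
  have hJcard : n ≤ 2 * J.card := by
    have h3 := Finset.card_compl_add_card (S ∪ S')
    have h4 := Finset.card_union_le S S'
    rw [Fintype.card_fin, ← hJ] at h3
    omega
  have hmemJ : ∀ i, i ∈ J ↔ i ∉ S ∧ i ∉ S' := fun i => by
    simp [hJ]
  have : Nonempty {i // i ∉ S ∧ i ∉ S'} := by
    obtain ⟨i, hi⟩ : J.Nonempty := Finset.card_pos.1 (by omega)
    exact ⟨⟨i, (hmemJ i).1 hi⟩⟩
  have hsync : ∀ i ∈ J, geoDist (x2 i) (act Q (x2' i)) ≤ 2 * ρ := by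
    intro i hi
    -- The competitor `Q₁ ∘ Q₂⁻¹` aligns the two families up to `2ρ`, so the minimizer does at least
    -- as well.
    refine le_trans ?_ ((hQ (Q₂.symm.trans Q₁)).trans ?_)
    · exact le_ciSup (f := fun i : {i // i ∉ S ∧ i ∉ S'} => geoDist (x2 i) (act Q (x2' i)))
        (Set.finite_range _).bddAbove ⟨i, (hmemJ i).1 hi⟩
    · refine ciSup_le fun ⟨i, hi, hi'⟩ => ?_
      change geoDist (x2 i) (act (Q₂.symm.trans Q₁) (x2' i)) ≤ 2 * ρ
      refine (geoDist_triangle _ (act Q₁ (x i)) _).trans ?_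
      have e : act (Q₂.symm.trans Q₁) (x2' i) = act Q₁ (act Q₂.symm (x2' i)) := rfl
      have e' : act Q₂ (act Q₂.symm (x2' i)) = x2' i := by
        ext; simp [coe_act]
      rw [e, geoDist_act, ← geoDist_act Q₂ (x i), e', geoDist_comm (act Q₂ _)]
      linarith [h1 i hi, h2 i hi']
  -- `Q₁⁻¹ Q Q₂` measures how far the chosen `Q` is from the ideal alignment. It moves the common
  -- points by at most `4ρ`, hence every point, which gives `5ρ` on `S`.
  have hcompare : ∀ i, geoDist (act ((Q₂.trans Q).trans Q₁.symm) (x i)) (x i) =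
      geoDist (act Q (act Q₂ (x i))) (act Q₁ (x i)) := by
    intro i
    rw [← geoDist_act Q₁]
    congr 1
    ext; simp [coe_act]
  have hR : ∀ i ∈ J, geoDist (act ((Q₂.trans Q).trans Q₁.symm) (x i)) (x i) ≤ 4 * ρ := by
    intro i hi
    rw [hcompare]
    have h3 := geoDist_triangle (act Q (act Q₂ (x i))) (act Q (x2' i)) (act Q₁ (x i))
    have h4 := geoDist_triangle (act Q (x2' i)) (x2 i) (act Q₁ (x i))
    rw [geoDist_act, geoDist_comm (act Q₂ _)] at h3
    rw [geoDist_comm _ (x2 i)] at h4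
    linarith [h1 i ((hmemJ i).1 hi).1, h2 i ((hmemJ i).1 hi).2, hsync i hi]
  have hρ : 0 ≤ ρ := by
    obtain ⟨i, hi⟩ : J.Nonempty := Finset.card_pos.1 (by omega)
    exact (geoDist_nonneg _ _).trans (h1 i ((hmemJ i).1 hi).1)
  split_ifs with hjS
  · have h3 := geoDist_act_self_le hn hσ hJcard hR hκρ (x j)
    rw [hcompare] at h3
    have h4 := geoDist_triangle (act Q (x2' j)) (act Q (act Q₂ (x j))) (act Q₁ (x j))
    rw [geoDist_act] at h4
    linarith [h2 j (Finset.disjoint_left.1 hdisj hjS)]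
  · linarith [h1 j hjS]

/-! ### Concentration for uniform subsets -/

/-- Each further prescribed element costs a factor `(N - k) / (4N - k) ≤ 1/4`: sampling without
replacement is no more favourable than independent sampling. -/
lemma choose_mul_four_pow_le {N : ℕ} (k : ℕ) (hk : k ≤ N) :
    (4 * N - k).choose (N - k) * 4 ^ k ≤ (4 * N).choose N := by
  induction k with
  | zero => simp
  | succ k ih =>
    refine le_trans ?_ (ih (by omega))
    have h := Nat.add_one_mul_choose_eq (4 * N - (k + 1)) (N - (k + 1))
    have e1 : 4 * N - (k + 1) + 1 = 4 * N - k := by omega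
    have e2 : N - (k + 1) + 1 = N - k := by omega
    rw [e1, e2] at h
    have h2 : 4 * (N - k) ≤ 4 * N - k := by omega
    have h3 : 4 * (4 * N - (k + 1)).choose (N - (k + 1)) ≤ (4 * N - k).choose (N - k) := by
      refine Nat.le_of_mul_le_mul_right ?_ (by omega : 0 < N - k)
      rw [← h]
      calc _ = 4 * (N - k) * (4 * N - (k + 1)).choose (N - (k + 1)) := by ring
        _ ≤ _ := Nat.mul_le_mul_right _ h2
    calc _ = 4 * (4 * N - (k + 1)).choose (N - (k + 1)) * 4 ^ k := by ring
      _ ≤ _ := Nat.mul_le_mul_right _ h3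

section Subsets

variable {α : Type*} [Fintype α] [DecidableEq α] {N : ℕ}

lemma card_filter_superset_mul_le (hα : Fintype.card α = 4 * N) (K : Finset α) :
    (((Finset.univ : Finset α).powersetCard N).filter (K ⊆ ·)).card * 4 ^ K.card ≤
      (4 * N).choose N := by
  by_cases hK : K.card ≤ N
  · refine le_trans (Nat.mul_le_mul_right _ ?_) (choose_mul_four_pow_le K.card hK)
    have h1 : (4 * N - K.card).choose (N - K.card) =
        (Kᶜ.powersetCard (N - K.card)).card := by
      rw [Finset.card_powersetCard, Finset.card_compl, hα]
    rw [h1]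
    refine Finset.card_le_card_of_injOn (fun S => S \ K) (fun S hS => ?_) (fun S hS S' hS' h => ?_)
    · have hS := Finset.mem_filter.1 (Finset.mem_coe.1 hS)
      refine Finset.mem_coe.2 (Finset.mem_powersetCard.2 ⟨?_, ?_⟩)
      · intro i hi
        exact Finset.mem_compl.2 (Finset.mem_sdiff.1 hi).2
      · rw [Finset.card_sdiff_of_subset hS.2, (Finset.mem_powersetCard.1 hS.1).2]
    · have hS := (Finset.mem_filter.1 (Finset.mem_coe.1 hS)).2
      have hS' := (Finset.mem_filter.1 (Finset.mem_coe.1 hS')).2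
      rw [← Finset.sdiff_union_of_subset hS, ← Finset.sdiff_union_of_subset hS']
      exact congrArg (· ∪ K) h
  · have : ((Finset.univ : Finset α).powersetCard N).filter (K ⊆ ·) = ∅ := by
      rw [Finset.filter_eq_empty_iff]
      intro S hS hKS
      have := Finset.card_le_card hKS
      rw [(Finset.mem_powersetCard.1 hS).2] at this
      omega
    rw [this]; simp

/-- Expanding `(1 + a)^|S ∩ B|` over subsets of `B` reduces the exponential moment to inclusion
probabilities, each at most `4^{-|K|}`. The outcome is the moment of a binomial variable of
parameter `1/4`. -/
lemma sum_one_add_pow_card_inter_le (hα : Fintype.card α = 4 * N) (B : Finset α) {a : ℝ}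
    (ha : 0 ≤ a) :
    ∑ S ∈ (Finset.univ : Finset α).powersetCard N, (1 + a) ^ (S ∩ B).card ≤
      (4 * N).choose N * (1 + a / 4) ^ B.card := by
  have h1 : ∀ S : Finset α, (1 + a) ^ (S ∩ B).card =
      ∑ K ∈ B.powerset, if K ⊆ S then a ^ K.card else 0 := by
    intro S
    rw [add_comm, ← Finset.sum_pow_mul_eq_add_pow, ← Finset.sum_filter]
    refine Finset.sum_congr ?_ fun K _ => by simp
    ext K
    rw [Finset.mem_powerset, Finset.subset_inter_iff, Finset.mem_filter, Finset.mem_powerset,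
      and_comm]
  have h2 : (1 + a / 4) ^ B.card = ∑ K ∈ B.powerset, a ^ K.card / 4 ^ K.card := by
    rw [add_comm, ← Finset.sum_pow_mul_eq_add_pow]
    exact Finset.sum_congr rfl fun K _ => by rw [one_pow, mul_one, div_pow]
  simp only [h1]
  rw [Finset.sum_comm, h2, Finset.mul_sum]
  refine Finset.sum_le_sum fun K _ => ?_
  rw [← Finset.sum_filter, Finset.sum_const, nsmul_eq_mul, mul_div_assoc', le_div_iff₀ (by positivity)]
  have h3 : ((((Finset.univ : Finset α).powersetCard N).filter (K ⊆ ·)).card : ℝ) * 4 ^ K.card ≤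
      (4 * N).choose N := by exact_mod_cast card_filter_superset_mul_le hα K
  calc _ = ((((Finset.univ : Finset α).powersetCard N).filter (K ⊆ ·)).card : ℝ) * 4 ^ K.card *
        a ^ K.card := by ring
    _ ≤ _ := by gcongr

/-- Chernoff bound for the intersection of a uniform subset with a fixed subset. -/
lemma card_filter_inter_le (hα : Fintype.card α = 4 * N) (B : Finset α) {s lam : ℝ}
    (hl0 : 0 ≤ lam) (hl1 : lam ≤ 1) :
    ((((Finset.univ : Finset α).powersetCard N).filter
      fun S => (B.card : ℝ) / 4 + s ≤ (S ∩ B).card).card : ℝ) ≤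
      (4 * N).choose N * Real.exp (N * lam ^ 2 - lam * s) := by
  have hexp : Real.exp lam ≤ 1 + lam + lam ^ 2 := by
    have := (abs_le.1 (Real.abs_exp_sub_one_sub_id_le (x := lam)
      (by rwa [abs_of_nonneg hl0]))).2
    linarith
  have hB : (B.card : ℝ) ≤ 4 * N := by
    have := Finset.card_le_univ B
    rw [hα] at this
    exact_mod_cast this
  have h1 := sum_one_add_pow_card_inter_le hα B (a := Real.exp lam - 1)
    (by linarith [Real.add_one_le_exp lam])
  have h2 : (1 + (Real.exp lam - 1) / 4) ^ B.card ≤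
      Real.exp (B.card * lam / 4 + N * lam ^ 2) := by
    calc _ ≤ (Real.exp ((lam + lam ^ 2) / 4)) ^ B.card := by
          have h0 := Real.add_one_le_exp lam
          refine pow_le_pow_left₀ (by linarith) ?_ _
          refine le_trans ?_ (Real.add_one_le_exp _)
          linarith
      _ = Real.exp (B.card * lam / 4 + B.card / 4 * lam ^ 2) := by
          rw [← Real.exp_nat_mul]; ring_nf
      _ ≤ _ := by
          apply Real.exp_le_exp.2
          have : (B.card : ℝ) / 4 * lam ^ 2 ≤ N * lam ^ 2 :=
            mul_le_mul_of_nonneg_right (by linarith) (sq_nonneg _)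
          linarith
  have h3 : ((((Finset.univ : Finset α).powersetCard N).filter
      fun S => (B.card : ℝ) / 4 + s ≤ (S ∩ B).card).card : ℝ) *
      Real.exp (lam * (B.card / 4 + s)) ≤
      ∑ S ∈ (Finset.univ : Finset α).powersetCard N,
        (1 + (Real.exp lam - 1)) ^ (S ∩ B).card := by
    rw [← nsmul_eq_mul, ← Finset.sum_const]
    refine le_trans (Finset.sum_le_sum fun S hS => ?_)
      (Finset.sum_le_sum_of_subset_of_nonneg (Finset.filter_subset _ _) fun S _ _ => by
        rw [add_sub_cancel]; positivity)
    rw [add_sub_cancel, ← Real.exp_nat_mul]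
    apply Real.exp_le_exp.2
    rw [mul_comm]
    exact mul_le_mul_of_nonneg_right (Finset.mem_filter.1 hS).2 hl0
  have h4 : ((((Finset.univ : Finset α).powersetCard N).filter
      fun S => (B.card : ℝ) / 4 + s ≤ (S ∩ B).card).card : ℝ) *
      Real.exp (lam * (B.card / 4 + s)) ≤
      (4 * N).choose N * Real.exp (B.card * lam / 4 + N * lam ^ 2) :=
    h3.trans (h1.trans (mul_le_mul_of_nonneg_left h2 (by positivity)))
  rw [← le_div_iff₀ (Real.exp_pos _), mul_div_assoc, ← Real.exp_sub] at h4
  refine h4.trans (le_of_eq ?_)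
  congr 2
  ring

end Subsets

/-! ### Representative subsets -/

/-- A subset is representative, up to `s`, if it contains about a quarter of the points of each
initial segment of the regular grid. -/
def IsRepresentative {n : ℕ} (σ : Equiv.Perm (Fin n)) (s : ℝ) (S : Finset (Fin n)) : Prop :=
  ∀ m : ℕ, m ≤ n → |((S.filter fun i => (σ i : ℕ) < m).card : ℝ) - m / 4| ≤ s

/-- The points of a representative subset are close to a regular grid. -/
lemma IsRepresentative.exists_equiv {n N : ℕ} [NeZero N] (hn : n = 4 * N)
    {σ : Equiv.Perm (Fin n)} {s : ℝ} {S : Finset (Fin n)} (h : IsRepresentative σ s S)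
    (hS : S.card = N) :
    ∃ τ : Fin N ≃ ZMod N, ∀ l,
      geoDist (root n (σ (S.orderEmbOfFin hS l))) (ZMod.toCircle (τ l)) ≤
        2 * Real.pi / N * s := by
  have hNpos : (0 : ℝ) < N := Nat.cast_pos.2 (NeZero.pos N)
  have hpi := Real.pi_pos
  set idx := S.orderEmbOfFin hS with hidx
  have hidxS : ∀ l, idx l ∈ S := fun l => Finset.orderEmbOfFin_mem _ _ _
  set rank : Fin N → Fin N := fun l => ⟨(S.filter fun i => (σ i : ℕ) < σ (idx l)).card, by
    calc (S.filter fun i => (σ i : ℕ) < σ (idx l)).card < S.card := by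
          refine Finset.card_lt_card ⟨Finset.filter_subset _ _, fun hsub => ?_⟩
          exact lt_irrefl _ (Finset.mem_filter.1 (hsub (hidxS l))).2
      _ = N := hS⟩ with hrank
  have hlt : ∀ l l', (σ (idx l) : ℕ) < σ (idx l') → (rank l : ℕ) < rank l' := by
    intro l l' hll
    refine Finset.card_lt_card ⟨fun i hi => ?_, fun hsub => ?_⟩
    · rw [Finset.mem_filter] at hi ⊢
      exact ⟨hi.1, hi.2.trans hll⟩
    · have := hsub (Finset.mem_filter.2 ⟨hidxS l, hll⟩)
      exact lt_irrefl _ (Finset.mem_filter.1 this).2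
  have hinj : Function.Injective rank := by
    intro l l' hll
    rcases lt_trichotomy (σ (idx l) : ℕ) (σ (idx l')) with h1 | h1 | h1
    · exact absurd (congrArg Fin.val hll) (hlt _ _ h1).ne
    · exact idx.injective (σ.injective (Fin.ext h1))
    · exact absurd (congrArg Fin.val hll) (hlt _ _ h1).ne'
  refine ⟨(Equiv.ofBijective rank (Finite.injective_iff_bijective.1 hinj)).trans
    (finEquivZMod N), fun l => ?_⟩
  have e : ZMod.toCircle (((Equiv.ofBijective rank (Finite.injective_iff_bijective.1 hinj)).trans
    (finEquivZMod N)) l) = root N (rank l) := by rw [root_eq_toCircle]; rfl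
  rw [e, root, root]
  refine (geoDist_exp_le _ _).trans ?_
  have h1 := h (σ (idx l)) (σ (idx l)).2.le
  -- The rank of a point inside `S` counts the points of `S` with a smaller label, so it is within
  -- `s` of a quarter of its label.
  have e2 : 2 * Real.pi * ((σ (idx l) : ℕ) : ℝ) / n - 2 * Real.pi * ((rank l : ℕ) : ℝ) / N =
      -(2 * Real.pi / N * (((rank l : ℕ) : ℝ) - ((σ (idx l) : ℕ) : ℝ) / 4)) := by
    have hnN : (n : ℝ) = 4 * N := by exact_mod_cast hn
    rw [hnN]; field_simp; ring
  rw [e2, abs_neg, abs_mul, abs_of_pos (by positivity : 0 < 2 * Real.pi / N)]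
  exact mul_le_mul_of_nonneg_left h1 (by positivity)

open Classical in
/-- Most subsets are representative. -/
lemma card_filter_not_isRepresentative_le {n N : ℕ} (hn : n = 4 * N) (σ : Equiv.Perm (Fin n))
    {s lam : ℝ} (hl0 : 0 ≤ lam) (hl1 : lam ≤ 1) :
    ((((Finset.univ : Finset (Fin n)).powersetCard N).filter
      fun S => ¬ IsRepresentative σ s S).card : ℝ) ≤
      2 * (n + 1) * ((4 * N).choose N * Real.exp (N * lam ^ 2 - lam * s)) := by
  have hα : Fintype.card (Fin n) = 4 * N := by rw [Fintype.card_fin, hn]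
  set W := (Finset.univ : Finset (Fin n)).powersetCard N with hW
  set B : ℕ → Finset (Fin n) := fun m => Finset.univ.filter fun i => (σ i : ℕ) < m with hB
  have hBcard : ∀ m, m ≤ n → (B m).card = m := by
    intro m hm
    have h1 : (B m).card = (Finset.univ.filter fun i : Fin n => (i : ℕ) < m).card :=
      Finset.card_equiv σ (by simp [hB])
    rw [h1]
    have h2 : (Finset.univ.filter fun i : Fin n => (i : ℕ) < m).card =
        (Finset.range m).card := by
      rw [← Finset.card_map Fin.valEmbedding]
      congr 1
      ext i
      simp only [Finset.mem_map, Finset.mem_filter, Finset.mem_univ, true_and,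
        Fin.valEmbedding_apply, Finset.mem_range]
      exact ⟨fun ⟨a, ha, hai⟩ => hai ▸ ha, fun hi => ⟨⟨i, by omega⟩, hi, rfl⟩⟩
    rw [h2, Finset.card_range]
  -- Since `S` has fixed cardinality, a deficit in `B m` is an excess in its complement; upper
  -- deviations are enough.
  have hsub : W.filter (fun S => ¬ IsRepresentative σ s S) ⊆ (Finset.range (n + 1)).biUnion fun m =>
      (W.filter fun S => ((B m).card : ℝ) / 4 + s ≤ (S ∩ B m).card) ∪
      (W.filter fun S => (((B m)ᶜ).card : ℝ) / 4 + s ≤ (S ∩ (B m)ᶜ).card) := by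
    intro S hS
    obtain ⟨hSW, hS⟩ := Finset.mem_filter.1 hS
    unfold IsRepresentative at hS
    push Not at hS
    obtain ⟨m, hm, hS⟩ := hS
    refine Finset.mem_biUnion.2 ⟨m, Finset.mem_range.2 (by omega), ?_⟩
    have hSc : S.card = N := (Finset.mem_powersetCard.1 hSW).2
    have e1 : (S.filter fun i => (σ i : ℕ) < m) = S ∩ B m := by
      ext i; simp [hB]
    rw [e1] at hS
    have e2 : ((S ∩ B m).card : ℝ) + (S ∩ (B m)ᶜ).card = N := by
      have := Finset.card_inter_add_card_sdiff S (B m)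
      rw [Finset.sdiff_eq_inter_compl, hSc] at this
      exact_mod_cast this
    have e3 : (((B m)ᶜ).card : ℝ) = n - m := by
      rw [Finset.card_compl, Fintype.card_fin, hBcard m hm, Nat.cast_sub hm]
    have e4 : (n : ℝ) = 4 * N := by rw [hn]; push_cast; ring
    rw [Finset.mem_union, Finset.mem_filter, Finset.mem_filter, e3, hBcard m hm]
    rcases lt_abs.1 hS with h | h
    · exact Or.inl ⟨hSW, by linarith⟩
    · exact Or.inr ⟨hSW, by linarith⟩
  refine (Nat.cast_le.2 ((Finset.card_le_card hsub).trans Finset.card_biUnion_le)).trans ?_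
  push_cast
  refine (Finset.sum_le_sum fun m _ => (Nat.cast_le.2 (Finset.card_union_le _ _)).trans
    (Nat.cast_add _ _).le).trans ?_
  calc _ ≤ ∑ m ∈ Finset.range (n + 1),
        2 * ((4 * N).choose N * Real.exp (N * lam ^ 2 - lam * s)) := by
        refine Finset.sum_le_sum fun m _ => ?_
        have h1 := card_filter_inter_le hα (B m) (s := s) hl0 hl1
        have h2 := card_filter_inter_le hα ((B m)ᶜ) (s := s) hl0 hl1
        rw [two_mul]
        exact add_le_add h1 h2
    _ = _ := by
        rw [Finset.sum_const, Finset.card_range, nsmul_eq_mul]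
        push_cast; ring

-- The number of choices of `S'` does not depend on `S`, so the first marginal of a uniform split is
-- uniform.
open Classical in
lemma card_filter_split_fst {n : ℕ} (p : Finset (Fin n) → Prop) :
    (Finset.univ.filter fun t : Split n => p t.1.1).card =
      (((Finset.univ : Finset (Fin n)).powersetCard (n / 4)).filter p).card *
        (n - n / 4).choose (n / 4) := by
  rw [Finset.card_eq_sum_card_fiberwise (f := fun t : Split n => t.1.1)
    (t := ((Finset.univ : Finset (Fin n)).powersetCard (n / 4)).filter p)]
  · rw [← smul_eq_mul, ← Finset.sum_const]
    refine Finset.sum_congr rfl fun S hS => ?_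
    obtain ⟨hSW, hpS⟩ := Finset.mem_filter.1 hS
    have hSc := (Finset.mem_powersetCard.1 hSW).2
    have h1 : (n - n / 4).choose (n / 4) = (Sᶜ.powersetCard (n / 4)).card := by
      rw [Finset.card_powersetCard, Finset.card_compl, Fintype.card_fin, hSc]
    rw [h1]
    refine Finset.card_bij (fun t _ => t.1.2) ?_ ?_ ?_
    · intro t ht
      simp only [Finset.mem_filter, Finset.mem_univ, true_and] at ht
      refine Finset.mem_powersetCard.2 ⟨?_, t.2.2.1⟩
      intro i hi
      rw [Finset.mem_compl, ← ht.2]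
      exact fun hi' => Finset.disjoint_left.1 t.2.2.2 hi' hi
    · intro t ht t' ht' h
      simp only [Finset.mem_filter, Finset.mem_univ, true_and] at ht ht'
      exact Subtype.ext (Prod.ext (ht.2.trans ht'.2.symm) h)
    · intro S' hS'
      obtain ⟨hS'1, hS'2⟩ := Finset.mem_powersetCard.1 hS'
      refine ⟨⟨(S, S'), hSc, hS'2, ?_⟩, ?_, rfl⟩
      · exact Finset.disjoint_right.2 fun i hi => Finset.mem_compl.1 (hS'1 hi)
      · simp [hpS]
  · intro t ht
    have ht := (Finset.mem_filter.1 (Finset.mem_coe.1 ht)).2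
    exact Finset.mem_coe.2 (Finset.mem_filter.2
      ⟨Finset.mem_powersetCard.2 ⟨Finset.subset_univ _, t.2.1⟩, ht⟩)

open Classical in
lemma card_filter_split_snd {n : ℕ} (p : Finset (Fin n) → Prop) :
    (Finset.univ.filter fun t : Split n => p t.1.2).card =
      (Finset.univ.filter fun t : Split n => p t.1.1).card :=
  Finset.card_bij (fun t _ => ⟨(t.1.2, t.1.1), t.2.2.1, t.2.1, t.2.2.2.symm⟩)
    (fun t ht => by simpa using ht)
    (fun t _ t' _ h => by
      have := congrArg Subtype.val h
      simp only [Prod.mk.injEq] at this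
      exact Subtype.ext (Prod.ext this.2 this.1))
    (fun t ht => ⟨⟨(t.1.2, t.1.1), t.2.2.1, t.2.1, t.2.2.2.symm⟩, by simpa using ht, rfl⟩)

open Classical in
lemma measure_split_or_le {Ω : Type*} [MeasurableSpace Ω] {P : Measure Ω}
    [IsProbabilityMeasure P] {n : ℕ} {A : Ω → Fin n → Fin n → ℝ}
    {T : Ω → Split n} (hT : IsUniformSplit P A T) (p : Finset (Fin n) → Prop) {c : ℝ}
    (hp : ((((Finset.univ : Finset (Fin n)).powersetCard (n / 4)).filter p).card : ℝ) ≤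
      c * n.choose (n / 4)) :
    P.real {ω | p (T ω).1.1 ∨ p (T ω).1.2} ≤ 2 * c := by
  have hcard : Nat.card (Split n) = n.choose (n / 4) * (n - n / 4).choose (n / 4) := by
    have := card_filter_split_fst (n := n) (fun _ => True)
    rw [Finset.filter_true, Finset.filter_true, Finset.card_powersetCard, Finset.card_univ,
      Finset.card_univ, Fintype.card_fin] at this
    rw [Nat.card_eq_fintype_card, this]
  have hc1 : 0 < n.choose (n / 4) := Nat.choose_pos (by omega)
  have hc2 : 0 < (n - n / 4).choose (n / 4) := Nat.choose_pos (by omega)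
  have hprob : ∀ q : Split n → Prop, P.real {ω | q (T ω)} ≤
      ((Finset.univ.filter q).card : ℝ) / Nat.card (Split n) := by
    intro q
    have e : {ω | q (T ω)} = ⋃ t ∈ Finset.univ.filter q, {ω | T ω = t} := by
      ext ω; simp
    rw [e]
    refine (measureReal_biUnion_finset_le _ _).trans (le_of_eq ?_)
    simp only [hT.uniform]
    rw [Finset.sum_const, nsmul_eq_mul]
    ring
  have hbad : ((Finset.univ.filter fun t : Split n => p t.1.1).card : ℝ) /
      Nat.card (Split n) ≤ c := by
    rw [card_filter_split_fst p, hcard]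
    push_cast
    rw [mul_div_mul_right _ _ (by exact_mod_cast hc2.ne'), div_le_iff₀ (by exact_mod_cast hc1)]
    exact hp
  have hsub : {ω | p (T ω).1.1 ∨ p (T ω).1.2} ⊆ {ω | p (T ω).1.1} ∪ {ω | p (T ω).1.2} :=
    fun ω hω => hω
  refine (measureReal_mono hsub).trans ((measureReal_union_le _ _).trans ?_)
  have h1 := hprob fun t => p t.1.1
  have h2 := hprob fun t => p t.1.2
  rw [card_filter_split_snd p] at h2
  linarith

open Classical in
/-- With high probability, both subsets of a uniform split are representative. -/
lemma measure_not_isRepresentative_le {Ω : Type*} [MeasurableSpace Ω] {P : Measure Ω}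
    [IsProbabilityMeasure P] {n N : ℕ} (hn : n = 4 * N) {A : Ω → Fin n → Fin n → ℝ}
    {T : Ω → Split n} (hT : IsUniformSplit P A T) (σ : Equiv.Perm (Fin n))
    {s lam : ℝ} (hl0 : 0 ≤ lam) (hl1 : lam ≤ 1) :
    P.real {ω | ¬ IsRepresentative σ s (T ω).1.1 ∨ ¬ IsRepresentative σ s (T ω).1.2} ≤
      4 * (n + 1) * Real.exp (N * lam ^ 2 - lam * s) := by
  refine (measure_split_or_le hT (fun S => ¬ IsRepresentative σ s S)
    (c := 2 * (n + 1) * Real.exp (N * lam ^ 2 - lam * s)) ?_).trans (le_of_eq (by ring))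
  have h1 := card_filter_not_isRepresentative_le hn σ (s := s) hl0 hl1
  have hn4 : n / 4 = N := by omega
  rw [hn4]
  refine le_of_le_of_eq (Eq.trans_le ?_ h1) ?_
  · congr!
  · rw [← hn]; ring

/-! ### The operator norm of the noise -/

lemma sum_upperPair {n : ℕ} (f : Fin n → Fin n → ℝ) :
    ∑ p : UpperPair n, f p.1.1 p.1.2 = ∑ i, ∑ j, if i < j then f i j else 0 := by
  rw [← Fintype.sum_prod_type' (f := fun i j => if i < j then f i j else 0)]
  rw [← Finset.sum_filter (fun p : Fin n × Fin n => p.1 < p.2) (fun p => f p.1 p.2)]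
  exact (Finset.sum_subtype _ (by simp) fun p : Fin n × Fin n => f p.1 p.2).symm

lemma sum_sum_eq_two_mul_sum_upperPair {n : ℕ} (f : Fin n → Fin n → ℝ)
    (hs : ∀ i j, f i j = f j i) (hd : ∀ i, f i i = 0) :
    ∑ i, ∑ j, f i j = 2 * ∑ p : UpperPair n, f p.1.1 p.1.2 := by
  have h : ∀ i j, f i j = (if i < j then f i j else 0) + (if j < i then f j i else 0) := by
    intro i j
    rcases lt_trichotomy i j with h | h | h
    · simp [h, h.le]
    · subst h; simp [hd]
    · simp [h, h.le, hs i j]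
  rw [two_mul, sum_upperPair]
  nth_rw 2 [Finset.sum_comm]
  rw [← Finset.sum_add_distrib]
  refine Finset.sum_congr rfl fun i _ => ?_
  rw [← Finset.sum_add_distrib]
  exact Finset.sum_congr rfl fun j _ => (h i j).trans (add_comm _ _)

lemma sum_upperPair_sq_le {n : ℕ} (y : Fin n → ℝ) :
    ∑ p : UpperPair n, (y p.1.1 * y p.1.2) ^ 2 ≤ (∑ i, y i ^ 2) ^ 2 := by
  rw [sum_upperPair (fun i j => (y i * y j) ^ 2), sq, Finset.sum_mul_sum]
  refine Finset.sum_le_sum fun i _ => Finset.sum_le_sum fun j _ => ?_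
  rw [mul_pow]
  split_ifs
  · exact le_rfl
  · positivity

lemma card_upperPair_le (n : ℕ) : (Fintype.card (UpperPair n) : ℝ) ≤ (n : ℝ) ^ 2 / 2 := by
  have h := sum_sum_eq_two_mul_sum_upperPair (n := n) (fun i j => if i = j then 0 else 1)
    (fun i j => by simp [eq_comm]) (by simp)
  have h1 : ∑ p : UpperPair n, (if p.1.1 = p.1.2 then (0 : ℝ) else 1) =
      Fintype.card (UpperPair n) := by
    rw [Finset.sum_congr rfl fun p _ => if_neg p.2.ne]
    simp
  have h2 : ∑ i : Fin n, ∑ j : Fin n, (if i = j then (0 : ℝ) else 1) ≤ ∑ i : Fin n, ∑ j : Fin n, 1 :=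
    Finset.sum_le_sum fun i _ => Finset.sum_le_sum fun j _ => by split_ifs <;> norm_num
  simp only [Finset.sum_const, Finset.card_univ, Fintype.card_fin, nsmul_eq_mul, mul_one] at h2
  rw [h1] at h
  nlinarith

/-- The integer vectors with entries of absolute value at most `n²`. -/
noncomputable def integerNet (n : ℕ) : Finset (Fin n → ℤ) :=
  Fintype.piFinset fun _ => Finset.Icc (-(n : ℤ) ^ 2) ((n : ℤ) ^ 2)

lemma card_integerNet (n : ℕ) : (integerNet n).card = (2 * n ^ 2 + 1) ^ n := by
  rw [integerNet, Fintype.card_piFinset, Finset.prod_const, Finset.card_univ, Fintype.card_fin,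
    Int.card_Icc]
  congr 1
  zify
  rw [Int.toNat_of_nonneg (by linarith [sq_nonneg (n : ℤ)])]
  ring

/-- A quadratic form with null diagonal is controlled by its values at integer vectors. -/
lemma abs_quadratic_le_of_integerNet {n : ℕ} {E : UpperPair n → ℝ} {t : ℝ} (ht : 0 ≤ t)
    (hE : ∀ k ∈ integerNet n, |∑ p : UpperPair n, (k p.1.1 * k p.1.2 : ℝ) * E p| ≤
      t * Real.sqrt (∑ p : UpperPair n, (k p.1.1 * k p.1.2 : ℝ) ^ 2)) (x : Fin n → ℝ) :
    |∑ p : UpperPair n, x p.1.1 * x p.1.2 * E p| ≤ 5 * t * ∑ i, x i ^ 2 := by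
  have hEp : ∀ p, |E p| ≤ t := by
    intro p
    have hn1 : 1 ≤ (n : ℤ) ^ 2 := by
      have : 0 < n := lt_of_le_of_lt (Nat.zero_le _) p.1.1.2
      exact_mod_cast Nat.one_le_pow _ _ this
    set k : Fin n → ℤ := fun i => if i = p.1.1 ∨ i = p.1.2 then 1 else 0 with hk
    have hkm : k ∈ integerNet n := by
      refine Fintype.mem_piFinset.2 fun i => Finset.mem_Icc.2 ?_
      simp only [hk]
      split_ifs
      · constructor <;> linarith
      · constructor <;> linarith
    have hkp : ∀ q : UpperPair n, (k q.1.1 * k q.1.2 : ℝ) = if q = p then 1 else 0 := by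
      intro q
      have hq := q.2
      have hp := p.2
      by_cases hqp : q = p
      · subst hqp; simp [hk]
      · have : ¬ ((q.1.1 = p.1.1 ∨ q.1.1 = p.1.2) ∧ (q.1.2 = p.1.1 ∨ q.1.2 = p.1.2)) := by
          rintro ⟨h1 | h1, h2 | h2⟩
          · rw [h1, h2] at hq; exact lt_irrefl _ hq
          · exact hqp (Subtype.ext (Prod.ext h1 h2))
          · rw [h1, h2] at hq; exact lt_asymm hq hp
          · rw [h1, h2] at hq; exact lt_irrefl _ hq
        rw [if_neg hqp]
        rw [not_and_or] at this
        rcases this with h | h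
        · simp [hk, h]
        · simp [hk, h]
    have := hE k hkm
    simp only [hkp] at this
    simpa using this
  have hunit : ∀ x : Fin n → ℝ, ∑ i, x i ^ 2 = 1 →
      |∑ p : UpperPair n, x p.1.1 * x p.1.2 * E p| ≤ 5 * t := by
    intro x hx
    have hx1 : ∀ i, |x i| ≤ 1 := by
      intro i
      have : x i ^ 2 ≤ 1 := by
        rw [← hx]
        exact Finset.single_le_sum (f := fun i => x i ^ 2) (fun i _ => sq_nonneg _)
          (Finset.mem_univ i)
      exact abs_le_one_iff_mul_self_le_one.2 (by nlinarith)
    have hn0 : 0 < n := by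
      rcases Nat.eq_zero_or_pos n with h | h
      · subst h; simp at hx
      · exact h
    have hnR : (1 : ℝ) ≤ n := by exact_mod_cast hn0
    -- The scale is fine enough for a crude rounding bound: at most `n² / 2` pairs, each with error
    -- `2 M t`, contribute `M² t`. The price is only a logarithmic factor in the entropy of the net,
    -- which the target rate allows.
    set M : ℝ := (n : ℝ) ^ 2 with hM
    have hM0 : 1 ≤ M := one_le_pow₀ hnR
    set k : Fin n → ℤ := fun i => ⌊M * x i⌋ with hk
    have hk1 : ∀ i, |M * x i - k i| ≤ 1 := by
      intro i
      rw [abs_le]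
      constructor
      · linarith [Int.floor_le (M * x i)]
      · linarith [Int.lt_floor_add_one (M * x i)]
    have hMc : M = ((n : ℤ) ^ 2 : ℤ) := by push_cast; rfl
    have hkm' : ∀ i, -(n : ℤ) ^ 2 ≤ k i ∧ k i ≤ (n : ℤ) ^ 2 := by
      intro i
      obtain ⟨h1, h2⟩ := abs_le.1 (hx1 i)
      constructor
      · refine Int.le_floor.2 ?_
        push_cast
        rw [← hM]; nlinarith
      · have : M * x i ≤ M := by nlinarith
        have h3 := Int.floor_le_floor this
        rw [hMc, Int.floor_intCast] at h3
        rw [← hMc] at h3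
        exact h3
    have hkm : k ∈ integerNet n := Fintype.mem_piFinset.2 fun i => Finset.mem_Icc.2 (hkm' i)
    have hkM : ∀ i, |(k i : ℝ)| ≤ M := by
      intro i
      rw [hMc, ← Int.cast_abs]
      exact Int.cast_le.2 (abs_le.2 (hkm' i))
    have hMx : ∀ i, |M * x i| ≤ M := by
      intro i
      rw [abs_mul, abs_of_pos (by linarith : 0 < M)]
      nlinarith [hx1 i]
    have h1 : |∑ p : UpperPair n, (k p.1.1 * k p.1.2 : ℝ) * E p| ≤ t * (4 * M ^ 2) := by
      refine (hE k hkm).trans (mul_le_mul_of_nonneg_left ?_ ht)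
      refine (Real.sqrt_le_sqrt (sum_upperPair_sq_le fun i => (k i : ℝ))).trans ?_
      rw [Real.sqrt_sq (Finset.sum_nonneg fun i _ => sq_nonneg _)]
      calc ∑ i, (k i : ℝ) ^ 2 ≤ ∑ i, (2 * M ^ 2 * x i ^ 2 + 2) := by
            refine Finset.sum_le_sum fun i _ => ?_
            have := sq_le_one_iff_abs_le_one _ |>.2 (hk1 i)
            nlinarith [sq_nonneg (M * x i + (M * x i - k i))]
        _ = 2 * M ^ 2 + n * 2 := by
            rw [Finset.sum_add_distrib, ← Finset.mul_sum, hx]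
            simp
        _ ≤ 4 * M ^ 2 := by
            have : (n : ℝ) ≤ M ^ 2 := by
              rw [hM, ← pow_mul]
              exact le_self_pow₀ hnR (by norm_num)
            linarith
    have h2 : |∑ p : UpperPair n, (M * x p.1.1 * (M * x p.1.2) - k p.1.1 * k p.1.2) * E p| ≤
        M ^ 2 * t := by
      refine (Finset.abs_sum_le_sum_abs _ _).trans ?_
      calc _ ≤ ∑ p : UpperPair n, 2 * M * t := by
            refine Finset.sum_le_sum fun p _ => ?_
            rw [abs_mul]
            refine mul_le_mul ?_ (hEp p) (abs_nonneg _) (by positivity)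
            have e : M * x p.1.1 * (M * x p.1.2) - k p.1.1 * k p.1.2 =
              M * x p.1.1 * (M * x p.1.2 - k p.1.2) + (M * x p.1.1 - k p.1.1) * k p.1.2 := by ring
            rw [e]
            refine (abs_add_le _ _).trans ?_
            rw [abs_mul, abs_mul (M * x p.1.1 - k p.1.1)]
            have a1 := mul_le_mul (hMx p.1.1) (hk1 p.1.2) (abs_nonneg _) (by positivity)
            have a2 := mul_le_mul (hk1 p.1.1) (hkM p.1.2) (abs_nonneg _) (by positivity)
            linarith
        _ = Fintype.card (UpperPair n) * (2 * M * t) := by simp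
        _ ≤ (n : ℝ) ^ 2 / 2 * (2 * M * t) :=
            mul_le_mul_of_nonneg_right (card_upperPair_le n) (by positivity)
        _ = M ^ 2 * t := by rw [← hM]; ring
    have h3 : M ^ 2 * ∑ p : UpperPair n, x p.1.1 * x p.1.2 * E p =
        ∑ p : UpperPair n, (k p.1.1 * k p.1.2 : ℝ) * E p +
        ∑ p : UpperPair n, (M * x p.1.1 * (M * x p.1.2) - k p.1.1 * k p.1.2) * E p := by
      rw [← Finset.sum_add_distrib, Finset.mul_sum]
      exact Finset.sum_congr rfl fun p _ => by ring
    have h4 : M ^ 2 * |∑ p : UpperPair n, x p.1.1 * x p.1.2 * E p| ≤ M ^ 2 * (5 * t) := by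
      rw [← abs_of_pos (by positivity : 0 < M ^ 2), ← abs_mul, h3,
        abs_of_pos (by positivity : 0 < M ^ 2)]
      refine (abs_add_le _ _).trans ?_
      linarith
    exact le_of_mul_le_mul_left h4 (by positivity)
  set r := ∑ i, x i ^ 2 with hr
  have hr0 : 0 ≤ r := Finset.sum_nonneg fun i _ => sq_nonneg _
  rcases hr0.eq_or_lt with h0 | h0
  · have hx0 : ∀ i, x i = 0 := by
      intro i
      have := (Finset.sum_eq_zero_iff_of_nonneg (s := Finset.univ) (f := fun i => x i ^ 2)
        fun i _ => sq_nonneg _).1 h0.symm i (Finset.mem_univ i)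
      exact pow_eq_zero_iff (by norm_num) |>.1 this
    simp [hx0, ← h0]
  · have hs := Real.sqrt_pos.2 h0
    have hss : Real.sqrt r * Real.sqrt r = r := Real.mul_self_sqrt hr0
    have h1 := hunit (fun i => x i / Real.sqrt r) (by
      simp only [div_pow, Real.sq_sqrt hr0]
      rw [← Finset.sum_div, ← hr, div_self h0.ne'])
    have h2 : ∑ p : UpperPair n, x p.1.1 / Real.sqrt r * (x p.1.2 / Real.sqrt r) * E p =
        (∑ p : UpperPair n, x p.1.1 * x p.1.2 * E p) / r := by
      rw [Finset.sum_div]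
      refine Finset.sum_congr rfl fun p _ => ?_
      rw [div_mul_div_comm, hss]; ring
    rw [h2, abs_div, abs_of_pos h0, div_le_iff₀ h0] at h1
    exact h1

section Model

variable {Ω : Type*} [MeasurableSpace Ω] {P : Measure Ω} [IsProbabilityMeasure P] {n : ℕ}
  {x : Fin n → Circle} {A : Ω → Fin n → Fin n → ℝ}

/-- With high probability, the noise matrix has an operator norm of order at most `√(n log n)`. -/
lemma IsLatentModel.measure_operator_noise_le (h : IsLatentModel P affinity x A) {t : ℝ}
    (ht : 0 ≤ t) :
    P.real {ω | ¬ ∀ y : Fin n → ℝ, |∑ i, ∑ j, y i * y j * noise x (A ω) i j| ≤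
      10 * t * ∑ i, y i ^ 2} ≤ 2 * (2 * n ^ 2 + 1) ^ n * Real.exp (-t ^ 2 / 2) := by
  set E : Ω → UpperPair n → ℝ := fun ω p => A ω p.1.1 p.1.2 - affinity (x p.1.1) (x p.1.2) with hE
  set bad : ℝ → (Fin n → ℤ) → Set Ω := fun e k =>
    {ω | t * Real.sqrt (∑ p : UpperPair n, (e * (k p.1.1 * k p.1.2) : ℝ) ^ 2) <
      ∑ p : UpperPair n, (e * (k p.1.1 * k p.1.2) : ℝ) * E ω p} with hbad
  have hb : ∀ e k, P.real (bad e k) ≤ Real.exp (-t ^ 2 / 2) := fun e k =>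
    h.subgaussian (fun p => (e * (k p.1.1 * k p.1.2) : ℝ)) t ht
  have hsub : {ω | ¬ ∀ y : Fin n → ℝ, |∑ i, ∑ j, y i * y j * noise x (A ω) i j| ≤
      10 * t * ∑ i, y i ^ 2} ⊆ ⋃ k ∈ integerNet n, (bad 1 k ∪ bad (-1) k) := by
    intro ω hω
    by_contra hno
    refine hω fun y => ?_
    have hnet : ∀ k ∈ integerNet n, |∑ p : UpperPair n, (k p.1.1 * k p.1.2 : ℝ) * E ω p| ≤
        t * Real.sqrt (∑ p : UpperPair n, (k p.1.1 * k p.1.2 : ℝ) ^ 2) := by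
      intro k hk
      have h1 : ω ∉ bad 1 k := fun h' => hno (Set.mem_biUnion hk (Or.inl h'))
      have h2 : ω ∉ bad (-1) k := fun h' => hno (Set.mem_biUnion hk (Or.inr h'))
      have h1 := le_of_not_gt (Set.notMem_ofPred_iff.1 h1)
      have h2 := le_of_not_gt (Set.notMem_ofPred_iff.1 h2)
      simp only [one_mul, neg_mul, neg_sq, Finset.sum_neg_distrib] at h1 h2
      exact abs_le.2 ⟨by linarith, h1⟩
    have h3 := abs_quadratic_le_of_integerNet ht hnet y
    -- Each pair is counted twice in the full form: `10 = 2 · 5`.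
    have h4 := sum_sum_eq_two_mul_sum_upperPair (fun i j => y i * y j * noise x (A ω) i j)
      (fun i j => by
        simp only [noise, affinity, h.symm ω i j, geoDist_comm (x i), eq_comm (a := i)]
        ring) (fun i => by simp [noise])
    have h5 : ∑ p : UpperPair n, y p.1.1 * y p.1.2 * noise x (A ω) p.1.1 p.1.2 =
        ∑ p : UpperPair n, y p.1.1 * y p.1.2 * E ω p :=
      Finset.sum_congr rfl fun p _ => by rw [noise, if_neg p.2.ne]
    rw [h4, h5, abs_mul, abs_two]
    linarith
  refine (measureReal_mono hsub (measure_ne_top _ _)).trans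
    ((measureReal_biUnion_finset_le _ _).trans ?_)
  calc _ ≤ ∑ k ∈ integerNet n, 2 * Real.exp (-t ^ 2 / 2) := by
        refine Finset.sum_le_sum fun k _ => (measureReal_union_le _ _).trans ?_
        rw [two_mul]
        exact add_le_add (hb _ _) (hb _ _)
    _ = _ := by
        rw [Finset.sum_const, card_integerNet, nsmul_eq_mul]
        push_cast; ring

end Model

/-! ### The noise of the refinement step -/

/-- The pair `{i, j}`, for `i ≠ j`. -/
def upperPair {n : ℕ} {i j : Fin n} (h : i ≠ j) : UpperPair n :=
  if hij : i < j then ⟨(i, j), hij⟩ else ⟨(j, i), lt_of_le_of_ne (not_lt.1 hij) h.symm⟩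

lemma upperPair_mem {n : ℕ} {i j : Fin n} (h : i ≠ j) :
    ((upperPair h).1.1 = i ∧ (upperPair h).1.2 = j) ∨
      ((upperPair h).1.1 = j ∧ (upperPair h).1.2 = i) := by
  unfold upperPair
  split_ifs
  · exact Or.inl ⟨rfl, rfl⟩
  · exact Or.inr ⟨rfl, rfl⟩

/-- The data for which the subset `S` is localized at `y`, and the noise is excessive when the
candidates `a` and `b` are compared in the refinement step for the index `i`. -/
def refinementBad {n N : ℕ} (x : Fin n → Circle) (L : (Fin N → Fin N → ℝ) → Fin N → Circle)
    (S : Finset (Fin n)) (hS : S.card = N) (r : ℝ) (y : Fin N → Circle) (i : Fin n)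
    (a b : Circle) : Set (Fin n → Fin n → ℝ) :=
  {M | (∀ l, L (block S hS M) l = y l) ∧ r * geoDist a b <
    ∑ l, (M i (S.orderEmbOfFin hS l) - affinity (x i) (x (S.orderEmbOfFin hS l))) *
      (geoDist a (y l) - geoDist b (y l))}

lemma measurable_block {n N : ℕ} (S : Finset (Fin n)) (hS : S.card = N) :
    Measurable (block S hS) :=
  measurable_pi_lambda _ fun k => measurable_pi_lambda _ fun l => by
    unfold block
    fun_prop

lemma measurableSet_forall_eq {N : ℕ} {L : (Fin N → Fin N → ℝ) → Fin N → Circle}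
    (hL : ∀ l, Measurable fun M => (L M l : ℂ)) (y : Fin N → Circle) :
    MeasurableSet {M | ∀ l, L M l = y l} := by
  have e : {M | ∀ l, L M l = y l} = ⋂ l, {M | (L M l : ℂ) = y l} := by
    ext M
    simp only [Set.mem_iInter, Set.mem_ofPred_eq, Circle.coe_inj]
  rw [e]
  exact MeasurableSet.iInter fun l => measurableSet_eq_fun (hL l) measurable_const

lemma measurableSet_refinementBad {n N : ℕ} (x : Fin n → Circle)
    {L : (Fin N → Fin N → ℝ) → Fin N → Circle} (hL : ∀ l, Measurable fun M => (L M l : ℂ))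
    (S : Finset (Fin n)) (hS : S.card = N) (r : ℝ) (y : Fin N → Circle) (i : Fin n)
    (a b : Circle) : MeasurableSet (refinementBad x L S hS r y i a b) := by
  have h : MeasurableSet {M : Fin n → Fin n → ℝ | r * geoDist a b <
      ∑ l, (M i (S.orderEmbOfFin hS l) - affinity (x i) (x (S.orderEmbOfFin hS l))) *
        (geoDist a (y l) - geoDist b (y l))} :=
    measurableSet_lt measurable_const (by fun_prop)
  exact ((measurable_block S hS) (measurableSet_forall_eq hL y)).inter h

lemma IsLatentModel.noise_upperPair {Ω : Type*} [MeasurableSpace Ω]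
    {P : Measure Ω} {n : ℕ} {x : Fin n → Circle} {A : Ω → Fin n → Fin n → ℝ}
    (h : IsLatentModel P affinity x A) {i j : Fin n} (hij : i ≠ j)
    (ω : Ω) : A ω (upperPair hij).1.1 (upperPair hij).1.2 -
      affinity (x (upperPair hij).1.1) (x (upperPair hij).1.2) =
      A ω i j - affinity (x i) (x j) := by
  rcases upperPair_mem hij with ⟨h1, h2⟩ | ⟨h1, h2⟩
  · rw [h1, h2]
  · rw [h1, h2, h.symm, affinity, affinity, geoDist_comm]

lemma ne_orderEmbOfFin {n N : ℕ} {S : Finset (Fin n)} (hS : S.card = N) {i : Fin n} (hi : i ∉ S) (l : Fin N) :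
    i ≠ S.orderEmbOfFin hS l :=
  fun h => hi (h ▸ Finset.orderEmbOfFin_mem _ _ _)

lemma upperPair_orderEmbOfFin_injective {n N : ℕ} {S : Finset (Fin n)} (hS : S.card = N) {i : Fin n}
    (hi : i ∉ S) : Function.Injective fun l => upperPair (ne_orderEmbOfFin hS hi l) := by
  intro l l' hll
  have hll : upperPair (ne_orderEmbOfFin hS hi l) = upperPair (ne_orderEmbOfFin hS hi l') := hll
  apply (S.orderEmbOfFin hS).injective
  rcases upperPair_mem (ne_orderEmbOfFin hS hi l) with ⟨h1, h2⟩ | ⟨h1, h2⟩ <;>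
    rcases upperPair_mem (ne_orderEmbOfFin hS hi l') with ⟨h1', h2'⟩ | ⟨h1', h2'⟩
  · rw [← h2, ← h2', hll]
  · rw [hll, h1'] at h1
    exact absurd h1.symm (ne_orderEmbOfFin hS hi l')
  · rw [hll, h1'] at h1
    exact absurd h1 (ne_orderEmbOfFin hS hi l)
  · rw [← h1, ← h1', hll]

section Model

variable {Ω : Type*} [MeasurableSpace Ω] {P : Measure Ω} {n N : ℕ}
  {x : Fin n → Circle} {A : Ω → Fin n → Fin n → ℝ}

lemma IsLatentModel.measure_row_noise_le (h : IsLatentModel P affinity x A) {S : Finset (Fin n)}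
    (hS : S.card = N) {i : Fin n} (hi : i ∉ S) (c : Fin N → ℝ) {t : ℝ} (ht : 0 ≤ t) :
    P.real {ω | t * Real.sqrt (∑ l, c l ^ 2) < ∑ l, (A ω i (S.orderEmbOfFin hS l) -
      affinity (x i) (x (S.orderEmbOfFin hS l))) * c l} ≤ Real.exp (-t ^ 2 / 2) := by
  set e := fun l => upperPair (ne_orderEmbOfFin hS hi l) with he
  have hinj : Function.Injective e := upperPair_orderEmbOfFin_injective hS hi
  have h1 := h.subgaussian (Function.extend e c 0) t ht
  have h2 : ∑ p, Function.extend e c 0 p ^ 2 = ∑ l, c l ^ 2 :=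
    (Fintype.sum_of_injective e hinj _ _
      (fun p hp => by rw [Function.extend_apply' _ _ _ (by simpa using hp)]; simp)
      fun l => by rw [hinj.extend_apply]).symm
  have h3 : ∀ ω, ∑ p : UpperPair n, Function.extend e c 0 p *
      (A ω p.1.1 p.1.2 - affinity (x p.1.1) (x p.1.2)) =
      ∑ l, (A ω i (S.orderEmbOfFin hS l) - affinity (x i) (x (S.orderEmbOfFin hS l))) * c l :=
    fun ω => (Fintype.sum_of_injective e hinj _ _
      (fun p hp => by rw [Function.extend_apply' _ _ _ (by simpa using hp)]; simp)
      fun l => by rw [hinj.extend_apply, h.noise_upperPair, mul_comm]).symm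
  simp only [h2, h3] at h1
  exact h1

/-- The noise between `i ∉ S` and the points of `S` is independent of the noise inside `S`. -/
lemma IsLatentModel.indepFun_block_row (h : IsLatentModel P affinity x A) {S : Finset (Fin n)}
    (hS : S.card = N) {i : Fin n} (hi : i ∉ S) :
    IndepFun (fun ω => block S hS (A ω)) (fun ω l => A ω i (S.orderEmbOfFin hS l)) P := by
  classical
  set E : UpperPair n → Ω → ℝ := fun p ω => A ω p.1.1 p.1.2 - affinity (x p.1.1) (x p.1.2) with hE
  have hEm : ∀ p, Measurable (E p) := fun p =>
    (((measurable_pi_apply _).comp ((measurable_pi_apply _).comp h.measurable))).sub_const _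
  set U : Finset (UpperPair n) := Finset.univ.filter fun p => p.1.1 ∈ S ∧ p.1.2 ∈ S with hU
  set V : Finset (UpperPair n) :=
    Finset.univ.image fun l => upperPair (ne_orderEmbOfFin hS hi l) with hV
  have hdisj : Disjoint U V := by
    refine Finset.disjoint_left.2 fun p hp hpV => ?_
    obtain ⟨l, -, rfl⟩ := Finset.mem_image.1 hpV
    have hp := (Finset.mem_filter.1 hp).2
    rcases upperPair_mem (ne_orderEmbOfFin hS hi l) with ⟨h1, h2⟩ | ⟨h1, h2⟩
    · exact hi (h1 ▸ hp.1)
    · exact hi (h2 ▸ hp.2)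
  -- `U` holds the pairs inside `S` and `V` those joining `i` to `S`. As `i ∉ S` they are disjoint,
  -- and block and row are measurable functions of the two families of noise.
  have hind := h.indep.indepFun_finset U V hdisj hEm
  have hmemU : ∀ k l : Fin N, ∀ hkl : S.orderEmbOfFin hS k ≠ S.orderEmbOfFin hS l,
      upperPair hkl ∈ U := by
    intro k l hkl
    refine Finset.mem_filter.2 ⟨Finset.mem_univ _, ?_⟩
    have hk := Finset.orderEmbOfFin_mem S hS k
    have hl := Finset.orderEmbOfFin_mem S hS l
    rcases upperPair_mem hkl with ⟨h1, h2⟩ | ⟨h1, h2⟩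
    · rw [h1, h2]; exact ⟨hk, hl⟩
    · rw [h1, h2]; exact ⟨hl, hk⟩
  set φ : (U → ℝ) → Fin N → Fin N → ℝ := fun e k l =>
    if hkl : S.orderEmbOfFin hS k ≠ S.orderEmbOfFin hS l then
      e ⟨upperPair hkl, hmemU k l hkl⟩ +
        affinity (x (S.orderEmbOfFin hS k)) (x (S.orderEmbOfFin hS l)) else 0 with hφ
  set ψ : (V → ℝ) → Fin N → ℝ := fun e l =>
    e ⟨upperPair (ne_orderEmbOfFin hS hi l), Finset.mem_image.2 ⟨l, Finset.mem_univ _, rfl⟩⟩ +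
      affinity (x i) (x (S.orderEmbOfFin hS l)) with hψ
  have hφm : Measurable φ := by
    refine measurable_pi_lambda _ fun k => measurable_pi_lambda _ fun l => ?_
    simp only [hφ]
    split_ifs
    · exact (measurable_pi_apply _).add_const _
    · exact measurable_const
  have hψm : Measurable ψ :=
    measurable_pi_lambda _ fun l => (measurable_pi_apply _).add_const _
  have key := hind.comp hφm hψm
  convert key using 1
  · funext ω k l
    simp only [Function.comp, hφ]
    split_ifs with hkl
    · rw [h.noise_upperPair hkl ω, sub_add_cancel]; rfl
    · rw [not_not] at hkl
      rw [block, hkl, h.diag]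
  · funext ω l
    simp only [Function.comp, hψ]
    rw [h.noise_upperPair _ ω, sub_add_cancel]

variable [IsProbabilityMeasure P]

/-- On the event where the localization equals `y` the weights are deterministic, and this event is
independent of the row. The factor `P(localization = y)` is kept so that it can be summed over `y`.
-/
lemma IsLatentModel.measure_refinementBad_le (h : IsLatentModel P affinity x A)
    {L : (Fin N → Fin N → ℝ) → Fin N → Circle} (hL : ∀ l, Measurable fun M => (L M l : ℂ))
    {S : Finset (Fin n)} (hS : S.card = N) {t : ℝ} (ht : 0 ≤ t) (y : Fin N → Circle) {i : Fin n}
    (hi : i ∉ S) (a b : Circle) :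
    P.real {ω | A ω ∈ refinementBad x L S hS (t * Real.sqrt N) y i a b} ≤
      P.real {ω | ∀ l, L (block S hS (A ω)) l = y l} * Real.exp (-t ^ 2 / 2) := by
  set c : Fin N → ℝ := fun l => geoDist a (y l) - geoDist b (y l) with hc
  have hcs : Real.sqrt (∑ l, c l ^ 2) ≤ Real.sqrt N * geoDist a b := by
    have h0 := geoDist_nonneg a b
    rw [← Real.sqrt_sq h0, ← Real.sqrt_mul (Nat.cast_nonneg _)]
    apply Real.sqrt_le_sqrt
    calc ∑ l, c l ^ 2 ≤ ∑ _l : Fin N, geoDist a b ^ 2 :=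
          Finset.sum_le_sum fun l _ => sq_le_sq.2 (by
            rw [abs_of_nonneg h0]; exact abs_geoDist_sub_le _ _ _)
      _ = _ := by simp
  set s2 : Set (Fin N → ℝ) := {R | t * Real.sqrt N * geoDist a b <
    ∑ l, (R l - affinity (x i) (x (S.orderEmbOfFin hS l))) * c l} with hs2
  have hs2m : MeasurableSet s2 := measurableSet_lt measurable_const (by fun_prop)
  have h1 := (h.indepFun_block_row hS hi).measure_inter_preimage_eq_mul _ s2
    (measurableSet_forall_eq hL y) hs2m
  have e : {ω | A ω ∈ refinementBad x L S hS (t * Real.sqrt N) y i a b} =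
      (fun ω => block S hS (A ω)) ⁻¹' {M | ∀ l, L M l = y l} ∩
        (fun ω l => A ω i (S.orderEmbOfFin hS l)) ⁻¹' s2 := rfl
  rw [e, measureReal_def, h1, ENNReal.toReal_mul]
  refine mul_le_mul_of_nonneg_left ?_ ENNReal.toReal_nonneg
  refine le_trans (measureReal_mono fun ω hω => ?_) (h.measure_row_noise_le hS hi c ht)
  have hω : t * Real.sqrt N * geoDist a b < ∑ l, (A ω i (S.orderEmbOfFin hS l) -
    affinity (x i) (x (S.orderEmbOfFin hS l))) * c l := hω
  refine lt_of_le_of_lt ?_ hω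
  rw [mul_assoc]
  exact mul_le_mul_of_nonneg_left hcs ht

/-- With high probability, the noise is moderate for all the refinement steps based on a fixed
subset. -/
lemma IsLatentModel.measure_iUnion_refinementBad_le [NeZero N] (h : IsLatentModel P affinity x A)
    {L : (Fin N → Fin N → ℝ) → Fin N → Circle} (hL : ∀ l, Measurable fun M => (L M l : ℂ))
    {S : Finset (Fin n)} (hS : S.card = N) {t : ℝ} (ht : 0 ≤ t) :
    P.real {ω | A ω ∈ ⋃ (i : {i // i ∉ S}) (a : ZMod N) (b : ZMod N) (β : Fin N ≃ ZMod N),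
      refinementBad x L S hS (t * Real.sqrt N) (fun l => ZMod.toCircle (β l)) i
        (ZMod.toCircle a) (ZMod.toCircle b)} ≤ n * N ^ 2 * Real.exp (-t ^ 2 / 2) := by
  classical
  have h1 : ∀ (i : {i // i ∉ S}) (a b : ZMod N),
      P.real (⋃ β : Fin N ≃ ZMod N, {ω | A ω ∈ refinementBad x L S hS (t * Real.sqrt N)
        (fun l => ZMod.toCircle (β l)) i (ZMod.toCircle a) (ZMod.toCircle b)}) ≤
        Real.exp (-t ^ 2 / 2) := by
    intro i a b
    refine (measureReal_iUnion_fintype_le _).trans ((Finset.sum_le_sum fun β _ =>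
      h.measure_refinementBad_le hL hS ht _ i.2 _ _).trans ?_)
    -- Distinct enumerations are disjoint events, so their probabilities sum to at most `1` and no
    -- factor `N!` appears.
    rw [← Finset.sum_mul, ← measureReal_iUnion_fintype]
    · exact (mul_le_mul_of_nonneg_right measureReal_le_one (Real.exp_pos _).le).trans
        (one_mul _).le
    · intro β β' hββ
      refine Set.disjoint_left.2 fun ω h1 h2 => hββ (Equiv.ext fun l => ?_)
      exact ZMod.injective_toCircle ((h1 l).symm.trans (h2 l))
    · exact fun β => ((measurable_block S hS).comp h.measurable) (measurableSet_forall_eq hL _)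
  have e : {ω | A ω ∈ ⋃ (i : {i // i ∉ S}) (a : ZMod N) (b : ZMod N) (β : Fin N ≃ ZMod N),
      refinementBad x L S hS (t * Real.sqrt N) (fun l => ZMod.toCircle (β l)) i
        (ZMod.toCircle a) (ZMod.toCircle b)} =
      ⋃ q : {i // i ∉ S} × ZMod N × ZMod N, ⋃ β : Fin N ≃ ZMod N,
        {ω | A ω ∈ refinementBad x L S hS (t * Real.sqrt N)
        (fun l => ZMod.toCircle (β l)) q.1 (ZMod.toCircle q.2.1) (ZMod.toCircle q.2.2)} := by
    ext ω
    simp only [Set.mem_ofPred_eq, Set.mem_iUnion, Prod.exists]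
  rw [e]
  refine (measureReal_iUnion_fintype_le _).trans ((Finset.sum_le_sum fun q _ =>
    h1 q.1 q.2.1 q.2.2).trans ?_)
  rw [Finset.sum_const, nsmul_eq_mul]
  refine mul_le_mul_of_nonneg_right ?_ (Real.exp_pos _).le
  rw [Finset.card_univ, Fintype.card_prod, Fintype.card_prod, ZMod.card, Nat.cast_mul,
    Nat.cast_mul, ← sq]
  refine mul_le_mul_of_nonneg_right ?_ (by positivity)
  exact Nat.cast_le.2 ((Fintype.card_subtype_le _).trans (Fintype.card_fin n).le)

/-- The split is independent of the data: conditioning on its value reduces to deterministic splits,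
with no union bound. -/
lemma measure_mem_of_uniformSplit_le {T : Ω → Split n} (hT : IsUniformSplit P A T)
    {F : Split n → Set (Fin n → Fin n → ℝ)} (hF : ∀ t, MeasurableSet (F t)) {c : ℝ}
    (hc : ∀ t, P.real {ω | A ω ∈ F t} ≤ c) : P.real {ω | A ω ∈ F (T ω)} ≤ c := by
  classical
  have e : {ω | A ω ∈ F (T ω)} = ⋃ t : Split n, A ⁻¹' F t ∩ T ⁻¹' {t} := by
    ext ω; simp
  have h1 : ∀ t, P.real (A ⁻¹' F t ∩ T ⁻¹' {t}) ≤ c * P.real (T ⁻¹' {t}) := by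
    intro t
    rw [measureReal_def, hT.indep.measure_inter_preimage_eq_mul _ _ (hF t)
      (measurableSet_singleton t), ENNReal.toReal_mul]
    exact mul_le_mul_of_nonneg_right (hc t) ENNReal.toReal_nonneg
  rw [e]
  refine (measureReal_iUnion_fintype_le _).trans ((Finset.sum_le_sum fun t _ => h1 t).trans ?_)
  rw [← Finset.mul_sum, ← measureReal_iUnion_fintype]
  · have : (⋃ t : Split n, T ⁻¹' {t}) = Set.univ := by
      ext ω; simp
    rw [this, probReal_univ, mul_one]
  · intro t t' htt
    exact Set.disjoint_left.2 fun ω h1 h2 => htt (h1.symm.trans h2)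
  · exact fun t => hT.measurable (measurableSet_singleton t)

end Model

/-! ### The guarantee for one subset -/

/-- The data for which the noise is excessive in one of the refinement steps based on `S`. -/
def refinementNoisy {n N : ℕ} (x : Fin n → Circle) (L : (Fin N → Fin N → ℝ) → Fin N → Circle)
    (S : Finset (Fin n)) (hS : S.card = N) (r : ℝ) [NeZero N] : Set (Fin n → Fin n → ℝ) :=
  ⋃ (i : {i // i ∉ S}) (a : ZMod N) (b : ZMod N) (β : Fin N ≃ ZMod N),
    refinementBad x L S hS r (fun l => ZMod.toCircle (β l)) i (ZMod.toCircle a) (ZMod.toCircle b)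

lemma measurableSet_refinementNoisy {n N : ℕ} [NeZero N] (x : Fin n → Circle)
    {L : (Fin N → Fin N → ℝ) → Fin N → Circle} (hL : ∀ l, Measurable fun M => (L M l : ℂ))
    (S : Finset (Fin n)) (hS : S.card = N) (r : ℝ) :
    MeasurableSet (refinementNoisy x L S hS r) :=
  MeasurableSet.iUnion fun _ => MeasurableSet.iUnion fun _ => MeasurableSet.iUnion fun _ =>
    MeasurableSet.iUnion fun _ => measurableSet_refinementBad x hL S hS r _ _ _ _

/-- The bad events are one-sided; exchanging the candidates `a` and `b` gives the other sign. -/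
lemma abs_sum_le_of_notMem_refinementNoisy {n N : ℕ} [NeZero N] {x : Fin n → Circle}
    {L : (Fin N → Fin N → ℝ) → Fin N → Circle} {S : Finset (Fin n)} {hS : S.card = N} {r : ℝ}
    {M : Fin n → Fin n → ℝ} (hM : M ∉ refinementNoisy x L S hS r) {β : Fin N ≃ ZMod N}
    (hβ : ∀ l, L (block S hS M) l = ZMod.toCircle (β l)) {i : Fin n} (hi : i ∉ S) (a b : ZMod N) :
    |∑ l, (M i (S.orderEmbOfFin hS l) - affinity (x i) (x (S.orderEmbOfFin hS l))) *
      (geoDist (ZMod.toCircle a) (L (block S hS M) l) -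
        geoDist (ZMod.toCircle b) (L (block S hS M) l))| ≤
      r * geoDist (ZMod.toCircle a) (ZMod.toCircle b) := by
  have key : ∀ a b : ZMod N, ∑ l, (M i (S.orderEmbOfFin hS l) -
      affinity (x i) (x (S.orderEmbOfFin hS l))) * (geoDist (ZMod.toCircle a) (ZMod.toCircle (β l)) -
        geoDist (ZMod.toCircle b) (ZMod.toCircle (β l))) ≤
      r * geoDist (ZMod.toCircle a) (ZMod.toCircle b) := by
    intro a b
    by_contra hlt
    refine hM ?_
    simp only [refinementNoisy, Set.mem_iUnion]
    exact ⟨⟨i, hi⟩, a, b, β, hβ, not_le.1 hlt⟩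
  simp only [hβ]
  refine abs_le.2 ⟨?_, key a b⟩
  have h1 := key b a
  rw [geoDist_comm (ZMod.toCircle b) (ZMod.toCircle a)] at h1
  rw [neg_le, ← Finset.sum_neg_distrib]
  refine (le_of_eq (Finset.sum_congr rfl fun l _ => ?_)).trans h1
  ring

/-- With a representative subset and a moderate noise, the refined positions are accurate up to a
global isometry. -/
lemma exists_isometry_of_notMem_refinementNoisy {n N : ℕ} [NeZero N] (hN : 2 < N) (hn : n = 4 * N)
    {x : Fin n → Circle} {M : Fin n → Fin n → ℝ} (hMs : ∀ i j, M i j = M j i)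
    (hMd : ∀ i, M i i = 0) {L : (Fin N → Fin N → ℝ) → Fin N → Circle}
    (hL : ∀ M : Fin N → Fin N → ℝ, (∀ i j, M i j = M j i) → IsSpectralLocalization M (L M))
    {S : Finset (Fin n)} {hS : S.card = N} {σ : Equiv.Perm (Fin n)} {κ s m r h : ℝ}
    (hσ : ∀ i, geoDist (x i) (root n (σ i)) ≤ κ) (hrep : IsRepresentative σ s S)
    (hm : ∀ y : Fin n → ℝ, |∑ i, ∑ j, y i * y j * noise x M i j| ≤ m * ∑ i, y i ^ 2)
    (hr : M ∉ refinementNoisy x L S hS r) (hh1 : 1 ≤ h) (hm0 : 0 ≤ m)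
    (hh : m + (κ + 2 * Real.pi / N * s) * N + 1 ≤ h) (hrh : r ≤ h) (hhN : h ≤ 0.005 * N) :
    ∃ Q : ℂ ≃ₗᵢ[ℝ] ℂ, ∀ i ∉ S, ∀ z, IsRefined M S hS (L (block S hS M)) i z →
      geoDist z (act Q (x i)) ≤ 1100000 * h / N := by
  have hloc := hL (block S hS M) fun i j => hMs _ _
  obtain ⟨τ, hτ⟩ := hrep.exists_equiv hn hS
  have hβ : ∃ β : Fin N ≃ ZMod N, ∀ l, L (block S hS M) l = ZMod.toCircle (β l) := by
    obtain ⟨w, -, hw⟩ := hloc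
    exact hw.exists_equiv
  obtain ⟨β, hβ⟩ := hβ
  refine exists_isometry_geoDist_refined_le hN hMd hloc (τ := τ) (m := m)
    (κ := κ + 2 * Real.pi / N * s) hh1 hh (by linarith) hhN hm
    (fun l => (geoDist_triangle _ (root n (σ (S.orderEmbOfFin hS l))) _).trans
      (add_le_add (hσ _) (hτ l))) fun i hi a b => ?_
  exact (abs_sum_le_of_notMem_refinementNoisy hr hβ hi a b).trans
    (mul_le_mul_of_nonneg_right hrh (geoDist_nonneg _ _))

lemma exp_neg_mul_log {n : ℕ} (hn : 0 < n) (k : ℕ) :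
    Real.exp (-(k * Real.log n)) = 1 / (n : ℝ) ^ k := by
  rw [Real.exp_neg, Real.exp_nat_mul, Real.exp_log (Nat.cast_pos.2 hn), one_div]

lemma exists_forall_sqrt_log_div_le {ε : ℝ} (hε : 0 < ε) :
    ∃ n₁ : ℕ, ∀ n : ℕ, n₁ ≤ n → Real.sqrt (Real.log n / n) ≤ ε := by
  have h1 : Filter.Tendsto (fun n : ℕ => Real.sqrt (Real.log n / n)) Filter.atTop (nhds 0) := by
    have h2 : Filter.Tendsto (fun y : ℝ => Real.log y / y) Filter.atTop (nhds 0) := by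
      simpa using Real.isLittleO_log_id_atTop.tendsto_div_nhds_zero
    have h3 := (h2.comp tendsto_natCast_atTop_atTop).sqrt
    rw [Real.sqrt_zero] at h3
    exact h3
  exact Filter.eventually_atTop.1 ((h1.eventually (gt_mem_nhds hε)).mono fun n hn => hn.le)

/-! ### The main result -/

section Main

variable {n : ℕ} [NeZero (n / 4)] {x : Fin n → Circle}
  {loc : Finset (Fin n) → (Fin (n / 4) → Fin (n / 4) → ℝ) → Fin (n / 4) → Circle}

/-- The success of the procedure on the data `M`, when both subsets are representative and the noise
is moderate. -/
lemma IsOutput.exists_dInf_le {M : Fin n → Fin n → ℝ} {t : Split n} {xhat : Fin n → Circle}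
    (hout : IsOutput loc M t xhat) (hn : n = 4 * (n / 4)) (hN : 2 < n / 4)
    (hloc : IsSpectralLocalizer loc) (hMs : ∀ i j, M i j = M j i) (hMd : ∀ i, M i i = 0)
    {σ : Equiv.Perm (Fin n)} {κ s m r h : ℝ}
    (hσ : ∀ i, geoDist (x i) (root n (σ i)) ≤ κ) (hrep : IsRepresentative σ s t.1.1)
    (hrep' : IsRepresentative σ s t.1.2)
    (hm : ∀ y : Fin n → ℝ, |∑ i, ∑ j, y i * y j * noise x M i j| ≤ m * ∑ i, y i ^ 2)
    (hr : M ∉ refinementNoisy x (loc t.1.1) t.1.1 t.2.1 r)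
    (hr' : M ∉ refinementNoisy x (loc t.1.2) t.1.2 t.2.2.1 r) (hh1 : 1 ≤ h) (hm0 : 0 ≤ m)
    (hh : m + (κ + 2 * Real.pi / (n / 4 : ℕ) * s) * (n / 4 : ℕ) + 1 ≤ h) (hrh : r ≤ h)
    (hhN : h ≤ 0.005 * (n / 4 : ℕ)) (hκ : 2 * κ + 4 * (1100000 * h / (n / 4 : ℕ)) ≤ 0.1) :
    ∃ Q : ℂ ≃ₗᵢ[ℝ] ℂ, dInf xhat (fun i => act Q (x i)) ≤ 5 * (1100000 * h / (n / 4 : ℕ)) := by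
  obtain ⟨x2, x2', Q, h2, h2', hQ, hxhat⟩ := hout
  have : NeZero n := ⟨by omega⟩
  obtain ⟨Q₁, hQ₁⟩ := exists_isometry_of_notMem_refinementNoisy hN hn hMs hMd
    (hloc.output t.1.1) (hS := t.2.1) hσ hrep hm hr hh1 hm0 hh hrh hhN
  obtain ⟨Q₂, hQ₂⟩ := exists_isometry_of_notMem_refinementNoisy hN hn hMs hMd
    (hloc.output t.1.2) (hS := t.2.2.1) hσ hrep' hm hr' hh1 hm0 hh hrh hhN
  refine ⟨Q₁, ?_⟩
  have : Nonempty (Fin n) := ⟨⟨0, by omega⟩⟩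
  refine ciSup_le fun j => ?_
  rw [hxhat j]
  exact hQ.geoDist_le (by omega) hσ (by rw [t.2.1]; omega) (by rw [t.2.2.1]; omega) t.2.2.2
    (fun i hi => hQ₁ i hi _ (h2 i hi)) (fun i hi => hQ₂ i hi _ (h2' i hi)) hκ j

/-- The random event on which the procedure may fail has a small probability. -/
lemma measure_failure_le {Ω : Type*} [MeasurableSpace Ω] {P : Measure Ω} [IsProbabilityMeasure P]
    {A : Ω → Fin n → Fin n → ℝ} {T : Ω → Split n} (hA : IsLatentModel P affinity x A)
    (hT : IsUniformSplit P A T) (hloc : IsSpectralLocalizer loc) (hn : n = 4 * (n / 4))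
    (σ : Equiv.Perm (Fin n)) {lam s t u : ℝ} (hl0 : 0 ≤ lam) (hl1 : lam ≤ 1) (ht : 0 ≤ t)
    (hu : 0 ≤ u) :
    P.real {ω | ¬ (IsRepresentative σ s (T ω).1.1 ∧ IsRepresentative σ s (T ω).1.2 ∧
      (∀ y : Fin n → ℝ, |∑ i, ∑ j, y i * y j * noise x (A ω) i j| ≤ 10 * t * ∑ i, y i ^ 2) ∧
      A ω ∉ refinementNoisy x (loc (T ω).1.1) (T ω).1.1 (T ω).2.1
        (u * Real.sqrt (n / 4 : ℕ)) ∧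
      A ω ∉ refinementNoisy x (loc (T ω).1.2) (T ω).1.2 (T ω).2.2.1
        (u * Real.sqrt (n / 4 : ℕ)))} ≤
      4 * (n + 1) * Real.exp ((n / 4 : ℕ) * lam ^ 2 - lam * s) +
      (2 * (2 * n ^ 2 + 1) ^ n * Real.exp (-t ^ 2 / 2) +
      2 * (n * (n / 4 : ℕ) ^ 2 * Real.exp (-u ^ 2 / 2))) := by
  set F : Split n → Set (Fin n → Fin n → ℝ) := fun p =>
    refinementNoisy x (loc p.1.1) p.1.1 p.2.1 (u * Real.sqrt (n / 4 : ℕ)) ∪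
    refinementNoisy x (loc p.1.2) p.1.2 p.2.2.1 (u * Real.sqrt (n / 4 : ℕ)) with hF
  have h3 := measure_mem_of_uniformSplit_le hT (F := F)
    (fun p => (measurableSet_refinementNoisy x (hloc.measurable _) _ _ _).union
      (measurableSet_refinementNoisy x (hloc.measurable _) _ _ _))
    (c := 2 * (n * (n / 4 : ℕ) ^ 2 * Real.exp (-u ^ 2 / 2))) (fun p => by
      rw [two_mul]
      exact (measureReal_union_le {ω | A ω ∈ refinementNoisy x (loc p.1.1) p.1.1 p.2.1
          (u * Real.sqrt (n / 4 : ℕ))} {ω | A ω ∈ refinementNoisy x (loc p.1.2) p.1.2 p.2.2.1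
          (u * Real.sqrt (n / 4 : ℕ))}).trans (add_le_add
        (hA.measure_iUnion_refinementBad_le (hloc.measurable _) _ hu)
        (hA.measure_iUnion_refinementBad_le (hloc.measurable _) _ hu)))
  have h1 := measure_not_isRepresentative_le hn hT σ (s := s) hl0 hl1
  have h2 := hA.measure_operator_noise_le ht
  refine le_trans (measureReal_mono ?_) ((measureReal_union_le _ _).trans
    (add_le_add h1 ((measureReal_union_le _ _).trans (add_le_add h2 h3))))
  intro ω hω
  simp only [Set.mem_union, Set.mem_ofPred_eq, hF] at hω ⊢
  tauto

end Main

/-! ### Choice of the parameters and conclusion. -/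

lemma two_mul_two_mul_sq_add_one_pow_mul_exp_le {n : ℕ} (hn : 3 ≤ n) {t : ℝ}
    (ht : 9 * (n * Real.log n) ≤ t ^ 2) :
    2 * (2 * (n : ℝ) ^ 2 + 1) ^ n * Real.exp (-t ^ 2 / 2) ≤ 1 / (n : ℝ) ^ 2 := by
  have hnR : (3 : ℝ) ≤ n := by exact_mod_cast hn
  have hlog : 0 ≤ Real.log n := Real.log_nonneg (by linarith)
  -- `2n² + 1 ≤ n³` bounds the entropy of the net by `3 n log n`, while the Gaussian exponent is at
  -- least `4.5 n log n`.
  have h1 : (2 * (n : ℝ) ^ 2 + 1) ^ n ≤ Real.exp (3 * (n * Real.log n)) := by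
    calc _ ≤ ((n : ℝ) ^ 3) ^ n := pow_le_pow_left₀ (by positivity) (by nlinarith [sq_nonneg (n : ℝ)]) _
      _ = _ := by
        rw [← Real.exp_log (by positivity : 0 < ((n : ℝ) ^ 3) ^ n), Real.log_pow, Real.log_pow]
        congr 1
        push_cast; ring
  have h2 : (2 : ℝ) * Real.exp (-(3 * Real.log n)) ≤ 1 / (n : ℝ) ^ 2 := by
    have := exp_neg_mul_log (n := n) (by omega) 3
    push_cast at this
    rw [this, mul_one_div, div_le_div_iff₀ (by positivity) (by positivity)]
    nlinarith [sq_nonneg (n : ℝ)]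
  refine le_trans ?_ h2
  calc _ ≤ 2 * Real.exp (3 * (n * Real.log n)) * Real.exp (-t ^ 2 / 2) := by gcongr
    _ = 2 * Real.exp (3 * (n * Real.log n) + -t ^ 2 / 2) := by rw [mul_assoc, ← Real.exp_add]
    _ ≤ _ := by
      gcongr
      nlinarith

end Seriation

theorem corollary4p2 (c_a : ℝ) (hc_a : 0 ≤ c_a) :
    ∃ (C : ℝ) (n₁ : ℕ), 0 < C ∧
      ∀ (n : ℕ), n₁ ≤ n → 4 ∣ n →
      ∀ (x : Fin n → Circle),
        Seriation.distToRegular x ≤ c_a * Real.sqrt (Real.log n / n) →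
      ∀ (Ω : Type*) [MeasurableSpace Ω] (P : MeasureTheory.Measure Ω)
        [MeasureTheory.IsProbabilityMeasure P]
        (A : Ω → Fin n → Fin n → ℝ) (T : Ω → Seriation.Split n)
        (loc : Finset (Fin n) → (Fin (n / 4) → Fin (n / 4) → ℝ) → Fin (n / 4) → Circle),
        Seriation.IsLatentModel P Seriation.affinity x A →
        Seriation.IsUniformSplit P A T →
        Seriation.IsSpectralLocalizer loc →
        ∃ G : Set Ω, MeasurableSet G ∧ 1 - 9 / (n : ℝ) ^ 2 ≤ P.real G ∧
          ∀ ω ∈ G, ∀ xhat : Fin n → Circle, Seriation.IsOutput loc (A ω) (T ω) xhat →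
            ∃ Q : ℂ ≃ₗᵢ[ℝ] ℂ,
              Seriation.dInf xhat (fun i => Seriation.act Q (x i)) ≤
                C * Real.sqrt (Real.log n / n) := by
  -- For `h = (c_a + 200) n δ`, this makes `h ≤ 0.005 n / 4`, and `17600000 · 5 · 10⁻⁹ = 0.088`
  -- leaves room in the synchronization condition `≤ 0.1`.
  obtain ⟨n₁, hn₁⟩ := Seriation.exists_forall_sqrt_log_div_le
    (ε := 0.000000005 / (c_a + 200)) (by positivity)
  refine ⟨22000000 * (c_a + 200), max n₁ 12, by positivity, ?_⟩
  intro n hn hdvd x hx Ω _ P _ A T loc hA hT hloc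
  have hn12 : 12 ≤ n := (le_max_right _ _).trans hn
  have hsmall := hn₁ n ((le_max_left _ _).trans hn)
  have hn4 : n = 4 * (n / 4) := by omega
  have hN : 2 < n / 4 := by omega
  have : NeZero (n / 4) := ⟨by omega⟩
  have hnR : (12 : ℝ) ≤ n := by exact_mod_cast hn12
  have hNR : ((n / 4 : ℕ) : ℝ) = n / 4 := by
    have : (n : ℝ) = 4 * (n / 4 : ℕ) := by exact_mod_cast hn4
    linarith
  have hlog : 1 ≤ Real.log n := by
    rw [Real.le_log_iff_exp_le (by linarith)]
    linarith [Real.exp_one_lt_d9]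
  set δ := Real.sqrt (Real.log n / n) with hδ
  have hδ0 : 0 ≤ δ := Real.sqrt_nonneg _
  have hδsq : n * δ ^ 2 = Real.log n := by
    rw [hδ, Real.sq_sqrt (by positivity)]
    field_simp
  rw [le_div_iff₀ (by positivity)] at hsmall
  have hcδ : 0 ≤ c_a * δ := mul_nonneg hc_a hδ0
  have hδ1 : δ ≤ 1 := by linarith
  have hnδ : 1 ≤ n * δ := by
    have : 1 ^ 2 ≤ (n * δ) ^ 2 := by
      have : (n * δ) ^ 2 = n * Real.log n := by rw [← hδsq]; ring
      rw [this, one_pow]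
      exact one_le_mul_of_one_le_of_one_le (by linarith) hlog
    exact le_of_sq_le_sq this (by positivity)
  have hpi := Real.pi_lt_d2
  obtain ⟨σ, hσ⟩ := Seriation.exists_forall_regular hx
  set u := 4 * Real.sqrt (Real.log n) with hu
  have hu2 : u ^ 2 = 16 * Real.log n := by
    rw [hu, mul_pow, Real.sq_sqrt (by linarith)]; norm_num
  have huN : u * Real.sqrt (n / 4 : ℕ) = 2 * (n * δ) := by
    rw [← sq_eq_sq₀ (by positivity) (by positivity), mul_pow, hu2, Real.sq_sqrt (by positivity),
      hNR, ← hδsq]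
    ring
  -- With `n δ² = log n`, the three exponents are at most `-5 log n` for the subsets, `-4.5 n log n`
  -- for the operator norm and `-8 log n` for the refinement. They beat the respective prefactors
  -- `4(n + 1)`, the size of the net, and `n³ / 8`.
  have hfail := Seriation.measure_failure_le hA hT hloc hn4 σ (lam := δ) (s := 6 * (n * δ))
    (t := 3 * (n * δ)) (u := u) hδ0 hδ1 (by positivity) (by positivity)
  set bad := {ω | ¬ (Seriation.IsRepresentative σ (6 * (n * δ)) (T ω).1.1 ∧
      Seriation.IsRepresentative σ (6 * (n * δ)) (T ω).1.2 ∧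
      (∀ y : Fin n → ℝ, |∑ i, ∑ j, y i * y j * Seriation.noise x (A ω) i j| ≤
        10 * (3 * (n * δ)) * ∑ i, y i ^ 2) ∧
      A ω ∉ Seriation.refinementNoisy x (loc (T ω).1.1) (T ω).1.1 (T ω).2.1
        (u * Real.sqrt (n / 4 : ℕ)) ∧
      A ω ∉ Seriation.refinementNoisy x (loc (T ω).1.2) (T ω).1.2 (T ω).2.2.1
        (u * Real.sqrt (n / 4 : ℕ)))} with hbad
  have hbad9 : P.real bad ≤ 9 / (n : ℝ) ^ 2 := by
    have h1 : 4 * ((n : ℝ) + 1) * Real.exp ((n / 4 : ℕ) * δ ^ 2 - δ * (6 * (n * δ))) ≤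
        1 / (n : ℝ) ^ 2 := by
      have e : ((n / 4 : ℕ) : ℝ) * δ ^ 2 - δ * (6 * (n * δ)) ≤ -((5 : ℕ) * Real.log n) := by
        rw [hNR, ← hδsq]
        push_cast
        linarith [mul_nonneg (by linarith : (0 : ℝ) ≤ n) (sq_nonneg δ)]
      refine (mul_le_mul_of_nonneg_left (Real.exp_le_exp.2 e) (by positivity)).trans ?_
      rw [Seriation.exp_neg_mul_log (by omega), mul_one_div,
        div_le_div_iff₀ (by positivity) (by positivity)]
      have : 4 * ((n : ℝ) + 1) ≤ n ^ 3 := by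
        have : (12 : ℝ) ^ 2 * n ≤ n ^ 2 * n := by gcongr
        linarith
      calc _ ≤ (n : ℝ) ^ 3 * n ^ 2 := mul_le_mul_of_nonneg_right this (by positivity)
        _ = _ := by ring
    have h2 := Seriation.two_mul_two_mul_sq_add_one_pow_mul_exp_le (n := n) (by omega)
      (t := 3 * (n * δ)) (by rw [← hδsq]; exact le_of_eq (by ring))
    have h3 : 2 * ((n : ℝ) * (n / 4 : ℕ) ^ 2 * Real.exp (-u ^ 2 / 2)) ≤ 1 / (n : ℝ) ^ 2 := by
      have e : -u ^ 2 / 2 = -((8 : ℕ) * Real.log n) := by rw [hu2]; push_cast; ring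
      rw [e, Seriation.exp_neg_mul_log (by omega), hNR, mul_one_div, mul_div_assoc',
        div_le_div_iff₀ (by positivity) (by positivity)]
      have : (n : ℝ) ^ 5 ≤ n ^ 8 := pow_le_pow_right₀ (by linarith) (by norm_num)
      have h0 : (0 : ℝ) ≤ n ^ 5 := by positivity
      linarith
    have h4 : 1 / (n : ℝ) ^ 2 + (1 / (n : ℝ) ^ 2 + 1 / (n : ℝ) ^ 2) ≤ 9 / (n : ℝ) ^ 2 := by
      rw [← add_div, ← add_div]
      gcongr
      norm_num
    linarith
  -- A measurable hull of the failure set has the same probability, which avoids proving that the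
  -- set itself is measurable.
  refine ⟨(toMeasurable P bad)ᶜ, (measurableSet_toMeasurable _ _).compl, ?_, ?_⟩
  · rw [probReal_compl_eq_one_sub (measurableSet_toMeasurable _ _), measureReal_def,
      measure_toMeasurable, ← measureReal_def]
    linarith
  · intro ω hω xhat hout
    have hω : ω ∉ bad := fun h => hω (subset_toMeasurable P bad h)
    rw [hbad, Set.notMem_ofPred_iff, not_not] at hω
    obtain ⟨hrep, hrep', hop, hr, hr'⟩ := hω
    have hbound : 5 * (1100000 * ((c_a + 200) * (n * δ)) / (n / 4 : ℕ)) =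
        22000000 * (c_a + 200) * δ := by
      rw [hNR]; field_simp; ring
    have hcn : 0 ≤ c_a * (n * δ) := mul_nonneg hc_a (by positivity)
    have hπ : Real.pi * (n * δ) ≤ 3.15 * (n * δ) := by gcongr
    have hn5 := mul_le_mul_of_nonneg_left hsmall (by linarith : (0 : ℝ) ≤ n)
    rw [← hbound]
    -- In units of `n δ ≥ 1`, the perturbation is at most `30` (noise) `+ c_a / 4` (latent
    -- positions) `+ 12π` (sampling) `+ 1` (diagonal), which is below `c_a + 200`.
    refine hout.exists_dInf_le hn4 hN hloc (hA.symm ω) (hA.diag ω) hσ hrep hrep' hop hr hr'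
      ?_ (by positivity) ?_ ?_ ?_ ?_
    · linarith
    · have e : (c_a * δ + 2 * Real.pi / (n / 4 : ℕ) * (6 * (n * δ))) * (n / 4 : ℕ) =
          (c_a / 4 + 12 * Real.pi) * (n * δ) := by
        rw [hNR]; field_simp; ring
      rw [e]
      linarith
    · rw [huN]
      linarith
    · rw [hNR]
      linarith
    · have e : 4 * (1100000 * ((c_a + 200) * (n * δ)) / (n / 4 : ℕ)) =
          17600000 * (δ * (c_a + 200)) := by
        rw [hNR]; field_simp; ring
      rw [e]
      linarith
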